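/- For $\lambda\in\mathbb{R}^m$ put $P(\lambda)=\max_i\sum_{k\ne i}\operatorname{arccot}(\lambda_k)$ and $Q(\lambda)=\sum_k\operatorname{arccot}(\lambda_k)$, where $\operatorname{arccot}$ takes values in $(0,\pi)$. For a positive definite real $(1,1)$-form $\chi$ on a complex manifold of dimension $m$ and constants $0<\theta<\Theta<\pi$, let $\Gamma_{\chi,\theta,\Theta}$ be the set of real $(1,1)$-forms $\omega$ such that at every point the eigenvalues $\lambda_1,\dots,\lambda_m$ of $\omega$ with respect to $\chi$ (that is, of $A^{-1}B$, where $A$ and $B$ are the Hermitian coefficient matrices of $\chi$ and $\omega$ in local coordinates) satisfy $P(\lambda)<\theta$ and $Q(\lambda)<\Theta$. Let $M$ be a compact complex manifold of dimension $n\ge 1$ with a Kähler form $\chi$ and a real closed $(1,1)$-form $\omega_0$, and let $0<\theta_0<\Theta_0<\pi$. Let $\pi_1,\pi_2:M\times M\to M$ be the projections and $\chi_{M\times M}=\pi_1^*\chi+\pi_2^*\chi$. Let $C_{14},\theta_{15},\Theta_{16},\Theta_{17},\Theta_{18}$ be real constants with \[\theta_{15}=\theta_0+n\operatorname{arccot}(C_{14})<\Theta_{16}=\Theta_{17}+n\operatorname{arccot}(C_{14})<\Theta_{18}=\Theta_0+n\operatorname{arccot}(C_{14})<\pi.\]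 Let $\varphi_{19}$ be a smooth real function on $M\times M$ such that the form \[\omega_{19}=\pi_1^*\omega_0+C_{14}\,\pi_2^*\chi+\sqrt{-1}\,\partial\bar\partial\varphi_{19}\] lies in $\Gamma_{\chi_{M\times M},\theta_{15},\Theta_{16}}$. Let $(\pi_1)_*$ denote integration along the fibres of $\pi_1$. Then the form \[\omega_{20}=\frac{\sum_{k=0}^{\lfloor\frac{n-1}{2}\rfloor}(-1)^k\frac{n!}{(n-2k)!\,(2k+1)!}\,(\pi_1)_*\bigl(\omega_{19}^{\,n-2k}\wedge\pi_2^*\chi^{2k+1}\bigr)}{\int_M\operatorname{Im}(C_{14}\chi+\sqrt{-1}\chi)^n}\] on $M$ lies in $\Gamma_{\chi,\theta_0,\Theta_0}$. -/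

import Mathlib

open scoped Manifold ContDiff
open MeasureTheory

noncomputable section

namespace DHYM

/-! ### The functions `P`, `Q` and the sets `Γ` -/

/-- The branch of the inverse cotangent with values in `(0, π)`. -/
def arccot (x : ℝ) : ℝ := Real.pi / 2 - Real.arctan x

/-- `P(μ) = max_i ∑_{k ≠ i} arccot μ_k`. -/
def P {ι : Type*} [Fintype ι] [DecidableEq ι] (μ : ι → ℝ) : ℝ :=
  ⨆ i, ∑ k ∈ Finset.univ.erase i, arccot (μ k)

/-- `Q(μ) = ∑_k arccot μ_k`. -/
def Q {ι : Type*} [Fintype ι] (μ : ι → ℝ) : ℝ := ∑ k, arccot (μ k)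

/-- The set `Γ_{θ,Θ}`. -/
def Gamma (ι : Type*) [Fintype ι] [DecidableEq ι] (θ Θ : ℝ) : Set (ι → ℝ) :=
  {μ | P μ < θ ∧ Q μ < Θ}

/-- The set `Γ_{A,θ,Θ}` of Hermitian matrices `B` such that the eigenvalues of `A⁻¹ B`, listed
with multiplicity, form a point of `Γ_{θ,Θ}`. -/
def GammaMatrix {ι : Type*} [Fintype ι] [DecidableEq ι] (A : Matrix ι ι ℂ) (θ Θ : ℝ) :
    Set (Matrix ι ι ℂ) :=
  {B | B.IsHermitian ∧ ∃ μ : ι → ℝ,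
    (A⁻¹ * B).charpoly = ∏ i, (Polynomial.X - Polynomial.C (μ i : ℂ)) ∧ μ ∈ Gamma ι θ Θ}

/-! ### Linear algebra of forms on a vector space -/

section Wedge

variable {E : Type*} [NormedAddCommGroup E] [NormedSpace ℝ E]
  {A : Type*} [NormedCommRing A] [NormedAlgebra ℝ A]

/-- The wedge product of alternating forms, as an alternating map: the sum over shuffles,
so that `(α ∧ β)(u, v) = α(u) β(v) - α(v) β(u)` for 1-forms. -/
def wedgeAlg {a b c : ℕ} (h : a + b = c) (α : E [⋀^Fin a]→L[ℝ] A) (β : E [⋀^Fin b]→L[ℝ] A) :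
    E [⋀^Fin c]→ₗ[ℝ] A :=
  ((LinearMap.mul' ℝ A).compAlternatingMap
    (α.toAlternatingMap.domCoprod β.toAlternatingMap)).domDomCongr
      (finSumFinEquiv.trans (finCongr h))

theorem continuous_wedgeAlg {a b c : ℕ} (h : a + b = c) (α : E [⋀^Fin a]→L[ℝ] A)
    (β : E [⋀^Fin b]→L[ℝ] A) : Continuous (wedgeAlg h α β) := by
  have key : ∀ σ : Equiv.Perm.ModSumCongr (Fin a) (Fin b), Continuous fun v : Fin c → E =>
      LinearMap.mul' ℝ A (AlternatingMap.domCoprod.summand α.toAlternatingMap β.toAlternatingMap σ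
        fun i => v (finSumFinEquiv.trans (finCongr h) i)) := by
    intro σ
    induction σ using Quotient.inductionOn' with
    | h σ =>
      have hα := α.coe_continuous
      have hβ := β.coe_continuous
      simp only [AlternatingMap.domCoprod.summand_mk'']
      rcases Int.units_eq_one_or (Equiv.Perm.sign σ) with hs | hs <;>
      · simp [hs, MultilinearMap.domCoprod_apply]
        fun_prop
  have h2 : (wedgeAlg h α β : (Fin c → E) → A) = fun v => ∑ σ,
      LinearMap.mul' ℝ A (AlternatingMap.domCoprod.summand α.toAlternatingMap β.toAlternatingMap σ
        fun i => v (finSumFinEquiv.trans (finCongr h) i)) := by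
    funext v
    simp [wedgeAlg, AlternatingMap.domCoprod_apply, map_sum]
    rfl
  rw [h2]
  exact continuous_finsetSum _ fun σ _ => key σ

/-- The wedge product `α ∧ β` of an `a`-form and a `b`-form, a form of degree `c = a + b`. -/
def wedge {a b c : ℕ} (h : a + b = c) (α : E [⋀^Fin a]→L[ℝ] A) (β : E [⋀^Fin b]→L[ℝ] A) :
    E [⋀^Fin c]→L[ℝ] A :=
  { wedgeAlg h α β with cont := continuous_wedgeAlg h α β }

/-- The exterior power `α ^ m` of a 2-form. -/
def wedgePow (α : E [⋀^Fin 2]→L[ℝ] A) : (m : ℕ) → E [⋀^Fin (2 * m)]→L[ℝ] A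
  | 0 => ContinuousAlternatingMap.constOfIsEmpty ℝ E (Fin 0) 1
  | m + 1 => wedge (by ring) (wedgePow α m) α

/-- Insertion of the vectors `w 0, …, w (m - 1)` into the first `m` slots of a form. -/
def contract {k : ℕ} : (m : ℕ) → (Fin m → E) → E [⋀^Fin (k + m)]→L[ℝ] A → E [⋀^Fin k]→L[ℝ] A
  | 0, _, η => η
  | m + 1, w, η => contract m (fun j => w j.succ) (η.curryLeft (w 0))

/-- The complex 2-form `α + √-1 β`, for real 2-forms `α` and `β`. -/
def complexForm (α β : E [⋀^Fin 2]→L[ℝ] ℝ) : E [⋀^Fin 2]→L[ℝ] ℂ :=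
  Complex.ofRealCLM.compContinuousAlternatingMap α +
    Complex.I • Complex.ofRealCLM.compContinuousAlternatingMap β

/-- The imaginary part of a complex form. -/
def imForm {k : ℕ} (η : E [⋀^Fin k]→L[ℝ] ℂ) : E [⋀^Fin k]→L[ℝ] ℝ :=
  Complex.imCLM.compContinuousAlternatingMap η

end Wedge

section Complex

variable {E : Type*} [NormedAddCommGroup E] [NormedSpace ℝ E] [NormedSpace ℂ E]
  [IsScalarTower ℝ ℂ E]

/-- Multiplication by `√-1`, the complex structure. -/
def J : E →L[ℝ] E where
  toFun v := Complex.I • v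
  map_add' := smul_add _
  map_smul' r v := by
    rw [RingHom.id_apply, ← algebraMap_smul ℂ r v, ← algebraMap_smul ℂ r (Complex.I • v),
      smul_smul, smul_smul, mul_comm]
  cont := continuous_const_smul _

/-- A real 2-form is of type (1,1). -/
def IsOneOne (α : E [⋀^Fin 2]→L[ℝ] ℝ) : Prop := ∀ u v, α ![J u, J v] = α ![u, v]

/-- A real (1,1)-form is positive definite. -/
def IsPositive (α : E [⋀^Fin 2]→L[ℝ] ℝ) : Prop := ∀ v, v ≠ 0 → 0 < α ![v, J v]

/-- The Hermitian matrix `(h_{ij})` of a real (1,1)-form `α = √-1 ∑ h_{ij} dz_i ∧ dz̄_j`, where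
`z_i` are the linear coordinates of the basis `b`. -/
def hermMatrix {ι : Type*} (b : Module.Basis ι ℂ E) (α : E [⋀^Fin 2]→L[ℝ] ℝ) : Matrix ι ι ℂ :=
  Matrix.of fun i j => ((α ![b i, J (b j)] : ℂ) - Complex.I * (α ![b i, b j] : ℂ)) / 2

end Complex

/-! ### Differential forms on manifolds

A `k`-form with values in `A` on a manifold `X` modelled on the vector space `E` is a function
`X → E [⋀^Fin k]→L[ℝ] A`: as everywhere in Mathlib, the tangent space `T_x X` is (by definition)
the space `E`, identified through the preferred chart at `x`. -/

section Forms

variable {E H : Type*} [NormedAddCommGroup E] [NormedSpace ℝ E] [TopologicalSpace H]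
  (I : ModelWithCorners ℝ E H) {X : Type*} [TopologicalSpace X] [ChartedSpace H X]
  {E' H' : Type*} [NormedAddCommGroup E'] [NormedSpace ℝ E'] [TopologicalSpace H']
  (I' : ModelWithCorners ℝ E' H') {Y : Type*} [TopologicalSpace Y] [ChartedSpace H' Y]

/-- The pull-back `f^* η` of a form on `Y` by a map `f : X → Y`. -/
def pullback {k : ℕ} (f : X → Y) (η : Y → E' [⋀^Fin k]→L[ℝ] ℝ) : X → E [⋀^Fin k]→L[ℝ] ℝ :=
  fun x => (η (f x)).compContinuousLinearMap (mfderiv I I' f x : E →L[ℝ] E')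

/-- The expression of a form in the preferred chart at `a` (meaningful on the target of the
chart). -/
def inChart {k : ℕ} (η : X → E [⋀^Fin k]→L[ℝ] ℝ) (a : X) : E → E [⋀^Fin k]→L[ℝ] ℝ :=
  pullback 𝓘(ℝ, E) I (extChartAt I a).symm η

/-- A form is smooth if its expressions in charts are smooth. -/
def IsSmoothForm {k : ℕ} (η : X → E [⋀^Fin k]→L[ℝ] ℝ) : Prop :=
  ∀ a : X, ContDiffOn ℝ ∞ (inChart I η a) (extChartAt I a).target

/-- The exterior derivative of a form: at `x`, it is computed in the preferred chart at `x`. -/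
def extD {k : ℕ} (η : X → E [⋀^Fin k]→L[ℝ] ℝ) : X → E [⋀^Fin (k + 1)]→L[ℝ] ℝ :=
  fun x => pullback I 𝓘(ℝ, E) (extChartAt I x) (extDeriv (inChart I η x)) x

/-- Smooth closed forms. -/
structure IsClosedForm {k : ℕ} (η : X → E [⋀^Fin k]→L[ℝ] ℝ) : Prop where
  smooth : IsSmoothForm I η
  closed : ∀ x, extD I η x = 0

section Complex

variable [NormedSpace ℂ E] [IsScalarTower ℝ ℂ E]

/-- Real smooth closed (1,1)-forms. -/
structure IsClosedOneOneForm (η : X → E [⋀^Fin 2]→L[ℝ] ℝ) : Prop extends IsClosedForm I η where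
  oneOne : ∀ x, IsOneOne (η x)

/-- Kähler forms: positive definite real smooth closed (1,1)-forms. -/
structure IsKahlerForm (η : X → E [⋀^Fin 2]→L[ℝ] ℝ) : Prop extends IsClosedOneOneForm I η where
  positive : ∀ x, IsPositive (η x)

/-- The 1-form `dφ ∘ J = -d^c φ`, where `d^c = √-1 (∂̄ - ∂)`. -/
def dCompJ (φ : X → ℝ) : X → E [⋀^Fin 1]→L[ℝ] ℝ :=
  fun x => ContinuousAlternatingMap.ofSubsingleton ℝ E ℝ (0 : Fin 1)
    ((mfderiv I 𝓘(ℝ, ℝ) φ x : E →L[ℝ] ℝ).comp J)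

/-- The real (1,1)-form `√-1 ∂∂̄ φ = (1/2) d d^c φ = -(1/2) d (dφ ∘ J)` of a real function. -/
def iddbar (φ : X → ℝ) : X → E [⋀^Fin 2]→L[ℝ] ℝ :=
  fun x => (-1 / 2 : ℝ) • extD I (dCompJ I φ) x

end Complex

end Forms

/-- `η ∈ Γ_{χ,θ,Θ}`, for real (1,1)-forms on a manifold: at every point, in coordinates, the
Hermitian matrix of `η` lies in `Γ_{A,θ,Θ}` where `A` is the matrix of `χ`. The matrices are taken
in the basis `b` of the model space, that is, of each tangent space. -/
def MemGamma {E X ι : Type*} [NormedAddCommGroup E] [NormedSpace ℝ E] [NormedSpace ℂ E]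
    [IsScalarTower ℝ ℂ E] [Fintype ι] [DecidableEq ι] (b : Module.Basis ι ℂ E)
    (χ : X → E [⋀^Fin 2]→L[ℝ] ℝ) (θ Θ : ℝ) (η : X → E [⋀^Fin 2]→L[ℝ] ℝ) : Prop :=
  ∀ x, IsOneOne (η x) ∧ hermMatrix b (η x) ∈ GammaMatrix (hermMatrix b (χ x)) θ Θ

/-! ### Integration on a compact complex manifold of dimension `n` -/

section Integration

variable {n : ℕ} {M : Type*} [TopologicalSpace M] [ChartedSpace (Fin n → ℂ) M]

variable (M) in
theorem exists_partition [CompactSpace M] [T2Space M] :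
    ∃ ρ : PartitionOfUnity M M, ρ.IsSubordinate fun a => (chartAt (Fin n → ℂ) a).source :=
  PartitionOfUnity.exists_isSubordinate isClosed_univ _
    (fun a => (chartAt (Fin n → ℂ) a).open_source)
    fun x _ => Set.mem_iUnion.2 ⟨x, mem_chart_source _ x⟩

variable (n M) in
/-- A partition of unity subordinate to the covering by the domains of the preferred charts. -/
def partition [CompactSpace M] [T2Space M] : PartitionOfUnity M M :=
  (exists_partition (n := n) M).choose

/-- The positively oriented real frame `e_1, √-1 e_1, …, e_n, √-1 e_n` of `ℂⁿ`. -/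
def frame (n : ℕ) (j : Fin (2 * n)) : Fin n → ℂ :=
  Pi.single ⟨j / 2, by omega⟩ (if (j : ℕ) % 2 = 0 then 1 else Complex.I)

/-- The integral over `M`, with its complex orientation, of a form of top degree `2n` with values
in a vector space `F`: the sum over the members `ρ_a` of a partition of unity of the Lebesgue
integrals of the coefficient of `ρ_a g` in the chart at `a`. The form is given by its values
`g y w` on tuples `w` of tangent vectors at `y`. -/
def topIntegral [CompactSpace M] [T2Space M] {F : Type*} [NormedAddCommGroup F] [NormedSpace ℝ F]
    (g : M → (Fin (2 * n) → (Fin n → ℂ)) → F) : F :=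
  ∑ᶠ a : M, ∫ z in (extChartAt 𝓘(ℝ, Fin n → ℂ) a).target,
    partition n M a ((extChartAt 𝓘(ℝ, Fin n → ℂ) a).symm z) •
      g ((extChartAt 𝓘(ℝ, Fin n → ℂ) a).symm z) fun j =>
        (mfderiv 𝓘(ℝ, Fin n → ℂ) 𝓘(ℝ, Fin n → ℂ) (extChartAt 𝓘(ℝ, Fin n → ℂ) a).symm z :
          (Fin n → ℂ) →L[ℝ] (Fin n → ℂ)) (frame n j)

/-- `∫_M η` for a real form of degree `2n`. -/
def formIntegral [CompactSpace M] [T2Space M] (η : M → (Fin n → ℂ) [⋀^Fin (2 * n)]→L[ℝ] ℝ) : ℝ :=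
  topIntegral fun y w => η y w

/-- The fibre integral `(π₁)_* η` of a form of degree `k + 2n` on `M × M`, a form of degree `k`
on `M`: its value at `p` on `u` is the integral over `y ∈ M` of the form
`w ↦ η_{(p,y)} ((0,w_1), …, (0,w_{2n}), (u_1,0), …, (u_k,0))`. (As the degree of the fibre
is even, the position of the fibre variables is immaterial.) -/
def fibreIntegral [CompactSpace M] [T2Space M] {k : ℕ}
    (η : M × M → ((Fin n → ℂ) × (Fin n → ℂ)) [⋀^Fin (k + 2 * n)]→L[ℝ] ℝ) :
    M → (Fin n → ℂ) [⋀^Fin k]→L[ℝ] ℝ :=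
  fun p => topIntegral fun y w =>
    (contract (2 * n) (fun j => ((0 : Fin n → ℂ), w j)) (η (p, y))).compContinuousLinearMap
      (ContinuousLinearMap.inl ℝ (Fin n → ℂ) (Fin n → ℂ))

end Integration

/-! ### The forms of the statement -/

section Push

variable (n : ℕ) {M : Type*} [TopologicalSpace M] [ChartedSpace (Fin n → ℂ) M]

/-- `π₁^* η`. -/
def pull₁ {k : ℕ} (η : M → (Fin n → ℂ) [⋀^Fin k]→L[ℝ] ℝ) :
    M × M → ((Fin n → ℂ) × (Fin n → ℂ)) [⋀^Fin k]→L[ℝ] ℝ :=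
  pullback (𝓘(ℝ, Fin n → ℂ).prod 𝓘(ℝ, Fin n → ℂ)) 𝓘(ℝ, Fin n → ℂ) Prod.fst η

/-- `π₂^* η`. -/
def pull₂ {k : ℕ} (η : M → (Fin n → ℂ) [⋀^Fin k]→L[ℝ] ℝ) :
    M × M → ((Fin n → ℂ) × (Fin n → ℂ)) [⋀^Fin k]→L[ℝ] ℝ :=
  pullback (𝓘(ℝ, Fin n → ℂ).prod 𝓘(ℝ, Fin n → ℂ)) 𝓘(ℝ, Fin n → ℂ) Prod.snd η

/-- The normalised push-forward
`(∑_{k=0}^{⌊(n-1)/2⌋} (-1)^k n! / ((n-2k)! (2k+1)!) (π₁)_*(η^{n-2k} ∧ π₂^* χ^{2k+1}))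
  / ∫_M Im (C χ + √-1 χ)^n`
of a 2-form `η` on `M × M`. -/
def normalisedPush [CompactSpace M] [T2Space M] (C : ℝ) (χ : M → (Fin n → ℂ) [⋀^Fin 2]→L[ℝ] ℝ)
    (η : M × M → ((Fin n → ℂ) × (Fin n → ℂ)) [⋀^Fin 2]→L[ℝ] ℝ) :
    M → (Fin n → ℂ) [⋀^Fin 2]→L[ℝ] ℝ :=
  fun p =>
    (formIntegral fun x => imForm (wedgePow (complexForm (C • χ x) (χ x)) n))⁻¹ •
      ∑ k : Fin ((n - 1) / 2 + 1),
        ((-1 : ℝ) ^ (k : ℕ) *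
          ((n.factorial : ℝ) / ((n - 2 * (k : ℕ)).factorial * (2 * (k : ℕ) + 1).factorial))) •
            fibreIntegral (k := 2) (fun q => wedge (by have := k.2; omega)
              (wedgePow (η q) (n - 2 * (k : ℕ))) (wedgePow (pull₂ n χ q) (2 * (k : ℕ) + 1))) p

end Push

end DHYM

end

noncomputable section

set_option linter.unusedSectionVars false

namespace DHYM

/-! ### The inverse cotangent -/

/-! Fix a point `p` of the base and a `χ`-orthonormal frame `u_i` at `p` that diagonalises the
push-forward `ω₂₀`. The numbers `ω₂₀(u_i, J u_i) / 2` are then its eigenvalues. At a point `(p, y)`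
let `B` be the Hermitian matrix of `ω₁₉` in a frame orthonormal for the product metric, made of the
`u_i` and of fibre vectors. Let `C` be the fibre block of `B`, put `D = C + √-1`, and let `N_i` be
the imaginary part of the determinant of `D` bordered by the row and column of `u_i`.

The coefficients defining `ω₂₀` are `1 / (n + 1)` times the signed binomial coefficients of the odd
powers of `π₂^*χ` in `(ω₁₉ + √-1 π₂^*χ)^(n+1)`, and the top power of `π₂^*χ` vanishes. Hence each
eigenvalue is a quotient of fibre integrals, `∫ N_i / ∫ Im det D`, with the same volume factor in
both (`sum_wedge_realFrame`, `density_pushIntegrand`).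

Pointwise estimate. The argument of `det (B + √-1)` is the total phase of `B`. Adding one border to
a matrix raises its phase by at least the arccotangent of the corresponding reduced entry
(`phase_add_arccot_le`), and lowers the other reduced entries (`reduced_border_le`). Induction over
the base directions bounds `∑ arccot (N_i / Im det D) + phase C` by the phase of `B`, and `phase C =
arccot (Re det D / Im det D)`. Leaving out one base direction gives the analogue for `P`: the phase
of the smaller matrix is controlled by a Schur–Horn argument (`sumElim_eigenvalues_mem`).

Averaging. For `Θ ≤ π` the set `∑ arccot x_i < Θ` is open and convex (`convex_sum_arccot_lt`), so it
contains the average, with weight `Im det D`, of the points with coordinates `Re det D / Im det D`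
and `N_i / Im det D` (`average_mem`). The pointwise estimates therefore pass to quotients of
integrals.

Cohomology. On the fibre `ω₁₉` restricts to `C₁₄ χ + √-1 ∂∂̄ φ`. By Stokes
(`topIntegral_add_iddbar`) the integral of `(ω₁₉ + √-1 χ)^n` over the fibre is a positive multiple
of `(C₁₄ + √-1)^n`, whose argument is `n arccot C₁₄`. Subtracting this constant from both averaged
estimates leaves the bounds `θ₀` and `Θ₀`. -/

theorem arccot_pos (x : ℝ) : 0 < arccot x := by
  have := Real.arctan_lt_pi_div_two x
  unfold arccot; linarith

theorem arccot_lt_pi (x : ℝ) : arccot x < Real.pi := by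
  have := Real.neg_pi_div_two_lt_arctan x
  unfold arccot; linarith

theorem arccot_lt_arccot {x y : ℝ} : arccot x < arccot y ↔ y < x := by
  unfold arccot
  rw [sub_lt_sub_iff_left, Real.arctan_strictMono.lt_iff_lt]

theorem arccot_le_arccot {x y : ℝ} : arccot x ≤ arccot y ↔ y ≤ x := by
  rw [← not_lt, arccot_lt_arccot, not_lt]

theorem continuous_arccot : Continuous arccot :=
  continuous_const.sub Real.continuous_arctan

theorem sin_arccot (x : ℝ) : Real.sin (arccot x) = 1 / √(1 + x ^ 2) := by
  rw [arccot, Real.sin_pi_div_two_sub, Real.cos_arctan]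

theorem cos_arccot (x : ℝ) : Real.cos (arccot x) = x / √(1 + x ^ 2) := by
  rw [arccot, Real.cos_pi_div_two_sub, Real.sin_arctan]

theorem sin_arccot_pos (x : ℝ) : 0 < Real.sin (arccot x) :=
  Real.sin_pos_of_pos_of_lt_pi (arccot_pos x) (arccot_lt_pi x)

theorem cos_arccot_eq (x : ℝ) : Real.cos (arccot x) = x * Real.sin (arccot x) := by
  rw [sin_arccot, cos_arccot]; ring

/-- An angle in `(0, π)` is determined by its cotangent. -/
theorem arccot_eq_of {α x : ℝ} (h0 : 0 < α) (h1 : α < Real.pi)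
    (h : Real.cos α = x * Real.sin α) : arccot x = α := by
  have hs : Real.sin (arccot x - α) = 0 := by
    rw [Real.sin_sub, cos_arccot_eq, h]; ring
  have h2 := arccot_pos x
  have h3 := arccot_lt_pi x
  have := (Real.sin_eq_zero_iff_of_lt_of_lt (by linarith) (by linarith)).1 hs
  linarith

theorem arccot_add_arccot_lt_pi {x y : ℝ} : arccot x + arccot y < Real.pi ↔ 0 < x + y := by
  have h : Real.pi - arccot y = arccot (-y) := by
    unfold arccot; rw [Real.arctan_neg]; ring
  rw [← lt_sub_iff_add_lt, h, arccot_lt_arccot, neg_lt_iff_pos_add]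

theorem arccot_add_arccot {x y : ℝ} (h : 0 < x + y) :
    arccot x + arccot y = arccot ((x * y - 1) / (x + y)) := by
  symm
  apply arccot_eq_of (add_pos (arccot_pos x) (arccot_pos y)) (arccot_add_arccot_lt_pi.2 h)
  rw [Real.cos_add, Real.sin_add, cos_arccot_eq, cos_arccot_eq]
  field_simp
  ring

/-- Concavity is obtained by exhibiting the function as a minimum of affine ones: `x y / (x + y)` is
the minimum over `l` of `l² x + (1 - l)² y`, and `-1 / (x + y)` the minimum over `t` of `t² (x + y)
- 2 t`. -/
theorem harmonic_le_affine {x y : ℝ} (h : 0 < x + y) (l t : ℝ) :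
    (x * y - 1) / (x + y) ≤ l ^ 2 * x + (1 - l) ^ 2 * y + t ^ 2 * (x + y) - 2 * t := by
  rw [div_le_iff₀ h]
  nlinarith [sq_nonneg (l * x - (1 - l) * y), sq_nonneg (t * (x + y) - 1)]

/-- Concavity of `(x, y) ↦ (x y - 1) / (x + y)` on the half plane `x + y > 0`. -/
theorem harmonic_concave {x y x' y' a b : ℝ} (h : 0 < x + y) (h' : 0 < x' + y') (ha : 0 ≤ a)
    (hb : 0 ≤ b) (hab : a + b = 1) (hp : 0 < (a * x + b * x') + (a * y + b * y')) :
    a * ((x * y - 1) / (x + y)) + b * ((x' * y' - 1) / (x' + y')) ≤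
      ((a * x + b * x') * (a * y + b * y') - 1) / ((a * x + b * x') + (a * y + b * y')) := by
  set X := a * x + b * x' with hX
  set Y := a * y + b * y' with hY
  -- Equality holds at the minimisers `l = Y / (X + Y)` and `t = 1 / (X + Y)`, which are then used
  -- at both end points.
  have key : (X * Y - 1) / (X + Y) = (Y / (X + Y)) ^ 2 * X + (1 - Y / (X + Y)) ^ 2 * Y +
      (1 / (X + Y)) ^ 2 * (X + Y) - 2 * (1 / (X + Y)) := by
    field_simp
    ring
  rw [key]
  have h1 := mul_le_mul_of_nonneg_left (harmonic_le_affine h (Y / (X + Y)) (1 / (X + Y))) ha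
  have h2 := mul_le_mul_of_nonneg_left (harmonic_le_affine h' (Y / (X + Y)) (1 / (X + Y))) hb
  refine (add_le_add h1 h2).trans (le_of_eq ?_)
  generalize Y / (X + Y) = l
  generalize 1 / (X + Y) = t
  rw [hX, hY]
  linear_combination (-2 * t) * hab

/-- The accumulators `c`, `d` carry the induction: one angle of the sum is merged with the
accumulated one by the addition formula. Since the cotangent of a sum is concave in the two
cotangents, the merged value at the convex combination is at least the combination of the merged
values, and `arccot` is decreasing. The bound `Θ ≤ π` keeps every merged pair in the half plane `x +
c > 0`. -/
theorem sum_arccot_add_lt {ι : Type*} {Θ : ℝ} (hΘ : Θ ≤ Real.pi) {a b : ℝ} (ha : 0 ≤ a)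
    (hb : 0 ≤ b) (hab : a + b = 1) (s : Finset ι) (x y : ι → ℝ) :
    ∀ c d : ℝ, ∑ i ∈ s, arccot (x i) + arccot c < Θ → ∑ i ∈ s, arccot (y i) + arccot d < Θ →
      ∑ i ∈ s, arccot (a * x i + b * y i) + arccot (a * c + b * d) < Θ := by
  classical
  induction s using Finset.induction_on with
  | empty =>
    intro c d hc hd
    simp only [Finset.sum_empty, zero_add] at *
    rcases le_total c d with h | h
    · refine lt_of_le_of_lt (arccot_le_arccot.2 ?_) hc
      nlinarith [mul_nonneg hb (sub_nonneg.2 h), congrArg (· * c) hab]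
    · refine lt_of_le_of_lt (arccot_le_arccot.2 ?_) hd
      nlinarith [mul_nonneg ha (sub_nonneg.2 h), congrArg (· * d) hab]
  | insert i s hi ih =>
    intro c d hc hd
    rw [Finset.sum_insert hi] at *
    have hx0 : 0 ≤ ∑ i ∈ s, arccot (x i) := Finset.sum_nonneg fun i _ => (arccot_pos _).le
    have hy0 : 0 ≤ ∑ i ∈ s, arccot (y i) := Finset.sum_nonneg fun i _ => (arccot_pos _).le
    have h1 : 0 < x i + c := arccot_add_arccot_lt_pi.1 (by linarith)
    have h2 : 0 < y i + d := arccot_add_arccot_lt_pi.1 (by linarith)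
    have h3 : 0 < (a * x i + b * y i) + (a * c + b * d) := by
      rcases ha.eq_or_lt with h | h
      · have : b = 1 := by linarith
        subst this; rw [← h]; linarith
      · nlinarith [mul_pos h h1, mul_nonneg hb h2.le]
    have h4 := ih _ _ (by rw [← arccot_add_arccot h1]; linarith)
      (by rw [← arccot_add_arccot h2]; linarith)
    have h5 := arccot_le_arccot.2 (harmonic_concave h1 h2 ha hb hab h3)
    rw [← arccot_add_arccot h3] at h5
    linarith

theorem sum_arccot_lt {ι : Type*} {Θ : ℝ} (hΘ : Θ ≤ Real.pi) {a b : ℝ} (ha : 0 ≤ a)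
    (hb : 0 ≤ b) (hab : a + b = 1) (s : Finset ι) (x y : ι → ℝ)
    (hx : ∑ i ∈ s, arccot (x i) < Θ) (hy : ∑ i ∈ s, arccot (y i) < Θ) :
    ∑ i ∈ s, arccot (a * x i + b * y i) < Θ := by
  classical
  rcases s.eq_empty_or_nonempty with rfl | ⟨i, hi⟩
  · simpa using hx
  · rw [← Finset.sum_erase_add s _ hi] at *
    exact sum_arccot_add_lt hΘ ha hb hab _ _ _ _ _ hx hy

/-- The superlevel sets of the total phase are convex up to `π`. -/
theorem convex_sum_arccot_lt {ι : Type*} {Θ : ℝ} (hΘ : Θ ≤ Real.pi) (s : Finset ι) :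
    Convex ℝ {x : ι → ℝ | ∑ i ∈ s, arccot (x i) < Θ} := by
  intro x hx y hy a b ha hb hab
  exact sum_arccot_lt hΘ ha hb hab s x y hx hy

theorem isOpen_sum_arccot_lt {ι : Type*} (Θ : ℝ) (s : Finset ι) :
    IsOpen {x : ι → ℝ | ∑ i ∈ s, arccot (x i) < Θ} :=
  isOpen_lt (continuous_finsetSum _ fun i _ => continuous_arccot.comp (continuous_apply i))
    continuous_const

/-- Nonemptiness matters: the supremum of an empty family of reals is `0`, which would impose the
extra condition `0 < θ`. -/
theorem mem_Gamma_iff {ι : Type*} [Fintype ι] [DecidableEq ι] [Nonempty ι] {θ Θ : ℝ}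
    {x : ι → ℝ} : x ∈ Gamma ι θ Θ ↔
      (∀ i, ∑ k ∈ Finset.univ.erase i, arccot (x k) < θ) ∧ ∑ k, arccot (x k) < Θ := by
  simp only [Gamma, Set.mem_ofPred_eq, P, Q]
  refine and_congr_left' ⟨fun h i => lt_of_le_of_lt ?_ h, fun h => ?_⟩
  · exact le_ciSup (f := fun i => ∑ k ∈ Finset.univ.erase i, arccot (x k))
      (Set.finite_range _).bddAbove i
  · obtain ⟨i, hi⟩ := exists_eq_ciSup_of_finite
      (f := fun i => ∑ k ∈ Finset.univ.erase i, arccot (x k))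
    rw [← hi]
    exact h i

theorem convex_Gamma {ι : Type*} [Fintype ι] [DecidableEq ι] [Nonempty ι] {θ Θ : ℝ}
    (hθ : θ ≤ Real.pi) (hΘ : Θ ≤ Real.pi) : Convex ℝ (Gamma ι θ Θ) := by
  intro x hx y hy a b ha hb hab
  rw [mem_Gamma_iff] at *
  exact ⟨fun i => sum_arccot_lt hθ ha hb hab _ x y (hx.1 i) (hy.1 i),
    sum_arccot_lt hΘ ha hb hab _ x y hx.2 hy.2⟩

theorem Gamma_comp_equiv {ι κ : Type*} [Fintype ι] [DecidableEq ι] [Nonempty ι] [Fintype κ]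
    [DecidableEq κ] [Nonempty κ] {θ Θ : ℝ} {x : ι → ℝ} (hx : x ∈ Gamma ι θ Θ) (σ : κ ≃ ι) :
    x ∘ σ ∈ Gamma κ θ Θ := by
  rw [mem_Gamma_iff] at *
  refine ⟨fun i => ?_, ?_⟩
  · have h := hx.1 (σ i)
    rwa [← Finset.sum_equiv σ (s := Finset.univ.erase i) (f := fun k => arccot (x (σ k)))
      (by simp) (by simp)] at h
  · have := hx.2
    rwa [← Equiv.sum_comp σ] at this

/-! ### Diagonals of Hermitian matrices -/

/-- The total phase of a Hermitian matrix, the sum of the inverse cotangents of its eigenvalues. -/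
def phase {ι : Type*} [Fintype ι] [DecidableEq ι] {A : Matrix ι ι ℂ} (hA : A.IsHermitian) : ℝ :=
  ∑ i, arccot (hA.eigenvalues i)

/-- Schur's theorem with Birkhoff's: the diagonal is the image of the eigenvalues under the doubly
stochastic matrix `|U_ij|²`, hence a convex combination of their permutations. -/
theorem diag_mem_of_eigenvalues_mem {ι : Type*} [Fintype ι] [DecidableEq ι] {A : Matrix ι ι ℂ}
    (hA : A.IsHermitian) {Ω : Set (ι → ℝ)} (hΩ : Convex ℝ Ω)
    (hσ : ∀ x ∈ Ω, ∀ σ : Equiv.Perm ι, x ∘ σ ∈ Ω) (h : hA.eigenvalues ∈ Ω) :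
    (fun i => (A i i).re) ∈ Ω := by
  set U : Matrix ι ι ℂ := (hA.eigenvectorUnitary : Matrix ι ι ℂ) with hU
  have hUU : U * star U = 1 := Unitary.mul_star_self_of_mem hA.eigenvectorUnitary.2
  have hUU' : star U * U = 1 := Unitary.star_mul_self_of_mem hA.eigenvectorUnitary.2
  set D : Matrix ι ι ℝ := Matrix.of fun i j => Complex.normSq (U i j) with hD
  have hDs : D ∈ doublyStochastic ℝ ι := by
    rw [mem_doublyStochastic_iff_sum]
    refine ⟨fun i j => Complex.normSq_nonneg _, fun i => ?_, fun j => ?_⟩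
    · have := congrFun (congrFun hUU i) i
      rw [Matrix.mul_apply, Matrix.one_apply_eq] at this
      apply_fun Complex.re at this
      simpa [hD, Matrix.star_apply, Complex.normSq_apply, Complex.mul_re] using this
    · have := congrFun (congrFun hUU' j) j
      rw [Matrix.mul_apply, Matrix.one_apply_eq] at this
      apply_fun Complex.re at this
      simpa [hD, Matrix.star_apply, Complex.normSq_apply, Complex.mul_re] using this
  obtain ⟨w, hw0, hw1, hw⟩ := exists_eq_sum_perm_of_mem_doublyStochastic hDs
  have hd : (fun i => (A i i).re) = ∑ σ : Equiv.Perm ι, w σ • (hA.eigenvalues ∘ σ) := by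
    funext i
    have h1 : (A i i).re = ∑ j, D i j * hA.eigenvalues j := by
      have := congrFun (congrFun hA.spectral_theorem i) i
      rw [this]
      simp [Unitary.conjStarAlgAut_apply, Matrix.mul_apply, Matrix.diagonal_apply, hD, ← hU,
        Matrix.star_apply, Complex.normSq_apply]
      refine Finset.sum_congr rfl fun j _ => ?_
      ring
    rw [h1, ← hw]
    simp only [Matrix.sum_apply, Matrix.smul_apply, Finset.sum_mul, Finset.sum_apply,
      Pi.smul_apply, Function.comp_apply, smul_eq_mul]
    rw [Finset.sum_comm]
    refine Finset.sum_congr rfl fun σ _ => ?_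
    simp [Equiv.Perm.permMatrix, PEquiv.toMatrix_apply, Equiv.toPEquiv_apply]
  rw [hd]
  exact hΩ.sum_mem (fun σ _ => hw0 σ) hw1 fun σ _ => hσ _ h σ

/-- Equal multisets of values mean fibres of equal cardinality, and bijections of the fibres glue.
-/
theorem exists_perm_of_map_univ_eq {ι κ : Type*} [Fintype ι] {f g : ι → κ}
    (h : Multiset.map f Finset.univ.val = Multiset.map g Finset.univ.val) :
    ∃ σ : Equiv.Perm ι, f = g ∘ σ := by
  classical
  have hc : ∀ c, Nonempty ({i // f i = c} ≃ {i // g i = c}) := fun c => by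
    rw [← Fintype.card_eq, Fintype.card_subtype, Fintype.card_subtype]
    have := congrArg (Multiset.count c) h
    rw [Multiset.count_map, Multiset.count_map] at this
    simpa [Finset.card_def, Finset.filter_val, eq_comm] using this
  refine ⟨Equiv.ofFiberEquiv fun c => (hc c).some, funext fun i => ?_⟩
  exact (Equiv.ofFiberEquiv_map _ i).symm

/-- Membership in `GammaMatrix` supplies an unordered list of roots; this compares it with the
sorted `eigenvalues`. -/
theorem exists_perm_eigenvalues {ι : Type*} [Fintype ι] [DecidableEq ι] {A : Matrix ι ι ℂ}
    (hA : A.IsHermitian) {μ : ι → ℝ}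
    (h : A.charpoly = ∏ i, (Polynomial.X - Polynomial.C (μ i : ℂ))) :
    ∃ σ : Equiv.Perm ι, hA.eigenvalues = μ ∘ σ := by
  have h1 := hA.roots_charpoly_eq_eigenvalues
  have h2 : (∏ i, (Polynomial.X - Polynomial.C (μ i : ℂ))).roots =
      Multiset.map (Complex.ofReal ∘ μ) Finset.univ.val := by
    rw [Polynomial.roots_prod _ _ (Finset.prod_ne_zero_iff.2 fun i _ =>
      Polynomial.X_sub_C_ne_zero _)]
    simp [Multiset.bind_singleton]
  rw [h, h2] at h1
  obtain ⟨σ, hσ⟩ := exists_perm_of_map_univ_eq h1.symm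
  refine ⟨σ, funext fun i => ?_⟩
  have := congrFun hσ i
  simpa using this

theorem phase_congr {ι κ : Type*} [Fintype ι] [DecidableEq ι] [Fintype κ] [DecidableEq κ]
    {A : Matrix ι ι ℂ} (hA : A.IsHermitian) {B : Matrix κ κ ℂ} (hB : B.IsHermitian) (e : ι ≃ κ)
    (h : A.charpoly = B.charpoly) : phase hA = phase hB := by
  have h1 : A.charpoly = ∏ i, (Polynomial.X - Polynomial.C ((hB.eigenvalues (e i) : ℝ) : ℂ)) := by
    rw [h, hB.charpoly_eq, ← Equiv.prod_comp e]
    rfl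
  obtain ⟨σ, hσ⟩ := exists_perm_eigenvalues hA (μ := hB.eigenvalues ∘ e) h1
  rw [phase, hσ, phase, ← Equiv.sum_comp e]
  exact Equiv.sum_comp σ fun i => arccot (hB.eigenvalues (e i))

/-- The determinant of `A + √-1` for a Hermitian matrix has argument `phase A`. -/
theorem exists_det_add_I {ι : Type*} [Fintype ι] [DecidableEq ι] {A : Matrix ι ι ℂ}
    (hA : A.IsHermitian) : ∃ r : ℝ, 0 < r ∧ (A + Complex.I • (1 : Matrix ι ι ℂ)).det =
      r * Complex.exp (phase hA * Complex.I) := by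
  refine ⟨∏ i, √(1 + hA.eigenvalues i ^ 2), Finset.prod_pos fun i _ => by positivity, ?_⟩
  have h1 : (A + Complex.I • (1 : Matrix ι ι ℂ)).det =
      ∏ i, ((hA.eigenvalues i : ℂ) + Complex.I) := by
    -- Up to the sign `(-1)^n`, distributed over the factors below, the determinant of `A + √-1` is
    -- the characteristic polynomial at `-√-1`.
    have h2 := congrArg (Polynomial.eval (-Complex.I)) hA.charpoly_eq
    rw [Matrix.eval_charpoly, Polynomial.eval_prod] at h2
    have h3 : A + Complex.I • (1 : Matrix ι ι ℂ) =
        -(Matrix.scalar ι (-Complex.I) - A) := by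
      rw [neg_sub, sub_eq_add_neg]
      simp [Matrix.smul_one_eq_diagonal, ← Matrix.diagonal_neg]
    rw [h3, Matrix.det_neg, h2, ← Finset.card_univ, ← Finset.prod_const, ← Finset.prod_mul_distrib]
    refine Finset.prod_congr rfl fun i _ => ?_
    simp
  rw [h1, phase, Complex.ofReal_sum, Finset.sum_mul, Complex.exp_sum, Complex.ofReal_prod,
    ← Finset.prod_mul_distrib]
  refine Finset.prod_congr rfl fun i _ => ?_
  have hr : (0 : ℝ) < √(1 + hA.eigenvalues i ^ 2) := by positivity
  -- Each factor is `λ + √-1 = √(1 + λ²) exp (√-1 arccot λ)`.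
  rw [Complex.exp_mul_I, ← Complex.ofReal_cos, ← Complex.ofReal_sin, cos_arccot, sin_arccot]
  have hr' : (√(1 + hA.eigenvalues i ^ 2) : ℂ) ≠ 0 := by exact_mod_cast hr.ne'
  push_cast
  field_simp

theorem phase_pos {ι : Type*} [Fintype ι] [DecidableEq ι] [Nonempty ι] {A : Matrix ι ι ℂ}
    (hA : A.IsHermitian) : 0 < phase hA :=
  Finset.sum_pos (fun _ _ => arccot_pos _) Finset.univ_nonempty

theorem im_det_add_I_pos {ι : Type*} [Fintype ι] [DecidableEq ι] [Nonempty ι] {A : Matrix ι ι ℂ}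
    (hA : A.IsHermitian) (h : phase hA < Real.pi) :
    0 < (A + Complex.I • (1 : Matrix ι ι ℂ)).det.im := by
  obtain ⟨r, hr, h1⟩ := exists_det_add_I hA
  rw [h1, Complex.im_ofReal_mul, Complex.exp_ofReal_mul_I_im]
  exact mul_pos hr (Real.sin_pos_of_pos_of_lt_pi (phase_pos hA) h)

theorem arccot_re_div_im {ι : Type*} [Fintype ι] [DecidableEq ι] [Nonempty ι] {A : Matrix ι ι ℂ}
    (hA : A.IsHermitian) (h : phase hA < Real.pi) :
    arccot ((A + Complex.I • (1 : Matrix ι ι ℂ)).det.re /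
      (A + Complex.I • (1 : Matrix ι ι ℂ)).det.im) = phase hA := by
  have hp := im_det_add_I_pos hA h
  obtain ⟨r, hr, h1⟩ := exists_det_add_I hA
  apply arccot_eq_of (phase_pos hA) h
  rw [h1, Complex.im_ofReal_mul, Complex.exp_ofReal_mul_I_im] at *
  rw [Complex.re_ofReal_mul, Complex.exp_ofReal_mul_I_re]
  have := (Real.sin_pos_of_pos_of_lt_pi (phase_pos hA) h).ne'
  field_simp

/-! ### Bordered Hermitian matrices -/

section Border

open Matrix

variable {κ : Type*} [Fintype κ] [DecidableEq κ]

/-- The matrix `M` bordered by a corner `a`, a column `b` and the row `b*`. -/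
def border (a : ℂ) (b : κ → ℂ) (M : Matrix κ κ ℂ) : Matrix (Unit ⊕ κ) (Unit ⊕ κ) ℂ :=
  fromBlocks (of fun _ _ => a) (of fun _ j => star (b j)) (of fun i _ => b i) M

/-- The Schur complement formula, with `M⁻¹ b` replaced by a solution `x` of `M x = b`, so that
later computations involve no inverse. -/
theorem det_border {M : Matrix κ κ ℂ} (hM : M.det ≠ 0) (a : ℂ) {b x : κ → ℂ}
    (hx : M *ᵥ x = b) : (border a b M).det = M.det * (a - star b ⬝ᵥ x) := by
  have hu : IsUnit M.det := hM.isUnit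
  let := M.invertibleOfIsUnitDet hu
  have h1 : ⅟M *ᵥ b = x := by
    rw [← hx, mulVec_mulVec, invOf_mul_self, one_mulVec]
  rw [border, det_fromBlocks₂₂]
  congr 1
  rw [det_unique, Matrix.sub_apply, of_apply, Matrix.mul_assoc, mul_apply]
  congr 1
  rw [← h1]
  rfl

theorem isHermitian_border (d : ℝ) (b : κ → ℂ) {C : Matrix κ κ ℂ} (hC : C.IsHermitian) :
    (border d b C).IsHermitian := by
  refine IsHermitian.fromBlocks ?_ ?_ hC
  · ext i j
    simp
  · ext i j
    simp

theorem border_add (a : ℂ) (b : κ → ℂ) (C : Matrix κ κ ℂ) :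
    border a b C + Complex.I • (1 : Matrix (Unit ⊕ κ) (Unit ⊕ κ) ℂ) =
      border (a + Complex.I) b (C + Complex.I • (1 : Matrix κ κ ℂ)) := by
  ext i j
  rcases i with i | i <;> rcases j with j | j <;> simp [border, one_apply]

/-- For Hermitian `C` the adjoint of `C + √-1` is `C - √-1`. -/
theorem star_mulVec_dotProduct {C : Matrix κ κ ℂ} (hC : C.IsHermitian) (x y : κ → ℂ) :
    star ((C + Complex.I • (1 : Matrix κ κ ℂ)) *ᵥ x) ⬝ᵥ y =
      star x ⬝ᵥ (C *ᵥ y) - Complex.I * (star x ⬝ᵥ y) := by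
  rw [star_mulVec, conjTranspose_add, conjTranspose_smul, conjTranspose_one, hC.eq,
    vecMul_add, add_dotProduct, dotProduct_mulVec, vecMul_smul, smul_dotProduct, vecMul_one]
  simp [sub_eq_add_neg]

theorem im_star_dotProduct_mulVec {C : Matrix κ κ ℂ} (hC : C.IsHermitian) (x : κ → ℂ) :
    (star x ⬝ᵥ (C *ᵥ x)).im = 0 := hC.im_star_dotProduct_mulVec_self x

theorem star_dotProduct_self_eq (x : κ → ℂ) :
    star x ⬝ᵥ x = ((∑ k, Complex.normSq (x k) : ℝ) : ℂ) := by
  simp [dotProduct, Complex.normSq_eq_conj_mul_self]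

theorem normSq_dotProduct_le (x y : κ → ℂ) :
    Complex.normSq (star x ⬝ᵥ y) ≤
      (∑ k, Complex.normSq (x k)) * ∑ k, Complex.normSq (y k) := by
  have h := norm_inner_le_norm (𝕜 := ℂ) (WithLp.toLp 2 x) (WithLp.toLp 2 y)
  have h2 := mul_self_le_mul_self (norm_nonneg _) h
  rw [← sq, mul_mul_mul_comm, ← sq, ← sq, EuclideanSpace.norm_sq_eq,
    EuclideanSpace.norm_sq_eq, EuclideanSpace.inner_toLp_toLp, dotProduct_comm] at h2
  simpa [Complex.normSq_eq_norm_sq] using h2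

/-- The entry of the reduced form: `Im det [[a, b*], [b, C + √-1]] / Im det (C + √-1)`. -/
def reduced (C : Matrix κ κ ℂ) (a : ℂ) (b : κ → ℂ) : ℝ :=
  (border a b (C + Complex.I • (1 : Matrix κ κ ℂ))).det.im /
    (C + Complex.I • (1 : Matrix κ κ ℂ)).det.im

theorem exists_mulVec_eq {M : Matrix κ κ ℂ} (hM : M.det ≠ 0) (b : κ → ℂ) : ∃ x, M *ᵥ x = b := by
  refine ⟨M⁻¹ *ᵥ b, ?_⟩
  rw [mulVec_mulVec, mul_nonsing_inv _ hM.isUnit, one_mulVec]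

/-- The complex number `a - b* (C + √-1)⁻¹ b` in terms of `x = (C + √-1)⁻¹ b`. -/
theorem sub_star_dotProduct_eq {C : Matrix κ κ ℂ} (hC : C.IsHermitian) (a : ℝ) {b x : κ → ℂ}
    (hx : (C + Complex.I • (1 : Matrix κ κ ℂ)) *ᵥ x = b) :
    (a : ℂ) - star b ⬝ᵥ x = ⟨a - (star x ⬝ᵥ (C *ᵥ x)).re, ∑ k, Complex.normSq (x k)⟩ := by
  rw [← hx, star_mulVec_dotProduct hC, star_dotProduct_self_eq]
  apply Complex.ext
  · simp
  · simp [im_star_dotProduct_mulVec hC]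

/-- Only the block `C` is diagonalised: conjugation by `1 ⊕ U` keeps the spectrum of the bordered
matrix and gives it the diagonal formed by `d` and the eigenvalues of `C`, to which Schur's theorem
applies. -/
theorem sumElim_eigenvalues_mem {C : Matrix κ κ ℂ} (hC : C.IsHermitian) (d : ℝ)
    (g : κ → ℂ) {Ω : Set (Unit ⊕ κ → ℝ)} (hΩ : Convex ℝ Ω)
    (hσ : ∀ x ∈ Ω, ∀ σ : Equiv.Perm (Unit ⊕ κ), x ∘ σ ∈ Ω)
    (h : (isHermitian_border d g hC).eigenvalues ∈ Ω) :
    (Sum.elim (fun _ => d) hC.eigenvalues) ∈ Ω := by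
  set U : Matrix κ κ ℂ := (hC.eigenvectorUnitary : Matrix κ κ ℂ) with hU
  have hUU : U * star U = 1 := Unitary.mul_star_self_of_mem hC.eigenvectorUnitary.2
  have hUU' : star U * U = 1 := Unitary.star_mul_self_of_mem hC.eigenvectorUnitary.2
  set V : Matrix (Unit ⊕ κ) (Unit ⊕ κ) ℂ := fromBlocks 1 0 0 U
  have hV : V * Vᴴ = 1 := by
    rw [fromBlocks_conjTranspose, fromBlocks_multiply]
    simp [← star_eq_conjTranspose, hUU]
  have hH := isHermitian_conjTranspose_mul_mul V (isHermitian_border d g hC)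
  have hcp : (Vᴴ * border d g C * V).charpoly = (border d g C).charpoly := by
    rw [Matrix.mul_assoc, charpoly_mul_comm, Matrix.mul_assoc, hV, Matrix.mul_one]
  obtain ⟨σ, hσ'⟩ := exists_perm_eigenvalues hH
    (hcp.trans (isHermitian_border d g hC).charpoly_eq)
  have h1 := diag_mem_of_eigenvalues_mem hH hΩ hσ (hσ' ▸ hσ _ h σ)
  have h4 : star U * C * U = diagonal (fun k => (hC.eigenvalues k : ℂ)) := by
    conv_lhs => rw [hC.spectral_theorem, Unitary.conjStarAlgAut_apply, ← hU]
    rw [Matrix.mul_assoc, Matrix.mul_assoc, Matrix.mul_assoc, hUU', Matrix.mul_one,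
      ← Matrix.mul_assoc, hUU', Matrix.one_mul]
    rfl
  convert h1 using 1
  funext i
  rw [fromBlocks_conjTranspose, border, fromBlocks_multiply, fromBlocks_multiply]
  rcases i with i | k
  · simp
  · simp [← star_eq_conjTranspose, h4]

/-- The previous lemma for a superlevel set of the total phase, after the positive term `arccot d`
is dropped. -/
theorem phase_lt_of_border [Nonempty κ] {C : Matrix κ κ ℂ} (hC : C.IsHermitian) (d : ℝ)
    (g : κ → ℂ) {Θ : ℝ} (hΘ : Θ ≤ Real.pi) (h : phase (isHermitian_border d g hC) < Θ) :
    phase hC < Θ := by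
  have h1 := sumElim_eigenvalues_mem hC d g (convex_sum_arccot_lt hΘ Finset.univ)
    (fun x hx σ => by
      have : ∑ i, arccot (x i) < Θ := hx
      rwa [← Equiv.sum_comp σ] at this) h
  have h2 : ∑ i, arccot (Sum.elim (fun _ : Unit => d) hC.eigenvalues i) < Θ := h1
  simp only [Fintype.sum_sum_type, Finset.univ_unique, Finset.sum_singleton, Sum.elim_inl,
    Sum.elim_inr] at h2
  exact lt_trans (lt_add_of_pos_left _ (arccot_pos d)) h2

/-- The phase of a bordered matrix dominates the phase of the matrix and of the reduced entry. -/
theorem phase_add_arccot_le [Nonempty κ] {C : Matrix κ κ ℂ} (hC : C.IsHermitian) (d : ℝ)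
    (g : κ → ℂ) (h : phase (isHermitian_border d g hC) < Real.pi) :
    phase hC + arccot (reduced C d g) ≤ phase (isHermitian_border d g hC) := by
  have hθ := phase_lt_of_border hC d g le_rfl h
  have hθ0 := phase_pos hC
  obtain ⟨r, hr, hD⟩ := exists_det_add_I hC
  obtain ⟨r', hr', hD'⟩ := exists_det_add_I (isHermitian_border d g hC)
  have hD0 := (im_det_add_I_pos hC hθ)
  have hne : (C + Complex.I • (1 : Matrix κ κ ℂ)).det ≠ 0 := fun h => by simp [h] at hD0
  obtain ⟨x, hx⟩ := exists_mulVec_eq hne g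
  have hS := sub_star_dotProduct_eq hC d hx
  set X := d - (star x ⬝ᵥ (C *ᵥ x)).re
  set Y := ∑ k, Complex.normSq (x k) with hYdef
  have hY : 0 ≤ Y := Finset.sum_nonneg fun _ _ => Complex.normSq_nonneg _
  set θ := phase hC
  set θ' := phase (isHermitian_border d g hC)
  have hs : 0 < Real.sin θ := Real.sin_pos_of_pos_of_lt_pi hθ0 hθ
  have hθ'0 : 0 < θ' := phase_pos _
  -- `ψ` is the argument of the Schur complement `X + √-1 (1 + Y)`; the `1` comes from the `√-1`
  -- added to the corner.
  set ψ := arccot (X / (1 + Y)) with hψ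
  have hψ0 : 0 < ψ := arccot_pos _
  have hψ1 : ψ < Real.pi := arccot_lt_pi _
  have hsψ : 0 < Real.sin ψ := sin_arccot_pos _
  have hcψ : Real.cos ψ = X / (1 + Y) * Real.sin ψ := cos_arccot_eq _
  rw [border_add, det_border hne _ hx, add_sub_right_comm, hS, hD] at hD'
  have e1 := congrArg Complex.re hD'
  have e2 := congrArg Complex.im hD'
  simp only [Complex.mul_re, Complex.mul_im, Complex.add_re, Complex.add_im, Complex.ofReal_re,
    Complex.ofReal_im, Complex.I_re, Complex.I_im, Complex.exp_ofReal_mul_I_re,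
    Complex.exp_ofReal_mul_I_im, zero_mul, sub_zero, add_zero] at e1 e2
  -- Multiplicativity of the determinant gives this only modulo `2π`. As `θ + ψ` lies in `(0, 2π)`
  -- and has positive sine, it is below `π`, which removes the ambiguity.
  have hsum : θ' = θ + ψ := by
    have hXY : X * Real.sin ψ = (1 + Y) * Real.cos ψ := by
      rw [hcψ]; field_simp
    have c1 : r' * Real.sin ψ * Real.cos θ' = r * (1 + Y) * Real.cos (θ + ψ) := by
      rw [Real.cos_add]
      linear_combination (-Real.sin ψ) * e1 + r * Real.cos θ * hXY
    have c2 : r' * Real.sin ψ * Real.sin θ' = r * (1 + Y) * Real.sin (θ + ψ) := by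
      rw [Real.sin_add]
      linear_combination (-Real.sin ψ) * e2 + r * Real.sin θ * hXY
    have hsin : 0 < Real.sin (θ + ψ) := by
      have : 0 < r * (1 + Y) * Real.sin (θ + ψ) := by
        rw [← c2]
        exact mul_pos (mul_pos hr' hsψ) (Real.sin_pos_of_pos_of_lt_pi hθ'0 h)
      exact pos_of_mul_pos_right this (by positivity)
    have hlt : θ + ψ < Real.pi := by
      by_contra hge
      have : Real.sin (θ + ψ) ≤ 0 := by
        rw [← Real.sin_sub_two_pi]
        exact Real.sin_nonpos_of_nonpos_of_neg_pi_le (by linarith) (by linarith)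
      linarith
    have hz : Real.sin (θ' - (θ + ψ)) = 0 := by
      have : r' * Real.sin ψ * Real.sin (θ' - (θ + ψ)) = 0 := by
        rw [Real.sin_sub]
        linear_combination Real.cos (θ + ψ) * c2 - Real.sin (θ + ψ) * c1
      exact (mul_eq_zero.1 this).resolve_left (by positivity)
    have := (Real.sin_eq_zero_iff_of_lt_of_lt (by linarith) (by linarith)).1 hz
    linarith
  -- In the reduced entry the corner has no `√-1`, so the Schur complement is `X + √-1 Y`.
  have hT : reduced C d g = X + Real.cos θ / Real.sin θ * Y := by
    rw [reduced, det_border hne _ hx, hS, hD]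
    simp only [Complex.mul_im, Complex.mul_re, Complex.ofReal_re, Complex.ofReal_im,
      Complex.exp_ofReal_mul_I_re, Complex.exp_ofReal_mul_I_im, zero_mul, sub_zero, add_zero]
    field_simp
    ring
  have hcot : arccot (Real.cos θ / Real.sin θ) = θ :=
    arccot_eq_of hθ0 hθ (by field_simp)
  have hpos : 0 < X / (1 + Y) + Real.cos θ / Real.sin θ := by
    rw [← arccot_add_arccot_lt_pi, hcot]
    linarith
  rw [hsum]
  gcongr
  rw [hψ, arccot_le_arccot, hT]
  -- The reduced entry exceeds `cot ψ` by `Y (cot ψ + cot θ)`, which is nonnegative because `ψ + θ <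
  -- π`.
  have : X + Real.cos θ / Real.sin θ * Y - X / (1 + Y) =
      Y * (X / (1 + Y) + Real.cos θ / Real.sin θ) := by
    field_simp
    ring
  nlinarith [mul_nonneg hY hpos.le]

/-- The scalar core of `reduced_border_le`: `S` and `s` are Schur complements and `m` the product of
the cross terms. From `Im (D S) Im (D s) - Im D Im (D S s) = |D|² Im S Im s`, clearing denominators
leaves `|D|² (Y + Y Yc - |h|²) + |Im D · ε + Re D · h̄|²`, nonnegative by the Cauchy–Schwarz
hypothesis `hh`. -/
theorem im_mul_div_im_mul_le {D S s m : ℂ} {Y Yc : ℝ} {h ε : ℂ} (hD : 0 < D.im)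
    (hDs : 0 < (D * s).im) (hS : S.im = Y) (hs : s.im = 1 + Yc) (hY : 0 ≤ Y)
    (hh : Complex.normSq h ≤ Y * Yc)
    (hm : m = (star ε + Complex.I * h) * (ε + Complex.I * star h)) :
    (D * (S * s - m)).im / (D * s).im ≤ (D * S).im / D.im := by
  rw [div_le_div_iff₀ hDs hD, hm]
  simp only [Complex.mul_im, Complex.mul_re, Complex.add_im, Complex.add_re, Complex.sub_im,
    Complex.sub_re, Complex.I_im, Complex.I_re, Complex.star_def, Complex.conj_re, Complex.conj_im,
    Complex.normSq_apply, hS, hs] at *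
  nlinarith [sq_nonneg (D.im * ε.re + D.re * h.re), sq_nonneg (D.im * ε.im - D.re * h.im),
    mul_nonneg (add_nonneg (sq_nonneg D.re) (sq_nonneg D.im)) hY,
    mul_le_mul_of_nonneg_left hh (add_nonneg (sq_nonneg D.re) (sq_nonneg D.im))]

/-- Enlarging the matrix by a border decreases the reduced entries. -/
theorem reduced_border_le [Nonempty κ] {C : Matrix κ κ ℂ} (hC : C.IsHermitian) (d : ℝ)
    (g : κ → ℂ) (h : phase (isHermitian_border d g hC) < Real.pi) (a : ℝ) (e : ℂ) (b : κ → ℂ) :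
    reduced (border d g C) a (Sum.elim (fun _ => e) b) ≤ reduced C a b := by
  have hθ := phase_lt_of_border hC d g le_rfl h
  have hD0 := im_det_add_I_pos hC hθ
  have hD1 := im_det_add_I_pos _ h
  have hne : (C + Complex.I • (1 : Matrix κ κ ℂ)).det ≠ 0 := fun h => by simp [h] at hD0
  obtain ⟨x, hx⟩ := exists_mulVec_eq hne b
  obtain ⟨y, hy⟩ := exists_mulVec_eq hne g
  have hS := sub_star_dotProduct_eq hC a hx
  have hs := sub_star_dotProduct_eq hC d hy
  set D := (C + Complex.I • (1 : Matrix κ κ ℂ)).det with hDdef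
  rw [reduced, reduced]
  rw [border_add] at hD1 ⊢
  set s : ℂ := d + Complex.I - star g ⬝ᵥ y with hsdef
  have hdet : (border (d + Complex.I) g (C + Complex.I • (1 : Matrix κ κ ℂ))).det = D * s :=
    det_border hne _ hy
  have hs0 : s ≠ 0 := fun h0 => by simp [hdet, h0] at hD1
  -- Block elimination: the corner coordinate is `(e - g* x) / s`, and the other block is `x`
  -- corrected by that multiple of `y`.
  have hx' : border (d + Complex.I) g (C + Complex.I • (1 : Matrix κ κ ℂ)) *ᵥ
      (Sum.elim (fun _ => (e - star g ⬝ᵥ x) / s) (x - ((e - star g ⬝ᵥ x) / s) • y)) =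
      Sum.elim (fun _ => e) b := by
    rw [border, fromBlocks_mulVec]
    congr 1
    · funext i
      have h1 : ((of fun (_ : Unit) j => star (g j)) *ᵥ
          (x - ((e - star g ⬝ᵥ x) / s) • y)) i =
          star g ⬝ᵥ x - ((e - star g ⬝ᵥ x) / s) * (star g ⬝ᵥ y) := by
        rw [mulVec_sub, mulVec_smul]
        rfl
      have h2 : ((of fun (_ _ : Unit) => (d + Complex.I : ℂ)) *ᵥ
          (fun _ => (e - star g ⬝ᵥ x) / s)) i = (d + Complex.I) * ((e - star g ⬝ᵥ x) / s) := by
        simp [mulVec, dotProduct]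
      simp only [Sum.elim_comp_inl, Sum.elim_comp_inr, Pi.add_apply]
      rw [h1, h2]
      have : (d + Complex.I : ℂ) = s + star g ⬝ᵥ y := by rw [hsdef]; ring
      rw [this]
      field_simp
      ring
    · simp only [Sum.elim_comp_inl, Sum.elim_comp_inr]
      rw [mulVec_sub, mulVec_smul, hx, hy]
      funext i
      simp [mulVec, dotProduct]
      ring
  have hne' : (border (d + Complex.I) g (C + Complex.I • (1 : Matrix κ κ ℂ))).det ≠ 0 := by
    rw [hdet]; exact mul_ne_zero hne hs0
  rw [det_border hne' _ hx', hdet, det_border hne _ hx]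
  have hnum : D * s * (a - star (Sum.elim (fun _ : Unit => e) b) ⬝ᵥ
      (Sum.elim (fun _ => (e - star g ⬝ᵥ x) / s) (x - ((e - star g ⬝ᵥ x) / s) • y))) =
      D * ((a - star b ⬝ᵥ x) * s - (star e - star b ⬝ᵥ y) * (e - star g ⬝ᵥ x)) := by
    have : star (Sum.elim (fun _ : Unit => e) b) ⬝ᵥ
      (Sum.elim (fun _ => (e - star g ⬝ᵥ x) / s) (x - ((e - star g ⬝ᵥ x) / s) • y)) =
        star e * ((e - star g ⬝ᵥ x) / s) + (star b ⬝ᵥ x -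
          ((e - star g ⬝ᵥ x) / s) * (star b ⬝ᵥ y)) := by
      rw [← smul_eq_mul _ (star b ⬝ᵥ y), ← dotProduct_smul, ← dotProduct_sub]
      simp [dotProduct, Fintype.sum_sum_type]
    rw [this]
    field_simp
    ring
  rw [hnum]
  have hsre : s = ⟨d - (star y ⬝ᵥ (C *ᵥ y)).re, ∑ k, Complex.normSq (y k)⟩ + Complex.I := by
    rw [← hs, hsdef]; ring
  -- With `ε = e - conj (x* C y)` and `h = x* y`, the two cross terms are `ε̄ + √-1 h` and `ε + √-1
  -- h̄`.
  refine im_mul_div_im_mul_le (Y := ∑ k, Complex.normSq (x k))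
    (Yc := ∑ k, Complex.normSq (y k)) (h := star x ⬝ᵥ y)
    (ε := e - star (star x ⬝ᵥ (C *ᵥ y))) hD0 (hdet ▸ hD1) (by rw [hS]) ?_
    (Finset.sum_nonneg fun _ _ => Complex.normSq_nonneg _) (normSq_dotProduct_le x y) ?_
  · rw [hsre]
    simp [add_comm]
  · have h1 : star b ⬝ᵥ y = star x ⬝ᵥ (C *ᵥ y) - Complex.I * (star x ⬝ᵥ y) := by
      rw [← hx, star_mulVec_dotProduct hC]
    have h2 : star g ⬝ᵥ x = star (star x ⬝ᵥ (C *ᵥ y)) - Complex.I * star (star x ⬝ᵥ y) := by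
      rw [← hy, star_mulVec_dotProduct hC]
      congr 2
      · rw [star_dotProduct, star_mulVec, hC.eq, ← dotProduct_mulVec]
      · rw [star_dotProduct]
    rw [h1, h2, star_sub, star_star]
    ring

/-- Enumerations `f`, `f'` are kept abstract so that adjoining one index to any partial index set is
a border, up to the relabelling `e`. -/
theorem submatrix_eq_border {ι : Type*} {B : Matrix ι ι ℂ} (hB : B.IsHermitian) {κ' : Type*}
    {f : κ → ι} {f' : κ' → ι} {i : ι} (e : Unit ⊕ κ ≃ κ')
    (he : ∀ k, f' (e k) = Sum.elim (fun _ => i) f k) :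
    (B.submatrix f' f').submatrix e e =
      border ((B i i).re : ℂ) (fun k => B (f k) i) (B.submatrix f f) := by
  ext k l
  rcases k with k | k <;> rcases l with l | l <;> simp only [border, submatrix_apply, he,
    Sum.elim_inl, Sum.elim_inr, fromBlocks_apply₁₁, fromBlocks_apply₁₂, fromBlocks_apply₂₁,
    fromBlocks_apply₂₂, of_apply]
  · exact (Complex.conj_eq_iff_re.1 (hB.apply i i)).symm
  · exact (hB.apply i (f l)).symm

theorem reduced_reindex {κ' : Type*} [Fintype κ'] [DecidableEq κ'] (e : κ' ≃ κ)
    (C : Matrix κ κ ℂ) (a : ℂ) (b : κ → ℂ) :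
    reduced (C.submatrix e e) a (b ∘ e) = reduced C a b := by
  have h1 : C.submatrix e e + Complex.I • (1 : Matrix κ' κ' ℂ) =
      (C + Complex.I • (1 : Matrix κ κ ℂ)).submatrix e e := by
    ext i j
    simp [one_apply]
  have h2 : ∀ M : Matrix κ κ ℂ, border a (b ∘ e) (M.submatrix e e) =
      (border a b M).submatrix (Equiv.sumCongr (Equiv.refl Unit) e)
        (Equiv.sumCongr (Equiv.refl Unit) e) := by
    intro M
    ext k l
    rcases k with k | k <;> rcases l with l | l <;> simp [border]
  rw [reduced, reduced, h1, h2, det_submatrix_equiv_self, det_submatrix_equiv_self]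

theorem charpoly_submatrix_equiv {κ' : Type*} [Fintype κ'] [DecidableEq κ'] (e : κ' ≃ κ)
    (C : Matrix κ κ ℂ) : (C.submatrix e e).charpoly = C.charpoly := charpoly_reindex e.symm C

theorem phase_border_eq {ι : Type*} {B : Matrix ι ι ℂ} (hB : B.IsHermitian) {κ' : Type*}
    [Fintype κ'] [DecidableEq κ'] {f : κ → ι} {f' : κ' → ι} {i : ι} (e : Unit ⊕ κ ≃ κ')
    (he : ∀ k, f' (e k) = Sum.elim (fun _ => i) f k) :
    phase (isHermitian_border (B i i).re (fun k => B (f k) i) (hB.submatrix f)) =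
      phase (hB.submatrix f') := by
  refine phase_congr _ _ e ?_
  rw [← submatrix_eq_border hB e he, charpoly_submatrix_equiv]

/-- The indices of `s ⊕ κ`, for a set `s` of indices in `α`. -/
def partialIndex {α : Type*} (κ : Type*) (s : Finset α) : s ⊕ κ → α ⊕ κ :=
  Sum.map Subtype.val id

theorem exists_equiv_insert {α : Type*} [DecidableEq α] {s : Finset α} {i : α} (hi : i ∉ s) :
    ∃ e : Unit ⊕ (s ⊕ κ) ≃ (insert i s : Finset α) ⊕ κ, ∀ k,
      partialIndex κ (insert i s) (e k) =
        Sum.elim (fun _ => Sum.inl i) (partialIndex κ s) k := by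
  refine ⟨Equiv.ofBijective (Sum.elim (fun _ => Sum.inl ⟨i, Finset.mem_insert_self i s⟩)
    (Sum.map (fun k => ⟨k, Finset.mem_insert_of_mem k.2⟩) id)) ⟨?_, ?_⟩, ?_⟩
  · rintro (k | ⟨k, hk⟩ | k) (l | ⟨l, hl⟩ | l) h <;> simp at h ⊢
    · exact hi (h ▸ hl)
    · exact hi (h ▸ hk)
    · exact h
    · exact h
  · rintro (⟨k, hk⟩ | k)
    · rcases Finset.mem_insert.1 hk with rfl | hk'
      · exact ⟨Sum.inl (), rfl⟩
      · exact ⟨Sum.inr (Sum.inl ⟨k, hk'⟩), rfl⟩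
    · exact ⟨Sum.inr (Sum.inr k), rfl⟩
  · rintro (k | k | k) <;> rfl

/-- Base indices are adjoined one at a time. Each gains the arccotangent of its entry reduced by the
matrix already enlarged; the second conjunct, monotonicity of reduced entries, is carried along to
replace that entry by the one reduced by the fibre block alone. -/
theorem phase_add_sum_arccot_le [Nonempty κ] {α : Type*} [DecidableEq α]
    {B : Matrix (α ⊕ κ) (α ⊕ κ) ℂ} (hB : B.IsHermitian) (s : Finset α) :
    phase (hB.submatrix (partialIndex κ s)) < Real.pi →
    phase (hB.submatrix Sum.inr) + ∑ i ∈ s, arccot (reduced (B.submatrix Sum.inr Sum.inr)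
      (B (Sum.inl i) (Sum.inl i)).re fun k => B (Sum.inr k) (Sum.inl i)) ≤
        phase (hB.submatrix (partialIndex κ s)) ∧
    ∀ j, reduced (B.submatrix (partialIndex κ s) (partialIndex κ s))
        (B (Sum.inl j) (Sum.inl j)).re (fun k => B (partialIndex κ s k) (Sum.inl j)) ≤
      reduced (B.submatrix Sum.inr Sum.inr) (B (Sum.inl j) (Sum.inl j)).re
        fun k => B (Sum.inr k) (Sum.inl j) := by
  induction s using Finset.induction_on with
  | empty =>
    intro h
    let e : κ ≃ (∅ : Finset α) ⊕ κ := (Equiv.emptySum _ κ).symm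
    have hs : (B.submatrix (partialIndex κ ∅) (partialIndex κ ∅)).submatrix e e =
        B.submatrix Sum.inr Sum.inr := rfl
    refine ⟨?_, fun j => ?_⟩
    · rw [Finset.sum_empty, add_zero]
      refine le_of_eq (phase_congr _ _ e ?_)
      rw [← hs, charpoly_submatrix_equiv]
    · rw [← reduced_reindex e, hs]
      exact le_rfl
  | insert i s hi ih =>
    intro h
    obtain ⟨e, he⟩ := exists_equiv_insert (κ := κ) hi
    rw [← phase_border_eq hB e he] at h ⊢
    obtain ⟨h1, h2⟩ := ih (phase_lt_of_border _ _ _ le_rfl h)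
    refine ⟨?_, fun j => ?_⟩
    · have h3 := phase_add_arccot_le (hB.submatrix _) _ _ h
      have h4 := arccot_le_arccot.2 (h2 i)
      rw [Finset.sum_insert hi]
      linarith
    · refine le_trans ?_ (h2 j)
      rw [← reduced_reindex e, submatrix_eq_border hB e he]
      refine le_trans (le_of_eq ?_) (reduced_border_le (hB.submatrix _) _ _ h _ (B (Sum.inl i) (Sum.inl j)) _)
      congr 1
      funext k
      rw [Function.comp_apply, he]
      rcases k with k | k <;> rfl

/-- The reduced entries of a matrix with eigenvalues in `Γ_{θ,Θ}`. -/
theorem sum_arccot_reduced_lt [Nonempty κ] {α : Type*} [Fintype α] [DecidableEq α]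
    {B : Matrix (α ⊕ κ) (α ⊕ κ) ℂ} (hB : B.IsHermitian) {μ : α ⊕ κ → ℝ}
    (hμ : B.charpoly = ∏ i, (Polynomial.X - Polynomial.C (μ i : ℂ))) {θ Θ : ℝ}
    (hθ : θ ≤ Real.pi) (hΘ : Θ ≤ Real.pi) (h : μ ∈ Gamma (α ⊕ κ) θ Θ) :
    phase (hB.submatrix Sum.inr) < Real.pi ∧
    ∑ i, arccot (reduced (B.submatrix Sum.inr Sum.inr) (B (Sum.inl i) (Sum.inl i)).re
      fun k => B (Sum.inr k) (Sum.inl i)) + phase (hB.submatrix Sum.inr) < Θ ∧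
    ∀ j, ∑ i ∈ Finset.univ.erase j, arccot (reduced (B.submatrix Sum.inr Sum.inr)
      (B (Sum.inl i) (Sum.inl i)).re fun k => B (Sum.inr k) (Sum.inl i)) +
        phase (hB.submatrix Sum.inr) < θ := by
  have hQ : phase (hB.submatrix (partialIndex κ Finset.univ)) < Θ := by
    let e : α ⊕ κ ≃ (Finset.univ : Finset α) ⊕ κ :=
      Equiv.sumCongr (Equiv.subtypeUnivEquiv (by simp)).symm (Equiv.refl κ)
    have hs : (B.submatrix (partialIndex κ Finset.univ) (partialIndex κ Finset.univ)).submatrix e e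
        = B := by
      ext (i | i) (j | j) <;> rfl
    rw [← phase_congr hB _ e (by rw [← charpoly_submatrix_equiv e, hs])]
    obtain ⟨σ, hσ⟩ := exists_perm_eigenvalues hB hμ
    rw [phase, hσ]
    exact (mem_Gamma_iff.1 (Gamma_comp_equiv h σ)).2
  have h1 := (phase_add_sum_arccot_le hB Finset.univ (hQ.trans_le hΘ)).1
  have h0 : ∀ s : Finset α, 0 ≤ ∑ i ∈ s, arccot (reduced (B.submatrix Sum.inr Sum.inr)
      (B (Sum.inl i) (Sum.inl i)).re fun k => B (Sum.inr k) (Sum.inl i)) := fun s =>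
    Finset.sum_nonneg fun _ _ => (arccot_pos _).le
  refine ⟨by linarith [h0 Finset.univ], by linarith, fun j => ?_⟩
  obtain ⟨e, he⟩ := exists_equiv_insert (κ := κ) (Finset.notMem_erase j Finset.univ)
  -- With `j` moved to the border, `sumElim_eigenvalues_mem` puts `B_jj` and the eigenvalues of the
  -- remaining matrix in `Γ`. The first condition of `Γ` at the corner index omits `B_jj` and bounds
  -- exactly this phase.
  have hP : phase (hB.submatrix (partialIndex κ (Finset.univ.erase j))) < θ := by
    let e' : (insert j (Finset.univ.erase j) : Finset α) ⊕ κ ≃ α ⊕ κ :=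
      Equiv.sumCongr (Equiv.subtypeUnivEquiv (by simp)) (Equiv.refl κ)
    have hs : B.submatrix e' e' = B.submatrix (partialIndex κ (insert j (Finset.univ.erase j)))
        (partialIndex κ (insert j (Finset.univ.erase j))) := by
      ext (i | i) (j | j) <;> rfl
    have hb := submatrix_eq_border hB e he
    rw [← hs] at hb
    have hcp := hμ
    rw [← charpoly_submatrix_equiv e', ← charpoly_submatrix_equiv e, hb,
      ← Equiv.prod_comp (e.trans e')] at hcp
    have : Nonempty (α ⊕ κ) := inferInstance
    obtain ⟨σ, hσ⟩ := exists_perm_eigenvalues (isHermitian_border _ _ (hB.submatrix _))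
      (μ := μ ∘ (e.trans e')) hcp
    have hm := sumElim_eigenvalues_mem (hB.submatrix (partialIndex κ (Finset.univ.erase j)))
      (B (Sum.inl j) (Sum.inl j)).re
      (fun k => B (partialIndex κ (Finset.univ.erase j) k) (Sum.inl j))
      (convex_Gamma hθ hΘ) (fun x hx σ => Gamma_comp_equiv hx σ)
      (hσ ▸ Gamma_comp_equiv (Gamma_comp_equiv h (e.trans e')) σ)
    have h2 := (mem_Gamma_iff.1 hm).1 (Sum.inl ())
    have h3 : (Finset.univ.erase (Sum.inl ()) : Finset (Unit ⊕ (Finset.univ.erase j ⊕ κ))) =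
        Finset.univ.map ⟨Sum.inr, Sum.inr_injective⟩ := by
      ext k
      rcases k with k | k <;> simp
    rw [h3, Finset.sum_map] at h2
    exact h2
  have h2 := (phase_add_sum_arccot_le hB (Finset.univ.erase j) (hP.trans_le hθ)).1
  linarith

end Border

/-! ### Alternating sums of products of functions of two indices -/

section Psi

open Equiv Finset

variable {m : ℕ} {A : Type*} [CommRing A]

/-- The alternating sum `∑_σ sign σ ∏_i G_i(σ(i,0), σ(i,1))`. -/
def psi (G : Fin m → Fin m × Fin 2 → Fin m × Fin 2 → A) : A :=
  ∑ σ : Perm (Fin m × Fin 2), ((Perm.sign σ : ℤ) : A) * ∏ i, G i (σ (i, 0)) (σ (i, 1))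

/-- Reordering the factors permutes pairs of arguments, and a permutation acting on both members of
each pair is even. -/
theorem psi_perm (G : Fin m → Fin m × Fin 2 → Fin m × Fin 2 → A) (π : Perm (Fin m)) :
    psi (fun i => G (π i)) = psi G := by
  rw [psi, psi]
  refine Fintype.sum_equiv (Equiv.mulRight (prodCongrLeft fun _ : Fin 2 => π⁻¹)) _ _ fun σ => ?_
  rw [Equiv.coe_mulRight, Perm.sign_mul, Perm.sign_prodCongrLeft]
  simp only [Perm.sign_inv, prod_const, card_univ, Fintype.card_fin, Int.units_sq, mul_one]
  congr 1
  rw [← Equiv.prod_comp π⁻¹]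
  refine Finset.prod_congr rfl fun i _ => ?_
  simp [Perm.mul_apply]

/-- Exchanging the two arguments of slot `k` is a transposition, so the subtracted half contributes
the same as the first. -/
theorem psi_eq_two_mul {G G' : Fin m → Fin m × Fin 2 → Fin m × Fin 2 → A} (k : Fin m)
    (hne : ∀ i, i ≠ k → G i = G' i) (hk : ∀ x y, G k x y = G' k x y - G' k y x) :
    psi G = 2 * psi G' := by
  have h1 : psi G = psi G' - ∑ σ : Perm (Fin m × Fin 2), ((Perm.sign σ : ℤ) : A) *
      (G' k (σ (k, 1)) (σ (k, 0)) * ∏ i ∈ univ.erase k, G' i (σ (i, 0)) (σ (i, 1))) := by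
    rw [psi, psi, ← Finset.sum_sub_distrib]
    refine Finset.sum_congr rfl fun σ _ => ?_
    rw [← mul_prod_erase univ _ (mem_univ k),
      ← mul_prod_erase univ (fun i => G' i (σ (i, 0)) (σ (i, 1))) (mem_univ k), hk]
    have : ∏ i ∈ univ.erase k, G i (σ (i, 0)) (σ (i, 1)) =
        ∏ i ∈ univ.erase k, G' i (σ (i, 0)) (σ (i, 1)) :=
      Finset.prod_congr rfl fun i hi => by rw [hne i (ne_of_mem_erase hi)]
    rw [this]
    ring
  have h2 : ∑ σ : Perm (Fin m × Fin 2), ((Perm.sign σ : ℤ) : A) *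
      (G' k (σ (k, 1)) (σ (k, 0)) * ∏ i ∈ univ.erase k, G' i (σ (i, 0)) (σ (i, 1))) =
      -psi G' := by
    rw [psi, ← Finset.sum_neg_distrib]
    refine Fintype.sum_equiv (Equiv.mulRight (swap (k, 0) (k, 1))) _ _ fun σ => ?_
    have hsw : Equiv.mulRight (swap (k, (0 : Fin 2)) (k, 1)) σ = σ * swap (k, 0) (k, 1) := rfl
    rw [hsw, Perm.sign_mul, Perm.sign_swap (by simp),
      ← mul_prod_erase univ (fun i => G' i ((σ * swap (k, (0 : Fin 2)) (k, 1)) (i, 0))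
        ((σ * swap (k, (0 : Fin 2)) (k, 1)) (i, 1))) (mem_univ k)]
    have : ∏ i ∈ univ.erase k, G' i ((σ * swap (k, (0 : Fin 2)) (k, 1)) (i, 0))
        ((σ * swap (k, (0 : Fin 2)) (k, 1)) (i, 1)) =
        ∏ i ∈ univ.erase k, G' i (σ (i, 0)) (σ (i, 1)) :=
      Finset.prod_congr rfl fun i hi => by
        have := ne_of_mem_erase hi
        rw [Perm.mul_apply, Perm.mul_apply, swap_apply_of_ne_of_ne (by simp [this])
          (by simp), swap_apply_of_ne_of_ne (by simp) (by simp [this])]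
    rw [this, Perm.mul_apply, Perm.mul_apply, swap_apply_left, swap_apply_right]
    push_cast
    ring
  rw [h1, h2]
  ring

theorem psi_antisymm (F : Fin m → Fin m × Fin 2 → Fin m × Fin 2 → A) :
    psi (fun i x y => F i x y - F i y x) = 2 ^ m * psi F := by
  have key : ∀ s : Finset (Fin m), psi (fun i x y => if i ∈ s then F i x y - F i y x else F i x y) =
      2 ^ #s * psi F := by
    intro s
    induction s using Finset.induction_on with
    | empty => simp
    | insert k s hk ih =>
      rw [psi_eq_two_mul (G' := fun i x y => if i ∈ s then F i x y - F i y x else F i x y) k, ih,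
        card_insert_of_notMem hk, pow_succ]
      · ring
      · intro i hi
        simp [hi]
      · simp [hk]
  simpa using key univ

/-- The alternating sum of a sum of decomposables is a determinant. -/
theorem psi_decomposable (ζ η : Fin m → Fin m × Fin 2 → A) :
    psi (fun (_ : Fin m) x y => ∑ r, ζ r x * η r y) = m.factorial *
      (Matrix.of fun (p : Fin m × Fin 2) x => if p.2 = 0 then ζ p.1 x else η p.1 x).det := by
  have h1 : ∀ f : Fin m → Fin m, ∑ σ : Perm (Fin m × Fin 2), ((Perm.sign σ : ℤ) : A) *
      ∏ i, (ζ (f i) (σ (i, 0)) * η (f i) (σ (i, 1))) =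
      ((Matrix.of fun (p : Fin m × Fin 2) x => if p.2 = 0 then ζ p.1 x else η p.1 x).submatrix
        (fun p => (f p.1, p.2)) id).det := by
    intro f
    rw [← Matrix.det_transpose, Matrix.det_apply']
    refine Finset.sum_congr rfl fun σ _ => ?_
    rw [Fintype.prod_prod_type]
    simp [Fin.prod_univ_two]
  have h2 : psi (fun (_ : Fin m) x y => ∑ r, ζ r x * η r y) = ∑ f : Fin m → Fin m,
      ((Matrix.of fun (p : Fin m × Fin 2) x => if p.2 = 0 then ζ p.1 x else η p.1 x).submatrix
        (fun p => (f p.1, p.2)) id).det := by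
    simp_rw [← h1]
    rw [Finset.sum_comm, psi]
    refine Finset.sum_congr rfl fun σ _ => ?_
    rw [← Finset.mul_sum, Fintype.prod_sum]
  rw [h2]
  -- Expanding the product over the choices `f` of one summand per slot, a repeated choice repeats a
  -- row. The injective choices all give the same determinant, because they permute pairs of rows;
  -- this is the factor `m!`.
  have h3 : ∀ f : Fin m → Fin m, f ∉ (univ.map ⟨fun π : Perm (Fin m) => (π : Fin m → Fin m),
      DFunLike.coe_injective⟩) →
      ((Matrix.of fun (p : Fin m × Fin 2) x => if p.2 = 0 then ζ p.1 x else η p.1 x).submatrix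
        (fun p => (f p.1, p.2)) id).det = 0 := by
    intro f hf
    have hf' : ¬ Function.Injective f := by
      intro hi
      apply hf
      simp only [Finset.mem_map, mem_univ, Function.Embedding.coeFn_mk, true_and]
      exact ⟨Equiv.ofBijective f (Finite.injective_iff_bijective.1 hi), rfl⟩
    simp only [Function.Injective, not_forall] at hf'
    obtain ⟨i, j, hij, hne⟩ := hf'
    refine Matrix.det_zero_of_row_eq (i := (i, 0)) (j := (j, 0)) (by simp [hne]) ?_
    funext x
    simp [hij]
  rw [← Finset.sum_subset (subset_univ _) fun f _ hf => h3 f hf, Finset.sum_map]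
  simp only [Function.Embedding.coeFn_mk]
  have h4 : ∀ π : Perm (Fin m),
      ((Matrix.of fun (p : Fin m × Fin 2) x => if p.2 = 0 then ζ p.1 x else η p.1 x).submatrix
        (fun p => (π p.1, p.2)) id).det =
      (Matrix.of fun (p : Fin m × Fin 2) x => if p.2 = 0 then ζ p.1 x else η p.1 x).det := by
    intro π
    have := Matrix.det_permute (prodCongrLeft fun _ : Fin 2 => π)
      (Matrix.of fun (p : Fin m × Fin 2) x => if p.2 = 0 then ζ p.1 x else η p.1 x)
    rw [Perm.sign_prodCongrLeft] at this
    simp only [prod_const, card_univ, Fintype.card_fin, Int.units_sq, Units.val_one, Int.cast_one,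
      one_mul] at this
    exact this
  rw [Finset.sum_congr rfl fun π _ => h4 π]
  simp [Fintype.card_perm]

/-- By `psi_perm` only the number of slots holding `F₀` counts, which yields the binomial
coefficients; placing them in the initial slots matches `wedge_wedgePow_apply`. -/
theorem psi_add (F₀ F₁ : Fin m × Fin 2 → Fin m × Fin 2 → A) :
    psi (fun (_ : Fin m) x y => F₀ x y + F₁ x y) = ∑ j ∈ range (m + 1),
      m.choose j • psi (fun i x y => if (i : ℕ) < j then F₀ x y else F₁ x y) := by
  have h1 : psi (fun (_ : Fin m) x y => F₀ x y + F₁ x y) = ∑ S ∈ (univ : Finset (Fin m)).powerset,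
      psi (fun i x y => if i ∈ S then F₀ x y else F₁ x y) := by
    simp only [psi]
    rw [Finset.sum_comm]
    refine Finset.sum_congr rfl fun σ _ => ?_
    rw [← Finset.mul_sum, Finset.prod_add]
    congr 1
    refine Finset.sum_congr rfl fun S _ => ?_
    rw [Finset.prod_ite]
    congr 1
    · congr 1; ext; simp
    · congr 1; ext; simp
  have h2 : ∀ S : Finset (Fin m), psi (fun i x y => if i ∈ S then F₀ x y else F₁ x y) =
      psi (fun (i : Fin m) x y => if (i : ℕ) < #S then F₀ x y else F₁ x y) := by
    intro S
    have hS : #S ≤ m := (card_le_univ S).trans_eq (Fintype.card_fin m)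
    have hc : Fintype.card {i : Fin m // (i : ℕ) < #S} = Fintype.card {i // i ∈ S} := by
      rw [Fintype.card_subtype, Fintype.card_coe]
      have : (univ.filter fun i : Fin m => (i : ℕ) < #S) =
          univ.map (Fin.castLEEmb hS) := by
        ext i
        simp only [mem_filter, mem_univ, true_and, Finset.mem_map]
        exact ⟨fun h => ⟨⟨i, h⟩, rfl⟩, fun ⟨a, ha⟩ => ha ▸ a.2⟩
      rw [this, card_map, card_univ, Fintype.card_fin]
    let e := Fintype.equivOfCardEq hc
    rw [← psi_perm _ e.extendSubtype]
    congr 1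
    funext i x y
    by_cases hi : (i : ℕ) < #S
    · rw [if_pos hi, if_pos (e.extendSubtype_mem i hi)]
    · rw [if_neg hi, if_neg (e.extendSubtype_not_mem i hi)]
  rw [h1, Finset.sum_congr rfl fun S _ => h2 S, Finset.sum_powerset_apply_card
    (fun j => psi (fun (i : Fin m) x y => if (i : ℕ) < j then F₀ x y else F₁ x y))]
  simp

/-- `G` has the shape of `√-1 ∑ h_ij dz_i ∧ dz̄_j` on the real frame, with `c` the values of `dz` on
`e` and `√-1 e`. Writing it as `∑ dz_r ⊗ (√-1 ∑ h_rj dz̄_j)` up to alternation makes `psi` a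
determinant, which factors into the block `(1, √-1 h)` and copies of the matrix from `(x, y)` to
`(z, z̄)`, of determinant `-2√-1`. -/
theorem psi_hermitian (h : Matrix (Fin m) (Fin m) ℂ)
    (G : Fin m × Fin 2 → Fin m × Fin 2 → ℂ) (c : Fin 2 → ℂ) (hc : c = ![1, Complex.I])
    (hG : ∀ x y, G x y = Complex.I * (h x.1 y.1 * (c x.2 * star (c y.2))) -
      Complex.I * (h y.1 x.1 * (c y.2 * star (c x.2)))) :
    psi (fun (_ : Fin m) => G) = 4 ^ m * m.factorial * h.det := by
  have h1 : psi (fun (_ : Fin m) => G) = 2 ^ m *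
      psi (fun (_ : Fin m) x y => Complex.I * (h x.1 y.1 * (c x.2 * star (c y.2)))) := by
    rw [← psi_antisymm]
    congr 1
    funext i x y
    exact hG x y
  have h2 : (fun (_ : Fin m) (x y : Fin m × Fin 2) =>
      Complex.I * (h x.1 y.1 * (c x.2 * star (c y.2)))) = fun (_ : Fin m) x y =>
      ∑ r, (if r = x.1 then c x.2 else 0) * (Complex.I * h r y.1 * star (c y.2)) := by
    funext i x y
    simp only [ite_mul, zero_mul, Finset.sum_ite_eq', mem_univ, if_true]
    ring
  have h3 : (Matrix.of fun (p : Fin m × Fin 2) (x : Fin m × Fin 2) =>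
      if p.2 = 0 then (if p.1 = x.1 then c x.2 else 0) else Complex.I * h p.1 x.1 * star (c x.2)) =
      Matrix.blockDiagonal (fun k : Fin 2 => if k = 0 then (1 : Matrix (Fin m) (Fin m) ℂ) else
        Complex.I • h) *
      Matrix.kronecker (1 : Matrix (Fin m) (Fin m) ℂ) !![1, Complex.I; 1, -Complex.I] := by
    ext ⟨i, a⟩ ⟨k, b⟩
    rw [Matrix.mul_apply, Fintype.sum_prod_type]
    simp only [Matrix.blockDiagonal_apply, Matrix.of_apply, Fin.sum_univ_two]
    fin_cases a <;> fin_cases b <;>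
      simp [hc, Matrix.one_apply]
  rw [h1, h2, psi_decomposable, h3, Matrix.det_mul, Matrix.det_blockDiagonal,
    Matrix.kronecker, Matrix.det_kronecker]
  simp only [Fin.prod_univ_two, if_true, Matrix.det_one, one_pow, one_mul,
    Fintype.card_fin, Matrix.det_fin_two_of]
  have h4 : Complex.I ^ m * (1 * -Complex.I - Complex.I * 1) ^ m = 2 ^ m := by
    rw [← mul_pow]
    congr 1
    linear_combination (-2) * Complex.I_mul_I
  have h5 : (4 : ℂ) ^ m = 2 ^ m * 2 ^ m := by rw [← mul_pow]; norm_num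
  simp only [one_ne_zero, if_false, Matrix.det_smul, Fintype.card_fin]
  rw [h5, ← h4]
  ring

end Psi

/-! ### Wedge products as alternating sums -/

section WedgePsi

open Equiv

variable {E : Type*} [NormedAddCommGroup E] [NormedSpace ℝ E]
  {A : Type*} [NormedCommRing A] [NormedAlgebra ℝ A]

/-- A form is the alternation of the multilinear function `F`. -/
def IsAlternation {k : ℕ} (η : E [⋀^Fin k]→L[ℝ] A) (F : (Fin k → E) → A) : Prop :=
  ∃ f : MultilinearMap ℝ (fun _ : Fin k => E) A, (∀ v, f v = F v) ∧
    η.toAlternatingMap = MultilinearMap.alternatization f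

theorem IsAlternation.apply {k : ℕ} {η : E [⋀^Fin k]→L[ℝ] A} {F : (Fin k → E) → A}
    (h : IsAlternation η F) (v : Fin k → E) :
    η v = ∑ σ : Perm (Fin k), ((Perm.sign σ : ℤ) : A) * F (v ∘ σ) := by
  obtain ⟨f, hf, hη⟩ := h
  have : η v = η.toAlternatingMap v := rfl
  rw [this, hη, MultilinearMap.alternatization_apply]
  refine Finset.sum_congr rfl fun σ _ => ?_
  rw [← hf, Units.smul_def, zsmul_eq_mul]
  rfl

/-- For the unnormalised alternation, the shuffle product of two alternations is the alternation of
the tensor product, without factorials. -/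
theorem IsAlternation.wedge {a b c : ℕ} (h : a + b = c) {α : E [⋀^Fin a]→L[ℝ] A}
    {β : E [⋀^Fin b]→L[ℝ] A} {F : (Fin a → E) → A} {G : (Fin b → E) → A}
    (hα : IsAlternation α F) (hβ : IsAlternation β G) :
    IsAlternation (DHYM.wedge h α β) fun v =>
      F (fun i => v (finCongr h (Fin.castAdd b i))) *
        G (fun i => v (finCongr h (Fin.natAdd a i))) := by
  obtain ⟨f, hf, hα⟩ := hα
  obtain ⟨g, hg, hβ⟩ := hβ
  refine ⟨((LinearMap.mul' ℝ A).compMultilinearMap (f.domCoprod g)).domDomCongr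
    (finSumFinEquiv.trans (finCongr h)), fun v => ?_, ?_⟩
  · simp [MultilinearMap.domCoprod_apply, hf, hg]
  · ext v
    have h1 : (DHYM.wedge h α β).toAlternatingMap v = wedgeAlg h α β v := rfl
    rw [h1, wedgeAlg, hα, hβ, ← MultilinearMap.domCoprod_alternization,
      AlternatingMap.domDomCongr_apply, LinearMap.compAlternatingMap_apply,
      MultilinearMap.alternatization_apply, MultilinearMap.alternatization_apply, map_sum]
    refine Fintype.sum_equiv (finSumFinEquiv.trans (finCongr h)).permCongr _ _ fun σ => ?_
    rw [Perm.sign_permCongr, Units.smul_def, Units.smul_def, map_zsmul]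
    congr 1
    simp [MultilinearMap.domDomCongr_apply, Function.comp_def]

/-- Alternating a 2-form that is already alternating doubles it, whence the factor `1 / 2`. -/
theorem isAlternation_two (α : E [⋀^Fin 2]→L[ℝ] A) :
    IsAlternation α fun v => algebraMap ℝ A (1 / 2) * α ![v 0, v 1] := by
  refine ⟨(1 / 2 : ℝ) • (α.toAlternatingMap : MultilinearMap ℝ (fun _ : Fin 2 => E) A),
    fun v => ?_, ?_⟩
  · have : v = ![v 0, v 1] := by funext i; fin_cases i <;> rfl
    rw [smul_apply, Algebra.smul_def]
    conv_lhs => rw [this]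
    rfl
  · ext v
    have h1 := congrArg (fun f => f v) (AlternatingMap.coe_alternatization α.toAlternatingMap)
    rw [MultilinearMap.alternatization_apply] at h1 ⊢
    simp only [MultilinearMap.domDomCongr_apply, smul_apply, smul_comm _ (1 / 2 : ℝ)] at h1 ⊢
    rw [← Finset.smul_sum, h1]
    simp [← Nat.cast_smul_eq_nsmul ℝ, smul_smul]

theorem isAlternation_wedgePow (α : E [⋀^Fin 2]→L[ℝ] A) (m : ℕ) :
    IsAlternation (wedgePow α m) fun v => algebraMap ℝ A ((1 / 2) ^ m) *
      ∏ i : Fin m, α ![v ⟨2 * i, by omega⟩, v ⟨2 * i + 1, by omega⟩] := by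
  induction m with
  | zero =>
    have : IsEmpty (Fin (2 * 0)) := Fin.isEmpty'
    refine ⟨MultilinearMap.constOfIsEmpty ℝ _ 1, fun v => by simp, ?_⟩
    ext v
    simp [wedgePow, MultilinearMap.alternatization_apply]
  | succ m ih =>
    have := ih.wedge (c := 2 * (m + 1)) (by ring) (isAlternation_two α)
    rw [wedgePow]
    convert this using 1
    funext v
    rw [Fin.prod_univ_castSucc, pow_succ, map_mul, mul_mul_mul_comm]
    rfl

/-- The index equivalence `(i, k) ↦ 2 i + k`. -/
def pairEquiv {m c : ℕ} (h : 2 * m = c) : Fin m × Fin 2 ≃ Fin c :=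
  finProdFinEquiv.trans (finCongr (by omega))

theorem pairEquiv_val {m c : ℕ} (h : 2 * m = c) (x : Fin m × Fin 2) :
    (pairEquiv h x : ℕ) = 2 * x.1 + x.2 := by
  simp [pairEquiv, finProdFinEquiv, add_comm]

theorem IsAlternation.apply_psi {m c : ℕ} (h : 2 * m = c) {η : E [⋀^Fin c]→L[ℝ] A}
    {r : ℝ} {γ : Fin m → E → E → A}
    (hη : IsAlternation η fun v => algebraMap ℝ A r *
      ∏ i, γ i (v (pairEquiv h (i, 0))) (v (pairEquiv h (i, 1)))) (v : Fin c → E) :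
    η v = algebraMap ℝ A r *
      psi (fun i x y => γ i (v (pairEquiv h x)) (v (pairEquiv h y))) := by
  rw [hη.apply, psi, Finset.mul_sum]
  refine (Fintype.sum_equiv (pairEquiv h).permCongr _ _ fun σ => ?_).symm
  rw [Perm.sign_permCongr]
  simp only [Function.comp_apply, permCongr_apply, symm_apply_apply]
  ring

theorem pair_congr {c : ℕ} (α : E [⋀^Fin 2]→L[ℝ] A) (v : Fin c → E) {i i' j j' : Fin c}
    (hi : (i : ℕ) = i') (hj : (j : ℕ) = j') : α ![v i, v j] = α ![v i', v j'] := by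
  rw [Fin.ext hi, Fin.ext hj]

theorem wedgePow_apply (α : E [⋀^Fin 2]→L[ℝ] A) (m : ℕ) (v : Fin (2 * m) → E) :
    wedgePow α m v = algebraMap ℝ A ((1 / 2) ^ m) *
      psi (fun (_ : Fin m) x y => α ![v (pairEquiv rfl x), v (pairEquiv rfl y)]) := by
  apply IsAlternation.apply_psi (γ := fun _ x y => α ![x, y])
  convert isAlternation_wedgePow α m using 1
  funext v
  congr 1
  refine Finset.prod_congr rfl fun i _ => ?_
  exact pair_congr _ v (by simp [pairEquiv_val]) (by simp [pairEquiv_val])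

theorem wedge_wedgePow_apply (α β : E [⋀^Fin 2]→L[ℝ] A) {a b m c : ℕ} (hab : a + b = m)
    (hm : 2 * m = c) (h : 2 * a + 2 * b = c) (v : Fin c → E) :
    wedge h (wedgePow α a) (wedgePow β b) v = algebraMap ℝ A ((1 / 2) ^ m) *
      psi (fun (i : Fin m) x y => if (i : ℕ) < a then α ![v (pairEquiv hm x), v (pairEquiv hm y)]
        else β ![v (pairEquiv hm x), v (pairEquiv hm y)]) := by
  apply IsAlternation.apply_psi (γ := fun (i : Fin m) x y => if (i : ℕ) < a then α ![x, y]
    else β ![x, y])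
  convert (isAlternation_wedgePow α a).wedge h (isAlternation_wedgePow β b) using 1
  funext v
  subst hab
  rw [Fin.prod_univ_add, pow_add, map_mul, mul_mul_mul_comm]
  congr 2
  · refine Finset.prod_congr rfl fun i _ => ?_
    rw [if_pos (by simp)]
    exact pair_congr _ v (by simp [pairEquiv_val]) (by simp [pairEquiv_val])
  · refine Finset.prod_congr rfl fun i _ => ?_
    rw [if_neg (by simp)]
    exact pair_congr _ v (by simp [pairEquiv_val]; ring) (by simp [pairEquiv_val]; ring)

end WedgePsi

/-! ### (1,1)-forms evaluated on real frames of complex vectors -/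

section Frames

open Equiv Finset

/-- Composing the summation variable with `ρ` costs `sign ρ`, which the scalars `s` compensate. This
serves to show that the fibre integral is of type (1,1). -/
theorem psi_rotate {m : ℕ} {A : Type*} [CommRing A]
    (G : Fin m → Fin m × Fin 2 → Fin m × Fin 2 → A) (ρ : Perm (Fin m × Fin 2))
    (s : Fin m × Fin 2 → A) (hs : ∏ x, s x = ((Perm.sign ρ : ℤ) : A)) :
    psi (fun i x y => s x * s y * G i (ρ x) (ρ y)) = psi G := by
  rw [psi, psi]
  refine Fintype.sum_equiv (Equiv.mulLeft ρ) _ _ fun σ => ?_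
  have hσ : Equiv.mulLeft ρ σ = ρ * σ := rfl
  rw [hσ, Perm.sign_mul, Finset.prod_mul_distrib]
  have h1 : ∏ i, (s (σ (i, 0)) * s (σ (i, 1))) = ((Perm.sign ρ : ℤ) : A) := by
    rw [← hs, ← Equiv.prod_comp σ, Fintype.prod_prod_type]
    simp [Fin.prod_univ_two]
  rw [h1]
  simp only [Perm.mul_apply]
  push_cast
  ring

variable {E : Type*} [NormedAddCommGroup E] [NormedSpace ℝ E] [NormedSpace ℂ E]
  [IsScalarTower ℝ ℂ E]

theorem J_J (v : E) : J (J v) = -v := by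
  change Complex.I • Complex.I • v = -v
  rw [smul_smul, Complex.I_mul_I, neg_one_smul]

section Basic

variable {A : Type*} [NormedCommRing A] [NormedAlgebra ℝ A] {α : E [⋀^Fin 2]→L[ℝ] A}

omit [NormedSpace ℂ E] [IsScalarTower ℝ ℂ E] in
theorem pair_swap (α : E [⋀^Fin 2]→L[ℝ] A) (u v : E) : α ![v, u] = -α ![u, v] := by
  have h : α (![u, v] ∘ swap 0 1) = -α ![u, v] := α.map_swap ![u, v] (i := 0) (j := 1) (by simp)
  rw [← h]
  congr 1
  funext i
  fin_cases i <;> simp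

omit [NormedSpace ℂ E] [IsScalarTower ℝ ℂ E] in
theorem pair_neg_left (α : E [⋀^Fin 2]→L[ℝ] A) (u v : E) : α ![-u, v] = -α ![u, v] := by
  have h := α.map_update_smul ![u, v] 0 (-1 : ℝ) u
  have h1 : ∀ w, Function.update ![u, v] 0 w = ![w, v] := fun w => by
    funext i
    fin_cases i <;> simp
  rw [h1, h1] at h
  simpa using h

omit [NormedSpace ℂ E] [IsScalarTower ℝ ℂ E] in
theorem pair_neg_right (α : E [⋀^Fin 2]→L[ℝ] A) (u v : E) : α ![u, -v] = -α ![u, v] := by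
  rw [pair_swap, pair_neg_left, pair_swap α u v, neg_neg]

theorem pair_J_left (hα : ∀ u v, α ![J u, J v] = α ![u, v]) (u v : E) :
    α ![J u, v] = -α ![u, J v] := by
  rw [← hα u (J v), J_J, pair_neg_right, neg_neg]

theorem pair_J_symm (hα : ∀ u v, α ![J u, J v] = α ![u, v]) (u v : E) :
    α ![u, J v] = α ![v, J u] := by
  rw [pair_swap α (J v), pair_J_left hα, neg_neg]

end Basic

/-- The sesquilinear form `h(u, v)` of a (1,1)-form `α`. -/
def hermForm (α : E [⋀^Fin 2]→L[ℝ] ℂ) (u v : E) : ℂ :=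
  (α ![u, J v] - Complex.I * α ![u, v]) / 2

/-- The real frame `e_1, √-1 e_1, …` spanned by complex vectors. -/
def realFrame {m : ℕ} (e : Fin m → E) (x : Fin m × Fin 2) : E :=
  if x.2 = 0 then e x.1 else J (e x.1)

theorem psi_realFrame {m : ℕ} {α : E [⋀^Fin 2]→L[ℝ] ℂ} (hα : ∀ u v, α ![J u, J v] = α ![u, v])
    (e : Fin m → E) :
    psi (fun (_ : Fin m) x y => α ![realFrame e x, realFrame e y]) =
      4 ^ m * m.factorial * (Matrix.of fun i j => hermForm α (e i) (e j)).det := by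
  refine psi_hermitian _ _ _ rfl ?_
  rintro ⟨i, a⟩ ⟨j, b⟩
  have h1 := pair_J_symm hα (e i) (e j)
  have h2 := pair_swap α (e i) (e j)
  fin_cases a <;> fin_cases b <;>
    simp [realFrame, hermForm, hα, pair_J_left hα]
  · rw [← h1, h2]
    linear_combination (α ![e i, e j]) * Complex.I_mul_I
  · rw [← h1, h2]
    linear_combination (α ![e i, J (e j)]) * Complex.I_mul_I
  · rw [← h1, h2]
    linear_combination (-α ![e i, J (e j)]) * Complex.I_mul_I
  · rw [← h1, h2]
    linear_combination (α ![e i, e j]) * Complex.I_mul_I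

omit [NormedSpace ℂ E] [IsScalarTower ℝ ℂ E] in
theorem complexForm_apply (α β : E [⋀^Fin 2]→L[ℝ] ℝ) (v : Fin 2 → E) :
    complexForm α β v = α v + Complex.I * β v := rfl

theorem complexForm_J {α β : E [⋀^Fin 2]→L[ℝ] ℝ} (hα : IsOneOne α) (hβ : IsOneOne β) (u v : E) :
    complexForm α β ![J u, J v] = complexForm α β ![u, v] := by
  rw [complexForm_apply, complexForm_apply, hα, hβ]

theorem hermForm_complexForm (α β : E [⋀^Fin 2]→L[ℝ] ℝ) (u v : E) :
    hermForm (complexForm α β) u v =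
      hermForm (complexForm α 0) u v + Complex.I * hermForm (complexForm β 0) u v := by
  simp only [hermForm, complexForm_apply]
  simp
  ring

theorem wedgePow_realFrame {m : ℕ} {α : E [⋀^Fin 2]→L[ℝ] ℂ}
    (hα : ∀ u v, α ![J u, J v] = α ![u, v]) (e : Fin m → E) (v : Fin (2 * m) → E)
    (hv : ∀ x, v (pairEquiv rfl x) = realFrame e x) :
    wedgePow α m v =
      2 ^ m * m.factorial * (Matrix.of fun i j => hermForm α (e i) (e j)).det := by
  rw [wedgePow_apply]
  simp only [hv]
  rw [psi_realFrame hα]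
  have : (4 : ℂ) ^ m = 2 ^ m * 2 ^ m := by rw [← mul_pow]; norm_num
  rw [this]
  have h2 : (algebraMap ℝ ℂ ((1 / 2) ^ m)) * 2 ^ m = 1 := by
    simp
  linear_combination (2 ^ m * m.factorial * (Matrix.of fun i j => hermForm α (e i) (e j)).det) * h2

theorem im_I_pow_two_mul (k : ℕ) : (Complex.I ^ (2 * k)).im = 0 := by
  rw [pow_mul, Complex.I_sq]
  have : ((-1 : ℂ)) ^ k = (((-1 : ℝ) ^ k : ℝ) : ℂ) := by push_cast; rfl
  rw [this, Complex.ofReal_im]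

theorem im_I_pow_two_mul_add_one (k : ℕ) : (Complex.I ^ (2 * k + 1)).im = (-1) ^ k := by
  rw [pow_succ, pow_mul, Complex.I_sq]
  have : ((-1 : ℂ)) ^ k = (((-1 : ℝ) ^ k : ℝ) : ℂ) := by push_cast; rfl
  rw [this, Complex.im_ofReal_mul, Complex.I_im, mul_one]

theorem psi_ofReal {m : ℕ} (G : Fin m → Fin m × Fin 2 → Fin m × Fin 2 → ℝ) :
    psi (fun i x y => (G i x y : ℂ)) = ((psi G : ℝ) : ℂ) := by
  simp [psi]

theorem psi_mul_I {m j : ℕ} (hj : j ≤ m) (F₀ F₁ : Fin m × Fin 2 → Fin m × Fin 2 → ℝ) :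
    psi (fun (i : Fin m) x y => if (i : ℕ) < j then (F₀ x y : ℂ) else Complex.I * F₁ x y) =
      Complex.I ^ (m - j) *
        ((psi (fun (i : Fin m) x y => if (i : ℕ) < j then F₀ x y else F₁ x y) : ℝ) : ℂ) := by
  rw [← psi_ofReal, psi, psi, Finset.mul_sum]
  refine Finset.sum_congr rfl fun σ _ => ?_
  have h1 : ∀ i : Fin m, (if (i : ℕ) < j then (F₀ (σ (i, 0)) (σ (i, 1)) : ℂ) else
      Complex.I * F₁ (σ (i, 0)) (σ (i, 1))) = (if (i : ℕ) < j then 1 else Complex.I) *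
      (((if (i : ℕ) < j then F₀ (σ (i, 0)) (σ (i, 1)) else F₁ (σ (i, 0)) (σ (i, 1)) : ℝ)) : ℂ) := by
    intro i
    split_ifs <;> simp
  have h2 : ∏ i : Fin m, (if (i : ℕ) < j then (1 : ℂ) else Complex.I) = Complex.I ^ (m - j) := by
    obtain ⟨l, rfl⟩ := Nat.exists_eq_add_of_le hj
    rw [Fin.prod_univ_add]
    simp
  rw [Finset.prod_congr rfl fun i _ => h1 i, Finset.prod_mul_distrib, h2]
  ring

/-- The imaginary part of the mixed alternating sums. -/
theorem im_psi_add_I_mul {m : ℕ} (F₀ F₁ : Fin m × Fin 2 → Fin m × Fin 2 → ℝ) :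
    (psi (fun (_ : Fin m) x y => (F₀ x y : ℂ) + Complex.I * F₁ x y)).im =
      ∑ l ∈ range (m + 1), m.choose l * ((Complex.I ^ l).im *
        psi (fun (i : Fin m) x y => if (i : ℕ) < m - l then F₀ x y else F₁ x y)) := by
  rw [psi_add, ← Finset.sum_range_reflect, Complex.im_sum]
  refine Finset.sum_congr rfl fun l hl => ?_
  have hl' : l ≤ m := Nat.lt_succ_iff.1 (mem_range.1 hl)
  have e : m + 1 - 1 - l = m - l := by omega
  rw [e, psi_mul_I (Nat.sub_le m l), Nat.sub_sub_self hl', Nat.choose_symm hl', nsmul_eq_mul]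
  simp [Complex.mul_im]

/-- The coefficient `n! / ((n - 2k)! (2k+1)!)` is `choose (n+1) (2k+1) / (n+1)`, so the sum is the
imaginary part of `(α + √-1 χ)^(n+1)`, divided by `n + 1`. The only odd power of `χ` not reached by
`k ≤ (n-1)/2` is the exponent `n + 1` for even `n`, and `hdeg` kills it. -/
theorem sum_wedge_realFrame {n : ℕ} (hn : 0 < n) {α χ : E [⋀^Fin 2]→L[ℝ] ℝ} (hα : IsOneOne α)
    (hχ : IsOneOne χ) (e : Fin (n + 1) → E) (v : Fin (2 + 2 * n) → E)
    (hv : ∀ x, v (pairEquiv (by ring) x) = realFrame e x)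
    (hdeg : (Matrix.of fun i j => hermForm (complexForm χ 0) (e i) (e j)).det = 0) :
    ∑ k : Fin ((n - 1) / 2 + 1), ((-1 : ℝ) ^ (k : ℕ) *
        ((n.factorial : ℝ) / ((n - 2 * (k : ℕ)).factorial * (2 * (k : ℕ) + 1).factorial))) *
      wedge (by have := k.2; omega) (wedgePow α (n - 2 * (k : ℕ)))
        (wedgePow χ (2 * (k : ℕ) + 1)) v =
    2 ^ (n + 1) * n.factorial * (Matrix.of fun i j => hermForm (complexForm α χ) (e i) (e j)).det.im
    := by
  set ψ : ℕ → ℝ := fun l => psi (fun (i : Fin (n + 1)) x y => if (i : ℕ) < n + 1 - l then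
    α ![realFrame e x, realFrame e y] else χ ![realFrame e x, realFrame e y]) with hψ
  have h1 : ∀ k : Fin ((n - 1) / 2 + 1), wedge (by have := k.2; omega)
      (wedgePow α (n - 2 * (k : ℕ))) (wedgePow χ (2 * (k : ℕ) + 1)) v =
      (1 / 2) ^ (n + 1) * ψ (2 * k + 1) := by
    intro k
    have hk : n - 2 * (k : ℕ) + (2 * (k : ℕ) + 1) = n + 1 := by have := k.2; omega
    rw [wedge_wedgePow_apply α χ hk (by ring)]
    simp only [hv, hψ]
    have : n + 1 - (2 * (k : ℕ) + 1) = n - 2 * k := by omega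
    rw [this]
    rfl
  have h2 : (psi (fun (_ : Fin (n + 1)) x y =>
      complexForm α χ ![realFrame e x, realFrame e y])).im =
      ∑ l ∈ range (n + 2), (n + 1).choose l * ((Complex.I ^ l).im * ψ l) :=
    im_psi_add_I_mul (fun x y => α ![realFrame e x, realFrame e y])
      fun x y => χ ![realFrame e x, realFrame e y]
  have h3 : ψ (n + 1) = 0 := by
    have : ((ψ (n + 1) : ℝ) : ℂ) = psi (fun (_ : Fin (n + 1)) x y =>
        complexForm χ 0 ![realFrame e x, realFrame e y]) := by
      rw [← psi_ofReal]
      simp [complexForm_apply]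
    rw [psi_realFrame (complexForm_J hχ fun _ _ => rfl), hdeg, mul_zero] at this
    exact_mod_cast this
  rw [psi_realFrame (complexForm_J hα hχ)] at h2
  have h4 : ∑ k : Fin ((n - 1) / 2 + 1), ((n + 1).choose (2 * k + 1) : ℝ) *
      ((-1) ^ (k : ℕ) * ψ (2 * k + 1)) =
      ∑ l ∈ range (n + 2), (n + 1).choose l * ((Complex.I ^ l).im * ψ l) := by
    refine Finset.sum_of_injOn (fun k => 2 * (k : ℕ) + 1) ?_ ?_ ?_ ?_
    · intro a _ b _ h
      ext
      simpa using h
    · intro k _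
      have := k.2
      simp
      omega
    · intro l hl hl'
      rcases Nat.even_or_odd' l with ⟨k, rfl | rfl⟩
      · rw [im_I_pow_two_mul]
        ring
      · have hk : 2 * k + 1 = n + 1 := by
          by_contra hne
          apply hl'
          have := mem_range.1 hl
          exact ⟨⟨k, by omega⟩, by simp, rfl⟩
        rw [hk, h3]
        ring
    · intro k _
      rw [im_I_pow_two_mul_add_one]
  rw [← h4] at h2
  have h5 : ((4 : ℂ) ^ (n + 1) * (n + 1).factorial *
      (Matrix.of fun i j => hermForm (complexForm α χ) (e i) (e j)).det).im =
      4 ^ (n + 1) * (n + 1).factorial *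
      (Matrix.of fun i j => hermForm (complexForm α χ) (e i) (e j)).det.im := by
    rw [show ((4 : ℂ) ^ (n + 1) * (n + 1).factorial) =
      (((4 : ℝ) ^ (n + 1) * (n + 1).factorial : ℝ) : ℂ) by push_cast; rfl, Complex.im_ofReal_mul]
  rw [h5] at h2
  have hfac : ((n + 1).factorial : ℝ) = (n + 1) * n.factorial := by
    rw [Nat.factorial_succ]; push_cast; ring
  have h6 : ∑ k : Fin ((n - 1) / 2 + 1), ((-1 : ℝ) ^ (k : ℕ) *
        ((n.factorial : ℝ) / ((n - 2 * (k : ℕ)).factorial * (2 * (k : ℕ) + 1).factorial))) *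
      wedge (by have := k.2; omega) (wedgePow α (n - 2 * (k : ℕ)))
        (wedgePow χ (2 * (k : ℕ) + 1)) v = (1 / 2) ^ (n + 1) * (1 / (n + 1)) *
      ∑ k : Fin ((n - 1) / 2 + 1), ((n + 1).choose (2 * k + 1) : ℝ) *
      ((-1) ^ (k : ℕ) * ψ (2 * k + 1)) := by
    rw [Finset.mul_sum]
    refine Finset.sum_congr rfl fun k _ => ?_
    rw [h1]
    have hk : 2 * (k : ℕ) + 1 ≤ n + 1 := by have := k.2; omega
    rw [Nat.cast_choose ℝ hk, hfac]
    have : n + 1 - (2 * (k : ℕ) + 1) = n - 2 * k := by omega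
    rw [this]
    field_simp
  rw [h6, ← h2, hfac]
  have h7 : (4 : ℝ) ^ (n + 1) = 2 ^ (n + 1) * 2 ^ (n + 1) := by rw [← mul_pow]; norm_num
  rw [h7]
  field_simp
  rw [← mul_pow]
  norm_num

end Frames

/-! ### Insertion of several vectors into a form -/

section Contract

variable {E : Type*} [NormedAddCommGroup E] [NormedSpace ℝ E]
  {A : Type*} [NormedCommRing A] [NormedAlgebra ℝ A]

theorem contract_apply {k : ℕ} (m : ℕ) (w : Fin m → E) (η : E [⋀^Fin (k + m)]→L[ℝ] A)
    (u : Fin k → E) : contract m w η u =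
      η fun i => if h : (i : ℕ) < m then w ⟨i, h⟩ else u ⟨i - m, by omega⟩ := by
  induction m with
  | zero => simp [contract]
  | succ m ih =>
    rw [contract, ih]
    change η (Matrix.vecCons (w 0) _) = _
    congr 1
    funext i
    refine Fin.cases ?_ (fun i => ?_) i
    · simp
    · simp [Matrix.vecCons]

end Contract

/-! ### Stokes' theorem for alternating sums on an open subset of a vector space -/

section Stokes

open Equiv Finset

/-- The alternating sum of the derivatives of a closed form vanishes. -/
theorem sum_sign_cyclic {n : ℕ} (k j : Fin n) (hkj : k ≠ j)
    (D : Fin n × Fin 2 → Fin n × Fin 2 → Fin n × Fin 2 → ℂ)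
    (hD : ∀ r s t, D r s t + D s t r + D t r s = 0) (g : Fin n × Fin 2 → ℂ)
    (B : Fin n → Fin n × Fin 2 → Fin n × Fin 2 → ℂ) :
    ∑ σ : Perm (Fin n × Fin 2), ((Perm.sign σ : ℤ) : ℂ) * (g (σ (k, 1)) *
      (D (σ (k, 0)) (σ (j, 0)) (σ (j, 1)) *
        ∏ i ∈ (univ.erase k).erase j, B i (σ (i, 0)) (σ (i, 1)))) = 0 := by
  have hjk := hkj.symm
  -- `c` is the 3-cycle `(k,0) → (j,0) → (j,1) → (k,0)`, which is even. Summing over its powers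
  -- produces the cyclic sum that vanishes by `hD`, so three times the total is zero.
  obtain ⟨c, hc⟩ : ∃ c : Perm (Fin n × Fin 2), c = swap (k, 0) (j, 0) * swap (j, 0) (j, 1) :=
    ⟨_, rfl⟩
  have c1 : c (k, 0) = (j, 0) := by
    rw [hc, Perm.mul_apply, swap_apply_of_ne_of_ne (x := (k, 0)) (by simp [hkj]) (by simp),
      swap_apply_left]
  have c2 : c (j, 0) = (j, 1) := by
    rw [hc, Perm.mul_apply, swap_apply_left, swap_apply_of_ne_of_ne (by simp) (by simp)]
  have c3 : c (j, 1) = (k, 0) := by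
    rw [hc, Perm.mul_apply, swap_apply_right, swap_apply_right]
  have c4 : c (k, 1) = (k, 1) := by
    rw [hc, Perm.mul_apply, swap_apply_of_ne_of_ne (x := (k, 1)) (by simp) (by simp [hkj]),
      swap_apply_of_ne_of_ne (by simp) (by simp)]
  have c5 : ∀ i, i ≠ k → i ≠ j → ∀ a, c (i, a) = (i, a) := by
    intro i hik hij a
    rw [hc, Perm.mul_apply, swap_apply_of_ne_of_ne (x := (i, a)) (by simp [hij]) (by simp [hij]),
      swap_apply_of_ne_of_ne (by simp [hik]) (by simp [hij])]
  have hsign : Perm.sign c = 1 := by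
    rw [hc, Perm.sign_mul, Perm.sign_swap (by simp [hkj]), Perm.sign_swap (by simp)]
    rfl
  clear hc
  have hprod : ∀ σ : Perm (Fin n × Fin 2),
      ∏ i ∈ (univ.erase k).erase j, B i ((σ * c) (i, 0)) ((σ * c) (i, 1)) =
      ∏ i ∈ (univ.erase k).erase j, B i (σ (i, 0)) (σ (i, 1)) := fun σ =>
    Finset.prod_congr rfl fun i hi => by
      simp only [mem_erase, mem_univ, and_true] at hi
      rw [Perm.mul_apply, Perm.mul_apply, c5 i hi.2 hi.1, c5 i hi.2 hi.1]
  set T : Perm (Fin n × Fin 2) → ℂ := fun σ => ((Perm.sign σ : ℤ) : ℂ) * (g (σ (k, 1)) *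
      (D (σ (k, 0)) (σ (j, 0)) (σ (j, 1)) *
        ∏ i ∈ (univ.erase k).erase j, B i (σ (i, 0)) (σ (i, 1)))) with hT
  have h1 : ∑ σ, T (σ * c) = ∑ σ, T σ := Equiv.sum_comp (Equiv.mulRight c) T
  have h2 : ∑ σ, T (σ * c * c) = ∑ σ, T σ :=
    (Equiv.sum_comp (Equiv.mulRight c) fun σ => T (σ * c)).trans h1
  have h3 : ∑ σ, (T σ + T (σ * c) + T (σ * c * c)) = 0 := by
    refine Finset.sum_eq_zero fun σ _ => ?_
    simp only [hT]
    rw [hprod (σ * c), hprod σ, Perm.sign_mul (σ * c), Perm.sign_mul, hsign]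
    simp only [Perm.mul_apply, c1, c2, c3, c4, mul_one]
    linear_combination (((Perm.sign σ : ℤ) : ℂ) * (g (σ (k, 1)) *
      ∏ i ∈ (univ.erase k).erase j, B i (σ (i, 0)) (σ (i, 1)))) *
      hD (σ (k, 0)) (σ (j, 0)) (σ (j, 1))
  rw [Finset.sum_add_distrib, Finset.sum_add_distrib, h1, h2] at h3
  have : (3 : ℂ) * ∑ σ, T σ = 0 := by linear_combination h3
  exact (mul_eq_zero.1 this).resolve_left (by norm_num)

variable {E : Type*} [NormedAddCommGroup E] [NormedSpace ℝ E] [FiniteDimensional ℝ E]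
  [MeasurableSpace E] [BorelSpace E] (μ : Measure E) [μ.IsAddHaarMeasure]

theorem integral_fderiv_eq_zero {g : E → ℂ} (hg : ContDiff ℝ 1 g) (hc : HasCompactSupport g)
    (v : E) : ∫ z, fderiv ℝ g z v ∂μ = 0 := by
  have h1 : Integrable (fun z => fderiv ℝ g z v) μ :=
    ((hg.continuous_fderiv one_ne_zero).clm_apply continuous_const).integrable_of_hasCompactSupport
      ((hc.fderiv ℝ).comp_left (g := fun L : E →L[ℝ] ℂ => L v) rfl)
  have h2 := integral_mul_fderiv_eq_neg_fderiv_mul_of_integrable (𝕜 := ℂ) (μ := μ)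
    (f := fun _ : E => (1 : ℂ)) (g := g) (v := v) (by simp) (by simpa using h1)
    (by simpa using hg.continuous.integrable_of_hasCompactSupport hc)
    (by fun_prop) (fun z _ => hg.differentiable one_ne_zero z)
  simpa using h2

/-- After doubling, slot `k` holds a derivative of `γ`. By the product rule the integrand becomes a
sum of directional derivatives of `γ ∏ β`: the terms where a derivative falls on a factor `β` cancel
by closedness (`sum_sign_cyclic`). The factors `β` are controlled only on `U`, but the support of
`γ` makes the products globally `C¹` with compact support, so their derivatives integrate to zero.
-/
theorem integral_psi_exact {n : ℕ} {U : Set E} (hU : IsOpen U) (v : Fin n × Fin 2 → E) (k : Fin n)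
    (γ : Fin n × Fin 2 → E → ℂ) (β : Fin n → Fin n × Fin 2 → Fin n × Fin 2 → E → ℂ)
    (hγ : ∀ s, ContDiff ℝ 1 (γ s)) (hγc : ∀ s, HasCompactSupport (γ s))
    (hγU : ∀ s, tsupport (γ s) ⊆ U) (hβ : ∀ i s t, ContDiffOn ℝ 1 (β i s t) U)
    (hcl : ∀ i r s t, ∀ z ∈ U, fderiv ℝ (β i s t) z (v r) + fderiv ℝ (β i t r) z (v s) +
      fderiv ℝ (β i r s) z (v t) = 0) :
    IntegrableOn (fun z => psi (fun i x y => if i = k then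
      fderiv ℝ (γ y) z (v x) - fderiv ℝ (γ x) z (v y) else β i x y z)) U μ ∧
    ∫ z in U, psi (fun i x y => if i = k then fderiv ℝ (γ y) z (v x) - fderiv ℝ (γ x) z (v y)
      else β i x y z) ∂μ = 0 := by
  set g : Perm (Fin n × Fin 2) → E → ℂ := fun σ z =>
    γ (σ (k, 1)) z * ∏ i ∈ univ.erase k, β i (σ (i, 0)) (σ (i, 1)) z with hg
  have hsupp : ∀ σ, tsupport (g σ) ⊆ tsupport (γ (σ (k, 1))) := fun σ =>
    closure_mono (Function.support_mul_subset_left _ _)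
  have hgc : ∀ σ, HasCompactSupport (g σ) := fun σ => (hγc _).mul_right
  have hβd : ∀ i s t, ∀ z ∈ U, ContDiffAt ℝ 1 (β i s t) z := fun i s t z hz =>
    (hβ i s t).contDiffAt (hU.mem_nhds hz)
  have hgd : ∀ σ, ContDiff ℝ 1 (g σ) := fun σ => by
    refine contDiff_iff_contDiffAt.2 fun z => ?_
    by_cases hz : z ∈ tsupport (g σ)
    swap
    · exact contDiffAt_const.congr_of_eventuallyEq (notMem_tsupport_iff_eventuallyEq.1 hz)
    have hzU : z ∈ U := hγU _ (hsupp σ hz)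
    exact (hγ _).contDiffAt.mul (contDiffAt_prod fun i _ => hβd i _ _ z hzU)
  have hpt : ∀ z ∈ U, psi (fun i x y => if i = k then
      fderiv ℝ (γ y) z (v x) - fderiv ℝ (γ x) z (v y) else β i x y z) =
      2 * ∑ σ : Perm (Fin n × Fin 2), ((Perm.sign σ : ℤ) : ℂ) *
        fderiv ℝ (g σ) z (v (σ (k, 0))) := by
    intro z hz
    rw [psi_eq_two_mul (G' := fun i x y => if i = k then fderiv ℝ (γ y) z (v x) else β i x y z) k
      (fun i hi => by simp [hi]) (fun x y => by simp)]
    congr 1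
    have hder : ∀ σ : Perm (Fin n × Fin 2), fderiv ℝ (g σ) z (v (σ (k, 0))) =
        fderiv ℝ (γ (σ (k, 1))) z (v (σ (k, 0))) *
          ∏ i ∈ univ.erase k, β i (σ (i, 0)) (σ (i, 1)) z +
        ∑ j ∈ univ.erase k, γ (σ (k, 1)) z * (fderiv ℝ (β j (σ (j, 0)) (σ (j, 1))) z (v (σ (k, 0)))
          * ∏ i ∈ (univ.erase k).erase j, β i (σ (i, 0)) (σ (i, 1)) z) := by
      intro σ
      have d1 : HasFDerivAt (γ (σ (k, 1))) (fderiv ℝ (γ (σ (k, 1))) z) z :=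
        ((hγ _).differentiable one_ne_zero z).hasFDerivAt
      have d2 := HasFDerivAt.finsetProd (u := univ.erase k)
        (g := fun i z => β i (σ (i, 0)) (σ (i, 1)) z)
        (fun i _ => ((hβd i (σ (i, 0)) (σ (i, 1)) z hz).differentiableAt one_ne_zero).hasFDerivAt)
      have d3 : fderiv ℝ (g σ) z = _ := (d1.mul d2).fderiv
      rw [d3]
      simp only [_root_.add_apply, _root_.smul_apply, _root_.sum_apply, smul_eq_mul, Finset.mul_sum]
      rw [add_comm]
      congr 1
      · ring
      · refine Finset.sum_congr rfl fun j _ => ?_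
        ring
    simp only [hder, mul_add, Finset.sum_add_distrib]
    have hz0 : ∑ σ : Perm (Fin n × Fin 2), ((Perm.sign σ : ℤ) : ℂ) *
        ∑ j ∈ univ.erase k, γ (σ (k, 1)) z * (fderiv ℝ (β j (σ (j, 0)) (σ (j, 1))) z (v (σ (k, 0)))
          * ∏ i ∈ (univ.erase k).erase j, β i (σ (i, 0)) (σ (i, 1)) z) = 0 := by
      simp only [Finset.mul_sum]
      rw [Finset.sum_comm]
      refine Finset.sum_eq_zero fun j hj => ?_
      exact sum_sign_cyclic k j (ne_of_mem_erase hj).symm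
        (fun r s t => fderiv ℝ (β j s t) z (v r)) (fun r s t => hcl j r s t z hz)
        (fun s => γ s z) fun i s t => β i s t z
    rw [hz0, add_zero, psi]
    refine Finset.sum_congr rfl fun σ _ => ?_
    rw [← mul_prod_erase univ _ (mem_univ k), if_pos rfl]
    congr 2
    refine Finset.prod_congr rfl fun i hi => ?_
    rw [if_neg (ne_of_mem_erase hi)]
  have hInt : ∀ σ, Integrable (fun z => fderiv ℝ (g σ) z (v (σ (k, 0)))) μ := fun σ =>
    (((hgd σ).continuous_fderiv one_ne_zero).clm_apply
      continuous_const).integrable_of_hasCompactSupport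
      (((hgc σ).fderiv ℝ).comp_left (g := fun L : E →L[ℝ] ℂ => L (v (σ (k, 0)))) rfl)
  refine ⟨(integrableOn_congr_fun hpt hU.measurableSet).2 ((integrable_finsetSum _ fun σ _ =>
    ((hInt σ).const_mul _).integrableOn).const_mul 2), ?_⟩
  rw [setIntegral_congr_fun hU.measurableSet hpt, integral_const_mul]
  rw [integral_finsetSum _ fun σ _ => ((hInt σ).const_mul _).integrableOn]
  have hzero : ∀ σ : Perm (Fin n × Fin 2), ∫ z in U, ((Perm.sign σ : ℤ) : ℂ) *
      fderiv ℝ (g σ) z (v (σ (k, 0))) ∂μ = 0 := fun σ => by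
    rw [integral_const_mul, setIntegral_eq_integral_of_forall_compl_eq_zero,
      integral_fderiv_eq_zero μ (hgd σ) (hgc σ), mul_zero]
    intro z hz
    have : fderiv ℝ (g σ) z = 0 := by
      by_contra hne
      exact hz (hγU _ (hsupp σ (support_fderiv_subset ℝ hne)))
    rw [this]
    rfl
  rw [Finset.sum_eq_zero fun σ _ => hzero σ, mul_zero]

omit [FiniteDimensional ℝ E] [MeasurableSpace E] [BorelSpace E] in
theorem fderiv_fderiv_comm {F : Type*} [NormedAddCommGroup F] [NormedSpace ℝ F] {g : E → F}
    {z : E} (hg : ContDiffAt ℝ 2 g z) (a b : E) :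
    fderiv ℝ (fun z => fderiv ℝ g z a) z b = fderiv ℝ (fun z => fderiv ℝ g z b) z a := by
  have hd : DifferentiableAt ℝ (fderiv ℝ g) z :=
    (hg.fderiv_right (m := 1) (by norm_num)).differentiableAt one_ne_zero
  have h : ∀ a b : E, fderiv ℝ (fun z => fderiv ℝ g z a) z b = fderiv ℝ (fderiv ℝ g) z b a := by
    intro a b
    rw [fderiv_clm_apply hd (differentiableAt_const a)]
    simp
  rw [h, h]
  exact hg.isSymmSndFDerivAt (by simp) b a

theorem psi_add_slot {n : ℕ} {A : Type*} [CommRing A]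
    {G G₁ G₂ : Fin n → Fin n × Fin 2 → Fin n × Fin 2 → A} (k : Fin n)
    (h₁ : ∀ i, i ≠ k → G i = G₁ i) (h₂ : ∀ i, i ≠ k → G i = G₂ i)
    (hk : ∀ x y, G k x y = G₁ k x y + G₂ k x y) : psi G = psi G₁ + psi G₂ := by
  rw [psi, psi, psi, ← Finset.sum_add_distrib]
  refine Finset.sum_congr rfl fun σ _ => ?_
  rw [← mul_prod_erase univ (fun i => G i _ _) (mem_univ k),
    ← mul_prod_erase univ (fun i => G₁ i _ _) (mem_univ k),
    ← mul_prod_erase univ (fun i => G₂ i _ _) (mem_univ k), hk]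
  have e₁ : ∏ i ∈ univ.erase k, G₁ i (σ (i, 0)) (σ (i, 1)) =
      ∏ i ∈ univ.erase k, G i (σ (i, 0)) (σ (i, 1)) :=
    Finset.prod_congr rfl fun i hi => by rw [h₁ i (ne_of_mem_erase hi)]
  have e₂ : ∏ i ∈ univ.erase k, G₂ i (σ (i, 0)) (σ (i, 1)) =
      ∏ i ∈ univ.erase k, G i (σ (i, 0)) (σ (i, 1)) :=
    Finset.prod_congr rfl fun i hi => by rw [h₂ i (ne_of_mem_erase hi)]
  rw [e₁, e₂]
  ring

/-- The integral of the top power of a closed 2-form does not change when an exact form with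
compact support is added. -/
theorem integral_psi_add_exact {n : ℕ} {U : Set E} (hU : IsOpen U) (v : Fin n × Fin 2 → E)
    (γ : Fin n × Fin 2 → E → ℂ) (β : Fin n × Fin 2 → Fin n × Fin 2 → E → ℂ)
    (hγ : ∀ s, ContDiff ℝ 2 (γ s)) (hγc : ∀ s, HasCompactSupport (γ s))
    (hγU : ∀ s, tsupport (γ s) ⊆ U) (hβ : ∀ s t, ContDiffOn ℝ 1 (β s t) U)
    (hcl : ∀ r s t, ∀ z ∈ U, fderiv ℝ (β s t) z (v r) + fderiv ℝ (β t r) z (v s) +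
      fderiv ℝ (β r s) z (v t) = 0) :
    ∫ z in U, (psi (fun (_ : Fin n) x y => β x y z +
        (fderiv ℝ (γ y) z (v x) - fderiv ℝ (γ x) z (v y))) -
      psi (fun (_ : Fin n) x y => β x y z)) ∂μ = 0 := by
  set δ : Fin n × Fin 2 → Fin n × Fin 2 → E → ℂ := fun x y z =>
    fderiv ℝ (γ y) z (v x) - fderiv ℝ (γ x) z (v y) with hδ
  have hγ1 : ∀ s a, ContDiff ℝ 1 fun z => fderiv ℝ (γ s) z a := fun s a =>
    ((hγ s).fderiv_right (m := 1) (by norm_num)).clm_apply contDiff_const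
  have hδd : ∀ s t, ContDiff ℝ 1 (δ s t) := fun s t => (hγ1 t _).sub (hγ1 s _)
  -- `d² = 0`, from the symmetry of second derivatives.
  have hδcl : ∀ r s t z, fderiv ℝ (δ s t) z (v r) + fderiv ℝ (δ t r) z (v s) +
      fderiv ℝ (δ r s) z (v t) = 0 := by
    intro r s t z
    have h1 : ∀ s t, fderiv ℝ (δ s t) z = fderiv ℝ (fun z => fderiv ℝ (γ t) z (v s)) z -
        fderiv ℝ (fun z => fderiv ℝ (γ s) z (v t)) z := fun s t =>
      fderiv_fun_sub ((hγ1 t _).differentiable one_ne_zero z)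
        ((hγ1 s _).differentiable one_ne_zero z)
    simp only [h1, _root_.sub_apply]
    rw [fderiv_fderiv_comm (hγ t).contDiffAt (v s), fderiv_fderiv_comm (hγ s).contDiffAt (v t),
      fderiv_fderiv_comm (hγ r).contDiffAt (v t)]
    ring
  -- The slots are changed from `β` to `β + δ` one at a time; each change contributes a term with
  -- one exact slot and all others closed.
  have key : ∀ k : ℕ, k ≤ n → IntegrableOn (fun z =>
      psi (fun (i : Fin n) x y => if (i : ℕ) < k then β x y z + δ x y z else β x y z) -
      psi (fun (_ : Fin n) x y => β x y z)) U μ ∧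
      ∫ z in U, (psi (fun (i : Fin n) x y => if (i : ℕ) < k then β x y z + δ x y z else β x y z) -
      psi (fun (_ : Fin n) x y => β x y z)) ∂μ = 0 := by
    intro k
    induction k with
    | zero => intro _; simp
    | succ k ih =>
      intro hk
      obtain ⟨i1, i2⟩ := ih (by omega)
      have hex := integral_psi_exact μ hU v ⟨k, hk⟩ γ
        (fun i x y z => if (i : ℕ) < k then β x y z + δ x y z else β x y z)
        (fun s => (hγ s).of_le (by norm_num)) hγc hγU
        (fun i s t => by
          by_cases hi : (i : ℕ) < k
          · simp only [hi, if_true]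
            exact (hβ s t).add (hδd s t).contDiffOn
          · simp only [hi, if_false]
            exact hβ s t)
        (fun i r s t z hz => by
          by_cases hi : (i : ℕ) < k
          · simp only [hi, if_true]
            have h2 : ∀ s t, fderiv ℝ (fun z => β s t z + δ s t z) z =
                fderiv ℝ (β s t) z + fderiv ℝ (δ s t) z := fun s t =>
              fderiv_fun_add (((hβ s t).contDiffAt (hU.mem_nhds hz)).differentiableAt one_ne_zero)
                ((hδd s t).differentiable one_ne_zero z)
            simp only [h2, _root_.add_apply]
            linear_combination hcl r s t z hz + hδcl r s t z
          · simp only [hi, if_false]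
            exact hcl r s t z hz)
      have heq : ∀ z, psi (fun (i : Fin n) x y =>
          if (i : ℕ) < k + 1 then β x y z + δ x y z else β x y z) -
          psi (fun (_ : Fin n) x y => β x y z) =
          (psi (fun (i : Fin n) x y => if (i : ℕ) < k then β x y z + δ x y z else β x y z) -
            psi (fun (_ : Fin n) x y => β x y z)) +
          psi (fun (i : Fin n) x y => if i = ⟨k, hk⟩ then
            fderiv ℝ (γ y) z (v x) - fderiv ℝ (γ x) z (v y) else
            if (i : ℕ) < k then β x y z + δ x y z else β x y z) := by
        intro z
        rw [psi_add_slot (G := fun (i : Fin n) x y =>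
          if (i : ℕ) < k + 1 then β x y z + δ x y z else β x y z)
          (G₁ := fun (i : Fin n) x y => if (i : ℕ) < k then β x y z + δ x y z else β x y z)
          (G₂ := fun (i : Fin n) x y => if i = ⟨k, hk⟩ then
            fderiv ℝ (γ y) z (v x) - fderiv ℝ (γ x) z (v y) else
            if (i : ℕ) < k then β x y z + δ x y z else β x y z) ⟨k, hk⟩]
        · ring
        · intro i hi
          have : (i : ℕ) ≠ k := fun h => hi (Fin.ext h)
          funext x y
          have h3 : (i : ℕ) < k + 1 ↔ (i : ℕ) < k := by omega
          simp only [h3]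
        · intro i hi
          have : (i : ℕ) ≠ k := fun h => hi (Fin.ext h)
          funext x y
          have h3 : (i : ℕ) < k + 1 ↔ (i : ℕ) < k := by omega
          simp only [h3, hi, if_false]
        · intro x y
          simp [hδ]
      simp only [heq]
      exact ⟨i1.add hex.1, by rw [integral_add i1 hex.1, i2, hex.2, add_zero]⟩
  have := (key n le_rfl).2
  simpa using this

end Stokes

/-! ### Forms, exterior derivative and `√-1 ∂∂̄` in charts -/

section Charts

open Set Filter Topology

variable {E H : Type*} [NormedAddCommGroup E] [NormedSpace ℝ E] [TopologicalSpace H]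
  (I : ModelWithCorners ℝ E H) {X : Type*} [TopologicalSpace X] [ChartedSpace H X]

/-- The derivative of the inverse of the preferred chart at `a`. -/
def symD (a : X) (z : E) : E →L[ℝ] E :=
  mfderiv 𝓘(ℝ, E) I (extChartAt I a).symm z

/-- The transition map from the chart at `a` to the chart at `b`. -/
def transition (a b : X) : E → E := extChartAt I b ∘ (extChartAt I a).symm

theorem inChart_apply {k : ℕ} (η : X → E [⋀^Fin k]→L[ℝ] ℝ) (a : X) (z : E) (v : Fin k → E) :
    inChart I η a z v = η ((extChartAt I a).symm z) fun i => symD I a z (v i) := rfl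

theorem symm_transition {a b : X} {z : E}
    (hb : (extChartAt I a).symm z ∈ (extChartAt I b).source) :
    (extChartAt I b).symm (transition I a b z) = (extChartAt I a).symm z :=
  (extChartAt I b).left_inv hb

theorem transition_mem {a b : X} {z : E}
    (hb : (extChartAt I a).symm z ∈ (extChartAt I b).source) :
    transition I a b z ∈ (extChartAt I b).target :=
  (extChartAt I b).map_source hb

theorem extD_eq [IsManifold I ∞ X] {k : ℕ} (η : X → E [⋀^Fin k]→L[ℝ] ℝ) (x : X) :
    extD I η x = extDeriv (inChart I η x) (extChartAt I x x) := by
  have h := mfderiv_extChartAt_self (I := I) (x := x)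
  rw [extD, pullback, h]
  rfl

variable [I.Boundaryless] [IsManifold I ∞ X]

theorem contDiffAt_transition {a b : X} {z : E} (hz : z ∈ (extChartAt I a).target)
    (hb : (extChartAt I a).symm z ∈ (extChartAt I b).source) :
    ContDiffAt ℝ ∞ (transition I a b) z := by
  have h := contDiffWithinAt_ext_coord_change (I := I) (n := ∞) (x := b) (x' := a) (y := z)
    (by rw [PartialEquiv.trans_source]; exact ⟨hz, hb⟩)
  rwa [I.range_eq_univ, contDiffWithinAt_univ] at h

theorem mdifferentiableAt_symm {a : X} {z : E} (hz : z ∈ (extChartAt I a).target) :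
    MDifferentiableAt 𝓘(ℝ, E) I (extChartAt I a).symm z := by
  have : IsManifold I 1 X := IsManifold.of_le (n := ∞) (by norm_num)
  have h := mdifferentiableWithinAt_extChartAt_symm (I := I) hz
  rwa [I.range_eq_univ, mdifferentiableWithinAt_univ] at h

/-- Tangent vectors at a point are recorded in the preferred chart of that point, so the derivative
of an inverse chart is that of a transition map whose target chart depends on `z`. -/
theorem symD_eq {a : X} {z : E} (hz : z ∈ (extChartAt I a).target) :
    symD I a z = fderiv ℝ (transition I a ((extChartAt I a).symm z)) z := by
  rw [symD, (mdifferentiableAt_symm I hz).mfderiv]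
  simp [transition, writtenInExtChartAt, fderivWithin_univ]
  rfl

theorem symD_self (x : X) : symD I x (extChartAt I x x) = ContinuousLinearMap.id ℝ E := by
  have h := mfderivWithin_range_extChartAt_symm (I := I) (x := x)
  rw [I.range_eq_univ, mfderivWithin_univ] at h
  exact h

theorem eventually_overlap {a b : X} {z : E} (hz : z ∈ (extChartAt I a).target)
    (hb : (extChartAt I a).symm z ∈ (extChartAt I b).source) :
    ∀ᶠ w in 𝓝 z, w ∈ (extChartAt I a).target ∧
      (extChartAt I a).symm w ∈ (extChartAt I b).source := by
  filter_upwards [(isOpen_extChartAt_target a).mem_nhds hz,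
    (continuousAt_extChartAt_symm'' hz).preimage_mem_nhds
      ((isOpen_extChartAt_source b).mem_nhds hb)] with w h₁ h₂ using ⟨h₁, h₂⟩

theorem symD_transition {a b : X} {z : E} (hz : z ∈ (extChartAt I a).target)
    (hb : (extChartAt I a).symm z ∈ (extChartAt I b).source) :
    symD I a z = (symD I b (transition I a b z)).comp (fderiv ℝ (transition I a b) z) := by
  have hτ := (contDiffAt_transition I hz hb).differentiableAt (by simp)
  have hw := transition_mem I hb
  have hx := symm_transition I hb
  rw [symD_eq I hz, symD_eq I hw, hx]
  have hd : DifferentiableAt ℝ (transition I b ((extChartAt I a).symm z)) (transition I a b z) :=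
    (contDiffAt_transition I hw (by rw [hx]; exact mem_extChartAt_source _)).differentiableAt
      (by simp)
  rw [← fderiv_comp z hd hτ]
  refine Filter.EventuallyEq.fderiv_eq ?_
  filter_upwards [eventually_overlap I hz hb] with w hw
  simp only [Function.comp_apply, transition]
  rw [(extChartAt I b).left_inv hw.2]

theorem inChart_transition {k : ℕ} (η : X → E [⋀^Fin k]→L[ℝ] ℝ) {a b : X} {z : E}
    (hz : z ∈ (extChartAt I a).target)
    (hb : (extChartAt I a).symm z ∈ (extChartAt I b).source) :
    inChart I η a z = (inChart I η b (transition I a b z)).compContinuousLinearMap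
      (fderiv ℝ (transition I a b) z) := by
  ext v
  change η _ _ = η _ _
  rw [symm_transition I hb]
  congr 1
  funext i
  change symD I a z (v i) = _
  rw [symD_transition I hz hb]
  rfl

theorem inChart_self {k : ℕ} (η : X → E [⋀^Fin k]→L[ℝ] ℝ) (x : X) :
    inChart I η x (extChartAt I x x) = η x := by
  ext v
  rw [inChart_apply, extChartAt_to_inv, symD_self]
  rfl

/-- The exterior derivative can be computed in every chart. -/
theorem inChart_extD {k : ℕ} {η : X → E [⋀^Fin k]→L[ℝ] ℝ}
    (hη : ∀ x, DifferentiableAt ℝ (inChart I η x) (extChartAt I x x)) {a : X} {z : E}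
    (hz : z ∈ (extChartAt I a).target) :
    inChart I (extD I η) a z = extDeriv (inChart I η a) z := by
  set x := (extChartAt I a).symm z with hx
  have hxs : (extChartAt I a).symm z ∈ (extChartAt I x).source := mem_extChartAt_source _
  have hτ : transition I a x z = extChartAt I x x := by simp [transition, hx]
  have h1 : extDeriv (inChart I η a) z = extDeriv (fun w =>
      (inChart I η x (transition I a x w)).compContinuousLinearMap
        (fderiv ℝ (transition I a x) w)) z := by
    refine Filter.EventuallyEq.extDeriv_eq ?_
    filter_upwards [eventually_overlap I hz hxs] with w hw
    exact inChart_transition I η hw.1 hw.2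
  -- Naturality of the exterior derivative under the transition map to the preferred chart of the
  -- point, in which `extD` is defined.
  rw [h1, extDeriv_pullback (r := ∞) (by rw [hτ]; exact hη x) (contDiffAt_transition I hz hxs)
    (by simpa using ENat.LEInfty.out), hτ, ← extD_eq, ← symD_eq I hz]
  rfl

theorem IsSmoothForm.differentiableAt {k : ℕ} {η : X → E [⋀^Fin k]→L[ℝ] ℝ}
    (hη : IsSmoothForm I η) {a : X} {z : E} (hz : z ∈ (extChartAt I a).target) :
    DifferentiableAt ℝ (inChart I η a) z :=
  ((hη a).contDiffAt ((isOpen_extChartAt_target a).mem_nhds hz)).differentiableAt (by simp)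

theorem extDeriv_eq_zero_iff_cyclic {E : Type*} [NormedAddCommGroup E] [NormedSpace ℝ E]
    {β : E → E [⋀^Fin 2]→L[ℝ] ℝ} {z : E}
    (hβ : DifferentiableAt ℝ β z) (h : extDeriv β z = 0) (r s t : E) :
    fderiv ℝ (fun z => β z ![s, t]) z r + fderiv ℝ (fun z => β z ![t, r]) z s +
      fderiv ℝ (fun z => β z ![r, s]) z t = 0 := by
  have h1 := extDeriv_apply hβ ![r, s, t]
  rw [h] at h1
  have e1 : (fun z => β z ((1 : Fin 3).removeNth ![r, s, t])) = fun z => β z ![r, t] := by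
    funext z; congr 1; funext i; fin_cases i <;> rfl
  have e2 : (fun z => β z ((2 : Fin 3).removeNth ![r, s, t])) = fun z => β z ![r, s] := by
    funext z; congr 1; funext i; fin_cases i <;> rfl
  have e3 : (fun z => β z ![t, r]) = fun z => -β z ![r, t] := by
    funext z; exact pair_swap _ _ _
  rw [e3, fderiv_fun_neg]
  simp [Fin.sum_univ_three, e1, e2] at h1
  simp
  linarith

/-- A 2-form is continuously differentiable and closed, in coordinates. -/
def IsCyclicClosed (β : X → E [⋀^Fin 2]→L[ℝ] ℝ) : Prop :=
  ∀ a : X, (∀ u v, ContDiffOn ℝ 1 (fun z => inChart I β a z ![u, v]) (extChartAt I a).target) ∧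
    ∀ r s t, ∀ z ∈ (extChartAt I a).target,
      fderiv ℝ (fun z => inChart I β a z ![s, t]) z r +
      fderiv ℝ (fun z => inChart I β a z ![t, r]) z s +
      fderiv ℝ (fun z => inChart I β a z ![r, s]) z t = 0

theorem IsClosedForm.isCyclicClosed {β : X → E [⋀^Fin 2]→L[ℝ] ℝ} (hβ : IsClosedForm I β) :
    IsCyclicClosed I β := by
  refine fun a => ⟨fun u v => ?_, fun r s t z hz => ?_⟩
  · have h : ContDiffOn ℝ 1 (inChart I β a) (extChartAt I a).target :=
      (hβ.smooth a).of_le (by exact_mod_cast le_top)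
    exact (ContinuousAlternatingMap.apply ℝ E ℝ ![u, v]).contDiff.comp_contDiffOn h
  · refine extDeriv_eq_zero_iff_cyclic (hβ.smooth.differentiableAt I hz) ?_ r s t
    rw [← inChart_extD I (fun x => hβ.smooth.differentiableAt I (mem_extChartAt_target x)) hz]
    ext v
    rw [inChart_apply, hβ.closed]
    rfl

theorem IsCyclicClosed.add {β γ : X → E [⋀^Fin 2]→L[ℝ] ℝ} (hβ : IsCyclicClosed I β)
    (hγ : IsCyclicClosed I γ) : IsCyclicClosed I (β + γ) := by
  have e : ∀ a u v, (fun z => inChart I (β + γ) a z ![u, v]) =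
    fun z => inChart I β a z ![u, v] + inChart I γ a z ![u, v] := fun a u v => rfl
  refine fun a => ⟨fun u v => ?_, fun r s t z hz => ?_⟩
  · rw [e]
    exact ((hβ a).1 u v).add ((hγ a).1 u v)
  · have d : ∀ {β : X → E [⋀^Fin 2]→L[ℝ] ℝ}, IsCyclicClosed I β → ∀ u v, DifferentiableAt ℝ
      (fun z => inChart I β a z ![u, v]) z := fun hβ u v =>
      (((hβ a).1 u v).contDiffAt ((isOpen_extChartAt_target a).mem_nhds hz)).differentiableAt
        (by simp)
    simp only [e, fderiv_fun_add (d hβ _ _) (d hγ _ _), _root_.add_apply]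
    linarith [(hβ a).2 r s t z hz, (hγ a).2 r s t z hz]

theorem IsCyclicClosed.smul {β : X → E [⋀^Fin 2]→L[ℝ] ℝ} (c : ℝ) (hβ : IsCyclicClosed I β) :
    IsCyclicClosed I (c • β) := by
  have e : ∀ a u v, (fun z => inChart I (c • β) a z ![u, v]) =
    fun z => c * inChart I β a z ![u, v] := fun a u v => rfl
  refine fun a => ⟨fun u v => ?_, fun r s t z hz => ?_⟩
  · rw [e]
    exact contDiffOn_const.mul ((hβ a).1 u v)
  · have d : ∀ u v, DifferentiableAt ℝ
      (fun z => inChart I β a z ![u, v]) z := fun u v =>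
      (((hβ a).1 u v).contDiffAt ((isOpen_extChartAt_target a).mem_nhds hz)).differentiableAt
        (by simp)
    simp only [e, fderiv_const_mul (d _ _), _root_.smul_apply, smul_eq_mul]
    linear_combination c * (hβ a).2 r s t z hz

section Iddbar

variable [NormedSpace ℂ E] [IsScalarTower ℝ ℂ E]

/-- The charts are compatible with the complex structure. -/
def IsHolomorphicAtlas (I : ModelWithCorners ℝ E H) (X : Type*) [TopologicalSpace X]
    [ChartedSpace H X] : Prop :=
  ∀ a : X, ∀ z ∈ (extChartAt I a).target, ∀ v, symD I a z (J v) = J (symD I a z v)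

omit [I.Boundaryless] in
theorem contDiffOn_comp_symm {φ : X → ℝ} (hφ : ContMDiff I 𝓘(ℝ, ℝ) ∞ φ) (a : X) :
    ContDiffOn ℝ ∞ (φ ∘ (extChartAt I a).symm) (extChartAt I a).target :=
  contMDiffOn_iff_contDiffOn.1 (hφ.comp_contMDiffOn (contMDiffOn_extChartAt_symm a))

variable (hJ : IsHolomorphicAtlas I X)
include hJ

theorem inChart_dCompJ {φ : X → ℝ} (hφ : ContMDiff I 𝓘(ℝ, ℝ) ∞ φ) {a : X} {z : E}
    (hz : z ∈ (extChartAt I a).target) :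
    inChart I (dCompJ I φ) a z = ContinuousAlternatingMap.ofSubsingleton ℝ E ℝ (0 : Fin 1)
      ((fderiv ℝ (φ ∘ (extChartAt I a).symm) z).comp J) := by
  ext v
  have hd := hφ.mdifferentiableAt (by simp) (x := (extChartAt I a).symm z)
  have h := mfderiv_comp z hd (mdifferentiableAt_symm I hz)
  rw [mfderiv_eq_fderiv] at h
  rw [inChart_apply]
  change (mfderiv I 𝓘(ℝ, ℝ) φ _ : E →L[ℝ] ℝ) (J (E := E) (symD I a z (v 0))) =
    fderiv ℝ (φ ∘ (extChartAt I a).symm) z (J (v 0))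
  rw [h, ← hJ a z hz]
  rfl

/-- The form `√-1 ∂∂̄ φ` in coordinates. -/
theorem inChart_iddbar {φ : X → ℝ} (hφ : ContMDiff I 𝓘(ℝ, ℝ) ∞ φ) {a : X} {z : E}
    (hz : z ∈ (extChartAt I a).target) (u v : E) :
    inChart I (iddbar I φ) a z ![u, v] =
      -(1 / 2) * (fderiv ℝ (fun z => fderiv ℝ (φ ∘ (extChartAt I a).symm) z (J v)) z u -
        fderiv ℝ (fun z => fderiv ℝ (φ ∘ (extChartAt I a).symm) z (J u)) z v) := by
  have hev : ∀ {a : X} {z : E}, z ∈ (extChartAt I a).target → inChart I (dCompJ I φ) a =ᶠ[𝓝 z]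
      fun z =>
        ContinuousAlternatingMap.ofSubsingletonLIE (𝕜 := ℝ) (E := E) (F := ℝ) (0 : Fin 1)
        ((fderiv ℝ (φ ∘ (extChartAt I a).symm) z).comp J) := by
    intro a z hz
    filter_upwards [(isOpen_extChartAt_target a).mem_nhds hz] with w hw
    exact inChart_dCompJ I hJ hφ hw
  have hdd : ∀ {a : X} {z : E}, z ∈ (extChartAt I a).target → DifferentiableAt ℝ (fun z =>
      ContinuousAlternatingMap.ofSubsingletonLIE (𝕜 := ℝ) (E := E) (F := ℝ) (0 : Fin 1)
        ((fderiv ℝ (φ ∘ (extChartAt I a).symm) z).comp J)) z := by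
    intro a z hz
    have h1 : DifferentiableAt ℝ (fderiv ℝ (φ ∘ (extChartAt I a).symm)) z :=
      (((contDiffOn_comp_symm I hφ a).contDiffAt
        ((isOpen_extChartAt_target a).mem_nhds hz)).fderiv_right (m := ∞)
          le_rfl).differentiableAt (by simp)
    exact (ContinuousAlternatingMap.ofSubsingletonLIE (𝕜 := ℝ) (E := E) (F := ℝ) (0 : Fin 1)).differentiableAt.comp z
      (h1.clm_comp (differentiableAt_const _))
  have h2 : inChart I (extD I (dCompJ I φ)) a z = extDeriv (inChart I (dCompJ I φ) a) z :=
    inChart_extD I (fun x => (hdd (mem_extChartAt_target x)).congr_of_eventuallyEq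
      (hev (mem_extChartAt_target x))) hz
  change (-1 / 2 : ℝ) * inChart I (extD I (dCompJ I φ)) a z ![u, v] = _
  rw [h2, (hev hz).extDeriv_eq, extDeriv_apply (hdd hz)]
  simp [Fin.sum_univ_two, Fin.removeNth]
  ring

end Iddbar

end Charts

/-! ### Closedness, additivity and locality of `√-1 ∂∂̄` -/

section Iddbar

open Set Filter Topology

variable {E H : Type*} [NormedAddCommGroup E] [NormedSpace ℝ E] [TopologicalSpace H]
  (I : ModelWithCorners ℝ E H) {X : Type*} [TopologicalSpace X] [ChartedSpace H X]
  [I.Boundaryless] [IsManifold I ∞ X] [NormedSpace ℂ E] [IsScalarTower ℝ ℂ E]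
  (hJ : IsHolomorphicAtlas I X)

theorem contDiffAt_comp_symm {φ : X → ℝ} (hφ : ContMDiff I 𝓘(ℝ, ℝ) ∞ φ) {a : X} {z : E}
    (hz : z ∈ (extChartAt I a).target) : ContDiffAt ℝ ∞ (φ ∘ (extChartAt I a).symm) z :=
  (contDiffOn_comp_symm I hφ a).contDiffAt ((isOpen_extChartAt_target a).mem_nhds hz)

theorem _root_.ContDiffAt.fderiv_apply_const {f : E → ℝ} {z : E} (hf : ContDiffAt ℝ ∞ f z) (v : E) :
    ContDiffAt ℝ ∞ (fun z => fderiv ℝ f z v) z :=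
  (hf.fderiv_right (m := ∞) le_rfl).clm_apply contDiffAt_const

theorem ext_pair {α β : E [⋀^Fin 2]→L[ℝ] ℝ} (h : ∀ u v, α ![u, v] = β ![u, v]) : α = β := by
  ext v
  have : v = ![v 0, v 1] := by funext i; fin_cases i <;> rfl
  rw [this]
  exact h _ _

include hJ

/-- In coordinates the form is `-1/2` times the differential of `v ↦ dφ(J v)`, so closedness is
again the symmetry of second derivatives. -/
theorem isCyclicClosed_iddbar {φ : X → ℝ} (hφ : ContMDiff I 𝓘(ℝ, ℝ) ∞ φ) :
    IsCyclicClosed I (iddbar I φ) := by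
  intro a
  have hT : IsOpen (extChartAt I a).target := isOpen_extChartAt_target a
  set G : E → E → ℝ := fun v z => fderiv ℝ (φ ∘ (extChartAt I a).symm) z (J v) with hG
  have hGs : ∀ v, ∀ z ∈ (extChartAt I a).target, ContDiffAt ℝ ∞ (G v) z := fun v z hz =>
    (contDiffAt_comp_symm I hφ hz).fderiv_apply_const _
  have hGG : ∀ v u, ∀ z ∈ (extChartAt I a).target,
      ContDiffAt ℝ ∞ (fun z => fderiv ℝ (G v) z u) z := fun v u z hz =>
    (hGs v z hz).fderiv_apply_const _
  refine ⟨fun u v => ?_, fun r s t z hz => ?_⟩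
  · refine ContDiffOn.congr (f := fun z => -(1 / 2) * (fderiv ℝ (G v) z u - fderiv ℝ (G u) z v)) ?_
      fun z hz => inChart_iddbar I hJ hφ hz u v
    intro z hz
    exact (contDiffAt_const.mul ((hGG v u z hz).sub (hGG u v z hz))).contDiffWithinAt.of_le
      ENat.LEInfty.out
  · have hev : ∀ u v, (fun z => inChart I (iddbar I φ) a z ![u, v]) =ᶠ[𝓝 z]
        fun z => -(1 / 2) * (fderiv ℝ (G v) z u - fderiv ℝ (G u) z v) := by
      intro u v
      filter_upwards [hT.mem_nhds hz] with w hw using inChart_iddbar I hJ hφ hw u v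
    have hd : ∀ u v, DifferentiableAt ℝ (fun z => fderiv ℝ (G v) z u) z := fun u v =>
      (hGG v u z hz).differentiableAt (by simp)
    have hf : ∀ u v w, fderiv ℝ (fun z => inChart I (iddbar I φ) a z ![u, v]) z w =
        -(1 / 2) * (fderiv ℝ (fun z => fderiv ℝ (G v) z u) z w -
          fderiv ℝ (fun z => fderiv ℝ (G u) z v) z w) := by
      intro u v w
      rw [(hev u v).fderiv_eq, fderiv_const_mul ((hd u v).fun_sub (hd v u)),
        fderiv_fun_sub (hd u v) (hd v u)]
      rfl
    have h2 : ∀ v, ContDiffAt ℝ 2 (G v) z := fun v => (hGs v z hz).of_le ENat.LEInfty.out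
    simp only [hf]
    rw [fderiv_fderiv_comm (h2 t) s r, fderiv_fderiv_comm (h2 s) t r,
      fderiv_fderiv_comm (h2 r) t s]
    ring

theorem iddbar_apply {φ : X → ℝ} (hφ : ContMDiff I 𝓘(ℝ, ℝ) ∞ φ) (x : X) (u v : E) :
    iddbar I φ x ![u, v] = -(1 / 2) *
      (fderiv ℝ (fun z => fderiv ℝ (φ ∘ (extChartAt I x).symm) z (J v)) (extChartAt I x x) u -
        fderiv ℝ (fun z => fderiv ℝ (φ ∘ (extChartAt I x).symm) z (J u)) (extChartAt I x x) v) := by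
  rw [← inChart_iddbar I hJ hφ (mem_extChartAt_target x), inChart_self]

theorem iddbar_add {φ ψ : X → ℝ} (hφ : ContMDiff I 𝓘(ℝ, ℝ) ∞ φ)
    (hψ : ContMDiff I 𝓘(ℝ, ℝ) ∞ ψ) : iddbar I (φ + ψ) = iddbar I φ + iddbar I ψ := by
  funext x
  refine ext_pair fun u v => ?_
  have hs : ContMDiff I 𝓘(ℝ, ℝ) ∞ (φ + ψ) := hφ.add hψ
  change _ = iddbar I φ x ![u, v] + iddbar I ψ x ![u, v]
  rw [iddbar_apply I hJ hs, iddbar_apply I hJ hφ, iddbar_apply I hJ hψ]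
  have hx := mem_extChartAt_target (I := I) x
  have h : ∀ u v, fderiv ℝ (fun z => fderiv ℝ ((φ + ψ) ∘ (extChartAt I x).symm) z v)
      (extChartAt I x x) u =
      fderiv ℝ (fun z => fderiv ℝ (φ ∘ (extChartAt I x).symm) z v) (extChartAt I x x) u +
      fderiv ℝ (fun z => fderiv ℝ (ψ ∘ (extChartAt I x).symm) z v) (extChartAt I x x) u := by
    intro u v
    have hev : (fun z => fderiv ℝ ((φ + ψ) ∘ (extChartAt I x).symm) z v) =ᶠ[𝓝 (extChartAt I x x)]
        fun z => fderiv ℝ (φ ∘ (extChartAt I x).symm) z v +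
          fderiv ℝ (ψ ∘ (extChartAt I x).symm) z v := by
      filter_upwards [(isOpen_extChartAt_target x).mem_nhds hx] with w hw
      have h1 := fderiv_add ((contDiffAt_comp_symm I hφ hw).differentiableAt (by simp))
        ((contDiffAt_comp_symm I hψ hw).differentiableAt (by simp))
      change fderiv ℝ (φ ∘ (extChartAt I x).symm + ψ ∘ (extChartAt I x).symm) w v = _
      rw [h1]
      rfl
    rw [hev.fderiv_eq, fderiv_fun_add
      (((contDiffAt_comp_symm I hφ hx).fderiv_apply_const v).differentiableAt (by simp))
      (((contDiffAt_comp_symm I hψ hx).fderiv_apply_const v).differentiableAt (by simp))]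
    rfl
  rw [h, h]
  ring

theorem iddbar_eq_zero {φ : X → ℝ} (hφ : ContMDiff I 𝓘(ℝ, ℝ) ∞ φ) {x : X}
    (h : φ =ᶠ[𝓝 x] 0) : iddbar I φ x = 0 := by
  refine ext_pair fun u v => ?_
  have h1 : φ ∘ (extChartAt I x).symm =ᶠ[𝓝 (extChartAt I x x)] 0 := by
    have := (continuousAt_extChartAt_symm (I := I) x).tendsto
    rw [extChartAt_to_inv] at this
    exact this.eventually h
  have h2 : ∀ v, (fun z => fderiv ℝ (φ ∘ (extChartAt I x).symm) z v) =ᶠ[𝓝 (extChartAt I x x)]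
      fun _ => 0 := by
    intro v
    filter_upwards [h1.fderiv (𝕜 := ℝ)] with z hz
    rw [hz]
    simp
  rw [iddbar_apply I hJ hφ, (h2 _).fderiv_eq, (h2 _).fderiv_eq]
  simp

theorem iddbar_sum {ι : Type*} (s : Finset ι) {f : ι → X → ℝ}
    (hf : ∀ i, ContMDiff I 𝓘(ℝ, ℝ) ∞ (f i)) :
    iddbar I (∑ i ∈ s, f i) = ∑ i ∈ s, iddbar I (f i) := by
  classical
  induction s using Finset.induction_on with
  | empty =>
    funext x
    exact iddbar_eq_zero I hJ contMDiff_const (Eventually.of_forall fun _ => rfl)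
  | insert i s hi ih =>
    rw [Finset.sum_insert hi, Finset.sum_insert hi, ← ih, iddbar_add I hJ (hf i)]
    convert ContMDiff.sum (t := s) fun i _ => hf i using 1
    funext x
    simp

end Iddbar

/-! ### Complex manifolds as real manifolds with holomorphic charts -/

section Holomorphic

variable {E : Type*} [NormedAddCommGroup E] [NormedSpace ℂ E] [NormedSpace ℝ E]
  [IsScalarTower ℝ ℂ E]
  {M : Type*} [TopologicalSpace M] [ChartedSpace E M] [IsManifold 𝓘(ℂ, E) ∞ M]

variable (E M) in
theorem isManifold_real : IsManifold 𝓘(ℝ, E) ∞ M := by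
  refine isManifold_of_contDiffOn _ _ _ fun e e' he he' => ?_
  have h := (HasGroupoid.compatible (G := contDiffGroupoid ∞ 𝓘(ℂ, E)) he he')
  rw [contDiffGroupoid, mem_groupoid_of_pregroupoid] at h
  exact ContDiffOn.restrict_scalars ℝ h.1

theorem differentiableAt_complex_transition {a b : M} {z : E}
    (hz : z ∈ (extChartAt 𝓘(ℝ, E) a).target)
    (hb : (extChartAt 𝓘(ℝ, E) a).symm z ∈ (extChartAt 𝓘(ℝ, E) b).source) :
    DifferentiableAt ℂ (transition 𝓘(ℝ, E) a b) z := by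
  have h := contDiffWithinAt_ext_coord_change (I := 𝓘(ℂ, E)) (n := ∞) (x := b) (x' := a) (y := z)
    (by rw [PartialEquiv.trans_source]; exact ⟨hz, hb⟩)
  rw [ModelWithCorners.range_eq_univ, contDiffWithinAt_univ] at h
  exact h.differentiableAt (by simp)

variable (E M) in
-- The derivative of an inverse chart is the real derivative of a complex differentiable transition
-- map, hence complex linear.
theorem isHolomorphicAtlas : IsHolomorphicAtlas 𝓘(ℝ, E) M := by
  have : IsManifold 𝓘(ℝ, E) ∞ M := isManifold_real E M
  intro a z hz v
  rw [symD_eq _ hz]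
  have hd := differentiableAt_complex_transition hz
    (mem_extChartAt_source (I := 𝓘(ℝ, E)) ((extChartAt 𝓘(ℝ, E) a).symm z))
  rw [hd.fderiv_restrictScalars ℝ]
  exact map_smul (fderiv ℂ (transition 𝓘(ℝ, E) a ((extChartAt 𝓘(ℝ, E) a).symm z)) z) Complex.I v

end Holomorphic

/-! ### Charts of the product and restriction to a fibre -/

section Product

open Set Filter Topology

variable {E : Type*} [NormedAddCommGroup E] [NormedSpace ℝ E] [NormedSpace ℂ E]
  [IsScalarTower ℝ ℂ E]
  {M : Type*} [TopologicalSpace M] [ChartedSpace E M] [IsManifold 𝓘(ℝ, E) ∞ M]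

theorem symD_prod {a b : M} {z w : E} (hz : z ∈ (extChartAt 𝓘(ℝ, E) a).target)
    (hw : w ∈ (extChartAt 𝓘(ℝ, E) b).target) :
    symD (𝓘(ℝ, E).prod 𝓘(ℝ, E)) (a, b) (z, w) =
      (symD 𝓘(ℝ, E) a z).prodMap (symD 𝓘(ℝ, E) b w) := by
  have hzw : (z, w) ∈ (extChartAt (𝓘(ℝ, E).prod 𝓘(ℝ, E)) (a, b)).target := by
    rw [extChartAt_prod]
    exact ⟨hz, hw⟩
  rw [symD_eq _ hzw, symD_eq _ hz, symD_eq _ hw]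
  have h1 := ((contDiffAt_transition 𝓘(ℝ, E) hz
    (mem_extChartAt_source _)).differentiableAt (by simp)).hasFDerivAt
  have h2 := ((contDiffAt_transition 𝓘(ℝ, E) hw
    (mem_extChartAt_source _)).differentiableAt (by simp)).hasFDerivAt
  rw [← (h1.prodMap (z, w) h2).fderiv]
  congr 1

theorem isHolomorphicAtlas_prod (hJ : IsHolomorphicAtlas 𝓘(ℝ, E) M) :
    IsHolomorphicAtlas (𝓘(ℝ, E).prod 𝓘(ℝ, E)) (M × M) := by
  rintro ⟨a, b⟩ ⟨z, w⟩ hzw ⟨u, v⟩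
  have h : z ∈ (extChartAt 𝓘(ℝ, E) a).target ∧ w ∈ (extChartAt 𝓘(ℝ, E) b).target := by
    rw [extChartAt_prod] at hzw
    exact hzw
  rw [symD_prod h.1 h.2]
  exact Prod.ext (hJ a z h.1 u) (hJ b w h.2 v)

theorem fderiv_prod_right {G : E × E → ℝ} {z w : E} (hG : DifferentiableAt ℝ G (z, w)) (v : E) :
    fderiv ℝ G (z, w) (0, v) = fderiv ℝ (fun w => G (z, w)) w v := by
  have h : HasFDerivAt (fun w => G (z, w)) _ w :=
    HasFDerivAt.comp w hG.hasFDerivAt (hasFDerivAt_prodMk_right z w)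
  rw [h.fderiv]
  rfl

/-- The restriction of `√-1 ∂∂̄ φ` to a fibre of the first projection. -/
theorem iddbar_prod_right (hJ : IsHolomorphicAtlas 𝓘(ℝ, E) M) {φ : M × M → ℝ}
    (hφ : ContMDiff (𝓘(ℝ, E).prod 𝓘(ℝ, E)) 𝓘(ℝ, ℝ) ∞ φ) (p y : M) (u v : E) :
    iddbar (𝓘(ℝ, E).prod 𝓘(ℝ, E)) φ (p, y) ![((0 : E), u), ((0 : E), v)] =
      iddbar 𝓘(ℝ, E) (fun y => φ (p, y)) y ![u, v] := by
  have hφp : ContMDiff 𝓘(ℝ, E) 𝓘(ℝ, ℝ) ∞ fun y => φ (p, y) :=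
    hφ.comp (contMDiff_const.prodMk contMDiff_id)
  rw [iddbar_apply _ hJ hφp, iddbar_apply _ (isHolomorphicAtlas_prod hJ) hφ]
  have key : ∀ u v : E, fderiv ℝ (fun z => fderiv ℝ
      (φ ∘ (extChartAt (𝓘(ℝ, E).prod 𝓘(ℝ, E)) (p, y)).symm) z (J ((0 : E), v)))
      (extChartAt (𝓘(ℝ, E).prod 𝓘(ℝ, E)) (p, y) (p, y)) (0, u) =
      fderiv ℝ (fun z => fderiv ℝ ((fun y => φ (p, y)) ∘ (extChartAt 𝓘(ℝ, E) y).symm) z (J v))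
        (extChartAt 𝓘(ℝ, E) y y) u := by
    intro u v
    have hJv : J ((0 : E), v) = ((0 : E), J v) := by
      change Complex.I • ((0 : E), v) = (0, Complex.I • v)
      simp
    have hpt : extChartAt (𝓘(ℝ, E).prod 𝓘(ℝ, E)) (p, y) (p, y) =
      (extChartAt 𝓘(ℝ, E) p p, extChartAt 𝓘(ℝ, E) y y) := by rw [extChartAt_prod]; rfl
    have hmem := mem_extChartAt_target (I := 𝓘(ℝ, E).prod 𝓘(ℝ, E)) (p, y)
    rw [hJv]
    rw [hpt] at hmem ⊢
    rw [fderiv_prod_right (((contDiffAt_comp_symm _ hφ hmem).fderiv_apply_const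
      (0, J v)).differentiableAt (by simp))]
    congr 1
    refine Filter.EventuallyEq.fderiv_eq ?_
    filter_upwards [(isOpen_extChartAt_target y).mem_nhds (mem_extChartAt_target y)] with w hw
    have hw' : (extChartAt 𝓘(ℝ, E) p p, w) ∈
        (extChartAt (𝓘(ℝ, E).prod 𝓘(ℝ, E)) (p, y)).target := by
      rw [extChartAt_prod]
      exact ⟨mem_extChartAt_target p, hw⟩
    rw [fderiv_prod_right ((contDiffAt_comp_symm _ hφ hw').differentiableAt (by simp))]
    congr 2
    funext q
    change φ ((extChartAt 𝓘(ℝ, E) p).symm (extChartAt 𝓘(ℝ, E) p p), _) = _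
    rw [extChartAt_to_inv]
    rfl
  rw [key, key]

end Product

/-! ### Integration of forms of top degree -/

section TopIntegral

open Set Filter Topology

theorem frame_pairEquiv {n : ℕ} (x : Fin n × Fin 2) :
    frame n (pairEquiv rfl x) = Pi.single x.1 (if x.2 = 0 then 1 else Complex.I) := by
  obtain ⟨i, a⟩ := x
  have h := pairEquiv_val (rfl : 2 * n = 2 * n) (i, a)
  have h1 : (⟨(pairEquiv (rfl : 2 * n = 2 * n) (i, a) : ℕ) / 2, by omega⟩ : Fin n) = i := by
    ext
    simp only [h]
    omega
  have h2 : ((pairEquiv (rfl : 2 * n = 2 * n) (i, a) : ℕ) % 2 = 0) ↔ a = 0 := by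
    rw [h]
    simp only
    omega
  simp only [frame, h1, h2]

/-- The real basis `e_1, √-1 e_1, …, e_n, √-1 e_n` of `ℂⁿ`. -/
def frameBasis (n : ℕ) : Module.Basis (Fin (2 * n)) ℝ (Fin n → ℂ) :=
  (Complex.basisOneI.smulTower' (Pi.basisFun ℂ (Fin n))).reindex (pairEquiv rfl)

theorem coe_frameBasis (n : ℕ) : ⇑(frameBasis n) = frame n := by
  funext j
  obtain ⟨x, rfl⟩ := (pairEquiv (rfl : 2 * n = 2 * n)).surjective j
  obtain ⟨i, a⟩ := x
  rw [frame_pairEquiv, frameBasis, Module.Basis.reindex_apply, Equiv.symm_apply_apply,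
    Module.Basis.smulTower'_apply]
  fin_cases a <;> simp [← Pi.single_smul]

theorem alternating_eq_det_smul {ι V F : Type*} [Fintype ι] [DecidableEq ι] [AddCommGroup V]
    [Module ℝ V] [AddCommGroup F] [Module ℝ F] (e : Module.Basis ι ℝ V) (f : V [⋀^ι]→ₗ[ℝ] F)
    (v : ι → V) : f v = e.det v • f e := by
  have h : f = (LinearMap.toSpanSingleton ℝ F (f e)).compAlternatingMap e.det := by
    refine Module.Basis.ext_alternating e fun i hi => ?_
    let σ : Equiv.Perm ι := Equiv.ofBijective i (Finite.injective_iff_bijective.1 hi)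
    change f (e ∘ σ) = ((LinearMap.toSpanSingleton ℝ F (f e)).compAlternatingMap e.det) (e ∘ σ)
    rw [AlternatingMap.map_perm, AlternatingMap.map_perm]
    simp [Module.Basis.det_self]
  conv_lhs => rw [h]
  rfl

/-- Source of the Jacobian in the change of variables; `L` accommodates the derivative of the second
inverse chart. -/
theorem alternating_comp_frame {n : ℕ} {F : Type*} [NormedAddCommGroup F] [NormedSpace ℝ F]
    (η : (Fin n → ℂ) [⋀^Fin (2 * n)]→L[ℝ] F) (L D : (Fin n → ℂ) →L[ℝ] (Fin n → ℂ)) :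
    η (fun j => L (D (frame n j))) = D.det • η fun j => L (frame n j) := by
  have h := alternating_eq_det_smul (frameBasis n)
    (η.compContinuousLinearMap L).toAlternatingMap (D ∘ frameBasis n)
  have h2 := (frameBasis n).det_comp (D : (Fin n → ℂ) →ₗ[ℝ] (Fin n → ℂ)) (frameBasis n)
  rw [Module.Basis.det_self, mul_one] at h2
  have h3 : (frameBasis n).det (D ∘ frameBasis n) = D.det := h2
  rw [h3, coe_frameBasis] at h
  exact h

variable {n : ℕ} {M : Type*} [TopologicalSpace M] [ChartedSpace (Fin n → ℂ) M]
  {F : Type*} [NormedAddCommGroup F] [NormedSpace ℝ F]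

/-- The coefficient of a form of top degree in the chart at `a`. -/
def density (g : M → (Fin (2 * n) → (Fin n → ℂ)) → F) (a : M) (z : Fin n → ℂ) : F :=
  g ((extChartAt 𝓘(ℝ, Fin n → ℂ) a).symm z) fun j => symD 𝓘(ℝ, Fin n → ℂ) a z (frame n j)

/-- The coefficients of a form of top degree are continuous. -/
def HasContinuousDensity (g : M → (Fin (2 * n) → (Fin n → ℂ)) → F) : Prop :=
  ∀ a, ContinuousOn (density g a) (extChartAt 𝓘(ℝ, Fin n → ℂ) a).target

theorem HasContinuousDensity.add {g h : M → (Fin (2 * n) → (Fin n → ℂ)) → F}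
    (hg : HasContinuousDensity g) (hh : HasContinuousDensity h) :
    HasContinuousDensity fun y w => g y w + h y w := fun a => (hg a).add (hh a)

theorem HasContinuousDensity.smul {g : M → (Fin (2 * n) → (Fin n → ℂ)) → F}
    (hg : HasContinuousDensity g) (c : ℝ) :
    HasContinuousDensity fun y w => c • g y w := fun a => (hg a).const_smul c

theorem HasContinuousDensity.sum {ι : Type*} (s : Finset ι)
    {g : ι → M → (Fin (2 * n) → (Fin n → ℂ)) → F} (hg : ∀ i ∈ s, HasContinuousDensity (g i)) :
    HasContinuousDensity fun y w => ∑ i ∈ s, g i y w := fun a =>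
  continuousOn_finsetSum s fun i hi => hg i hi a

variable [CompactSpace M] [T2Space M]

theorem topIntegral_eq (g : M → (Fin (2 * n) → (Fin n → ℂ)) → F) :
    topIntegral g = ∑ᶠ a : M, ∫ z in (extChartAt 𝓘(ℝ, Fin n → ℂ) a).target,
      partition n M a ((extChartAt 𝓘(ℝ, Fin n → ℂ) a).symm z) • density g a z := rfl

variable (n M) in
theorem tsupport_partition_subset (a : M) :
    tsupport (partition n M a) ⊆ (extChartAt 𝓘(ℝ, Fin n → ℂ) a).source := by
  rw [extChartAt_source]
  exact (exists_partition (n := n) M).choose_spec a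

variable (n M) in
/-- The members of the partition of unity which do not vanish. -/
theorem exists_finset_partition :
    ∃ S : Finset M, (∀ a, a ∉ S → ∀ x, partition n M a x = 0) ∧
      ∀ x, ∑ a ∈ S, partition n M a x = 1 := by
  have hfin := (partition n M).locallyFinite.finite_nonempty_of_compact
  refine ⟨hfin.toFinset, fun a ha x => ?_, fun x => ?_⟩
  · by_contra hne
    exact ha ((hfin.mem_toFinset).2 ⟨x, hne⟩)
  · rw [← (partition n M).sum_eq_one (mem_univ x)]
    refine (finsum_eq_sum_of_support_subset _ fun a ha => ?_).symm
    exact hfin.mem_toFinset.2 ⟨x, ha⟩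

theorem topIntegral_eq_sum {S : Finset M} (hS : ∀ a, a ∉ S → ∀ x, partition n M a x = 0)
    (g : M → (Fin (2 * n) → (Fin n → ℂ)) → F) :
    topIntegral g = ∑ a ∈ S, ∫ z in (extChartAt 𝓘(ℝ, Fin n → ℂ) a).target,
      partition n M a ((extChartAt 𝓘(ℝ, Fin n → ℂ) a).symm z) • density g a z := by
  rw [topIntegral_eq]
  refine finsum_eq_sum_of_support_subset _ fun a ha => ?_
  by_contra hne
  refine ha ?_
  simp [hS a hne]

theorem integrableOn_of_zero_off_compact {V : Type*} [NormedAddCommGroup V] [NormedSpace ℝ V]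
    [FiniteDimensional ℝ V] [MeasurableSpace V] [BorelSpace V] (μ : Measure V)
    [IsLocallyFiniteMeasure μ] {T K : Set V} (hT : IsOpen T)
    (hK : IsCompact K) (hKT : K ⊆ T) {f : V → F} (hf : ContinuousOn f T)
    (h0 : ∀ z ∈ T, z ∉ K → f z = 0) : IntegrableOn f T μ :=
  ((hf.mono hKT).integrableOn_compact hK).of_forall_sdiff_eq_zero hT.measurableSet
    fun z hz => h0 z hz.1 hz.2

variable (n) in
theorem isCompact_image_chart {K : Set M} (hK : IsClosed K) {a : M}
    (hKa : K ⊆ (extChartAt 𝓘(ℝ, Fin n → ℂ) a).source) :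
    IsCompact (extChartAt 𝓘(ℝ, Fin n → ℂ) a '' K) ∧
      extChartAt 𝓘(ℝ, Fin n → ℂ) a '' K ⊆ (extChartAt 𝓘(ℝ, Fin n → ℂ) a).target :=
  ⟨hK.isCompact.image_of_continuousOn ((continuousOn_extChartAt a).mono hKa),
    image_subset_iff.2 fun _ hx => (extChartAt 𝓘(ℝ, Fin n → ℂ) a).map_source (hKa hx)⟩

variable (n) in
theorem continuousOn_partition_symm (a b : M) :
    ContinuousOn (fun z => partition n M a ((extChartAt 𝓘(ℝ, Fin n → ℂ) b).symm z))
      (extChartAt 𝓘(ℝ, Fin n → ℂ) b).target :=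
  (partition n M a).continuous.comp_continuousOn (continuousOn_extChartAt_symm b)

theorem HasContinuousDensity.integrableOn {g : M → (Fin (2 * n) → (Fin n → ℂ)) → F}
    (hg : HasContinuousDensity g) (a : M) :
    IntegrableOn (fun z => partition n M a ((extChartAt 𝓘(ℝ, Fin n → ℂ) a).symm z) •
      density g a z) (extChartAt 𝓘(ℝ, Fin n → ℂ) a).target := by
  obtain ⟨h1, h2⟩ := isCompact_image_chart n (isClosed_tsupport _)
    (tsupport_partition_subset n M a)
  refine integrableOn_of_zero_off_compact volume (isOpen_extChartAt_target a) h1 h2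
    ((continuousOn_partition_symm n a a).smul (hg a)) fun z hz hzK => ?_
  rw [image_eq_zero_of_notMem_tsupport (f := partition n M a), zero_smul]
  exact fun h => hzK ⟨_, h, (extChartAt 𝓘(ℝ, Fin n → ℂ) a).right_inv hz⟩

/-- Used to take real and imaginary parts of integrals and to evaluate form-valued integrals on
vectors. -/
theorem topIntegral_clm {G : Type*} [NormedAddCommGroup G] [NormedSpace ℝ G] [CompleteSpace F]
    [CompleteSpace G] (L : F →L[ℝ] G)
    {g : M → (Fin (2 * n) → (Fin n → ℂ)) → F} (hg : HasContinuousDensity g) :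
    topIntegral (fun y w => L (g y w)) = L (topIntegral g) := by
  obtain ⟨S, hS, -⟩ := exists_finset_partition n M
  rw [topIntegral_eq_sum hS, topIntegral_eq_sum hS, map_sum]
  refine Finset.sum_congr rfl fun a _ => ?_
  rw [← L.integral_comp_comm (hg.integrableOn a)]
  simp only [map_smul]
  rfl

theorem topIntegral_add {g h : M → (Fin (2 * n) → (Fin n → ℂ)) → F}
    (hg : HasContinuousDensity g) (hh : HasContinuousDensity h) :
    topIntegral (fun y w => g y w + h y w) = topIntegral g + topIntegral h := by
  obtain ⟨S, hS, -⟩ := exists_finset_partition n M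
  rw [topIntegral_eq_sum hS, topIntegral_eq_sum hS, topIntegral_eq_sum hS,
    ← Finset.sum_add_distrib]
  refine Finset.sum_congr rfl fun a _ => ?_
  rw [← integral_add (hg.integrableOn a) (hh.integrableOn a)]
  simp only [← smul_add]
  rfl

theorem topIntegral_smul (c : ℝ) (g : M → (Fin (2 * n) → (Fin n → ℂ)) → F) :
    topIntegral (fun y w => c • g y w) = c • topIntegral g := by
  obtain ⟨S, hS, -⟩ := exists_finset_partition n M
  rw [topIntegral_eq_sum hS, topIntegral_eq_sum hS, Finset.smul_sum]
  refine Finset.sum_congr rfl fun a _ => ?_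
  rw [← integral_smul]
  refine integral_congr_ae (Eventually.of_forall fun z => ?_)
  exact smul_comm _ _ _

theorem topIntegral_sum {ι : Type*} (s : Finset ι)
    {g : ι → M → (Fin (2 * n) → (Fin n → ℂ)) → F} (hg : ∀ i ∈ s, HasContinuousDensity (g i)) :
    topIntegral (fun y w => ∑ i ∈ s, g i y w) = ∑ i ∈ s, topIntegral (g i) := by
  classical
  induction s using Finset.induction_on with
  | empty =>
    simp only [Finset.sum_empty]
    simp [topIntegral]
  | insert i s hi ih =>
    simp only [Finset.sum_insert hi]
    rw [topIntegral_add (hg i (Finset.mem_insert_self i s))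
      (HasContinuousDensity.sum s fun j hj => hg j (Finset.mem_insert_of_mem hj)),
      ih fun j hj => hg j (Finset.mem_insert_of_mem hj)]

theorem topIntegral_congr {g h : M → (Fin (2 * n) → (Fin n → ℂ)) → F}
    (H : ∀ a, ∀ z ∈ (extChartAt 𝓘(ℝ, Fin n → ℂ) a).target, density g a z = density h a z) :
    topIntegral g = topIntegral h := by
  rw [topIntegral_eq, topIntegral_eq]
  refine finsum_congr fun a => setIntegral_congr_fun (isOpen_extChartAt_target a).measurableSet
    fun z hz => ?_
  simp only [H a z hz]

/-- All terms are nonnegative, and a member of the partition positive at some point gives an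
integrand nonzero on a nonempty open set. -/
theorem topIntegral_pos [Nonempty M] {g : M → (Fin (2 * n) → (Fin n → ℂ)) → ℝ}
    (hg : HasContinuousDensity g)
    (hpos : ∀ a, ∀ z ∈ (extChartAt 𝓘(ℝ, Fin n → ℂ) a).target, 0 < density g a z) :
    0 < topIntegral g := by
  obtain ⟨S, hS, -⟩ := exists_finset_partition n M
  rw [topIntegral_eq_sum hS]
  obtain ⟨x⟩ := ‹Nonempty M›
  obtain ⟨a, ha⟩ := (partition n M).exists_pos (mem_univ x)
  have hnn : ∀ a, ∀ z ∈ (extChartAt 𝓘(ℝ, Fin n → ℂ) a).target,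
      0 ≤ partition n M a ((extChartAt 𝓘(ℝ, Fin n → ℂ) a).symm z) • density g a z :=
    fun a z hz => smul_nonneg ((partition n M).nonneg _ _) (hpos a z hz).le
  refine Finset.sum_pos' (fun a _ => setIntegral_nonneg
    (isOpen_extChartAt_target a).measurableSet (hnn a)) ⟨a, ?_, ?_⟩
  · by_contra h
    exact ha.ne' (hS a h x)
  have hT : IsOpen (extChartAt 𝓘(ℝ, Fin n → ℂ) a).target := isOpen_extChartAt_target a
  rw [setIntegral_pos_iff_support_of_nonneg_ae
    ((ae_restrict_iff' hT.measurableSet).2 (Eventually.of_forall (hnn a))) (hg.integrableOn a)]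
  have hx : x ∈ (extChartAt 𝓘(ℝ, Fin n → ℂ) a).source :=
    tsupport_partition_subset n M a (subset_tsupport _ ha.ne')
  rw [inter_comm]
  refine IsOpen.measure_pos volume (((continuousOn_partition_symm n a a).smul
    (hg a)).isOpen_inter_preimage hT isOpen_ne) ⟨extChartAt 𝓘(ℝ, Fin n → ℂ) a x, ?_, ?_⟩
  · exact (extChartAt 𝓘(ℝ, Fin n → ℂ) a).map_source hx
  · have h1 := hpos a _ ((extChartAt 𝓘(ℝ, Fin n → ℂ) a).map_source hx)
    have h2 : 0 < partition n M a ((extChartAt 𝓘(ℝ, Fin n → ℂ) a).symm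
        (extChartAt 𝓘(ℝ, Fin n → ℂ) a x)) := by
      rw [(extChartAt 𝓘(ℝ, Fin n → ℂ) a).left_inv hx]
      exact ha
    exact (smul_pos h2 h1).ne'

variable [IsManifold 𝓘(ℂ, Fin n → ℂ) ∞ M]

/-- The real determinant of a complex linear map is the squared modulus of its complex determinant,
so the absolute value in the change of variables disappears. -/
theorem det_fderiv_transition_nonneg {a b : M} {z : Fin n → ℂ}
    (hz : z ∈ (extChartAt 𝓘(ℝ, Fin n → ℂ) a).target)
    (hb : (extChartAt 𝓘(ℝ, Fin n → ℂ) a).symm z ∈ (extChartAt 𝓘(ℝ, Fin n → ℂ) b).source) :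
    0 ≤ (fderiv ℝ (transition 𝓘(ℝ, Fin n → ℂ) a b) z).det := by
  have hd := differentiableAt_complex_transition hz hb
  rw [hd.fderiv_restrictScalars ℝ]
  have h := LinearMap.det_restrictScalars (R := ℝ) (S := ℂ)
    (f := (fderiv ℂ (transition 𝓘(ℝ, Fin n → ℂ) a b) z : (Fin n → ℂ) →ₗ[ℂ] (Fin n → ℂ)))
  rw [Algebra.norm_complex_apply] at h
  exact (Complex.normSq_nonneg _).trans_eq h.symm

attribute [local instance] isManifold_real

/-- Change of variables for forms supported in the domain of two charts. -/
theorem setIntegral_density_transition [CompleteSpace F]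
    (η : M → (Fin n → ℂ) [⋀^Fin (2 * n)]→L[ℝ] F) (a b : M)
    {ρ : M → ℝ} (ha : ∀ x, x ∉ (extChartAt 𝓘(ℝ, Fin n → ℂ) a).source → ρ x = 0)
    (hb : ∀ x, x ∉ (extChartAt 𝓘(ℝ, Fin n → ℂ) b).source → η x = 0) :
    ∫ z in (extChartAt 𝓘(ℝ, Fin n → ℂ) a).target,
      ρ ((extChartAt 𝓘(ℝ, Fin n → ℂ) a).symm z) • density (fun y w => η y w) a z =
    ∫ z in (extChartAt 𝓘(ℝ, Fin n → ℂ) b).target,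
      ρ ((extChartAt 𝓘(ℝ, Fin n → ℂ) b).symm z) • density (fun y w => η y w) b z := by
  set I := 𝓘(ℝ, Fin n → ℂ) with hI
  set U : Set (Fin n → ℂ) := (extChartAt I a).target ∩
    (extChartAt I a).symm ⁻¹' (extChartAt I b).source with hU
  set V : Set (Fin n → ℂ) := (extChartAt I b).target ∩
    (extChartAt I b).symm ⁻¹' (extChartAt I a).source with hV
  have hUo : IsOpen U := (continuousOn_extChartAt_symm a).isOpen_inter_preimage
    (isOpen_extChartAt_target a) (isOpen_extChartAt_source b)
  have himg : transition I a b '' U = V := by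
    ext w
    constructor
    · rintro ⟨z, ⟨hz1, hz2⟩, rfl⟩
      refine ⟨transition_mem I hz2, ?_⟩
      rw [mem_preimage, symm_transition I hz2]
      exact (extChartAt I a).map_target hz1
    · rintro ⟨hw1, hw2⟩
      refine ⟨transition I b a w, ⟨transition_mem I hw2, ?_⟩, ?_⟩
      · rw [mem_preimage, symm_transition I hw2]
        exact (extChartAt I b).map_target hw1
      · rw [transition, Function.comp_apply, symm_transition I hw2]
        exact (extChartAt I b).right_inv hw1
  have hinj : InjOn (transition I a b) U := by
    intro z hz w hw h
    have h2 := congrArg (extChartAt I b).symm h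
    rw [symm_transition I hz.2, symm_transition I hw.2] at h2
    exact (extChartAt I a).symm.injOn hz.1 hw.1 h2
  rw [setIntegral_eq_of_subset_of_forall_sdiff_eq_zero (isOpen_extChartAt_target a).measurableSet
    (inter_subset_left : U ⊆ _), setIntegral_eq_of_subset_of_forall_sdiff_eq_zero
    (isOpen_extChartAt_target b).measurableSet (inter_subset_left : V ⊆ _), ← hU, ← hV, ← himg,
    integral_image_eq_integral_abs_det_fderiv_smul volume hUo.measurableSet
      (f' := fun z => fderiv ℝ (transition I a b) z) (fun z hz =>
      ((contDiffAt_transition I hz.1 hz.2).differentiableAt (by simp)).hasFDerivAt.hasFDerivWithinAt)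
      hinj]
  · refine setIntegral_congr_fun hUo.measurableSet fun z hz => ?_
    rw [symm_transition I hz.2, abs_of_nonneg (det_fderiv_transition_nonneg hz.1 hz.2),
      smul_comm]
    congr 1
    rw [density, density, symm_transition I hz.2, symD_transition I hz.1 hz.2]
    exact alternating_comp_frame _ _ _
  · intro z hz
    rw [ha _ fun h => hz.2 ⟨hz.1, h⟩, zero_smul]
  · intro z hz
    rw [density, hb _ fun h => hz.2 ⟨hz.1, h⟩]
    simp

/-- The integral of a form supported in the domain of a chart. -/
theorem topIntegral_eq_of_support [CompleteSpace F]
    (η : M → (Fin n → ℂ) [⋀^Fin (2 * n)]→L[ℝ] F) (b : M)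
    (hη : HasContinuousDensity fun y w => η y w) {K : Set M} (hK : IsClosed K)
    (hKb : K ⊆ (extChartAt 𝓘(ℝ, Fin n → ℂ) b).source) (h0 : ∀ x, x ∉ K → η x = 0) :
    topIntegral (fun y w => η y w) =
      ∫ z in (extChartAt 𝓘(ℝ, Fin n → ℂ) b).target, density (fun y w => η y w) b z := by
  obtain ⟨S, hS, hS1⟩ := exists_finset_partition n M
  rw [topIntegral_eq_sum hS]
  -- Every term is moved to the single chart at `b`, where the partition functions add up to `1`.
  have h1 : ∀ a ∈ S, ∫ z in (extChartAt 𝓘(ℝ, Fin n → ℂ) a).target,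
      partition n M a ((extChartAt 𝓘(ℝ, Fin n → ℂ) a).symm z) • density (fun y w => η y w) a z =
      ∫ z in (extChartAt 𝓘(ℝ, Fin n → ℂ) b).target,
      partition n M a ((extChartAt 𝓘(ℝ, Fin n → ℂ) b).symm z) •
        density (fun y w => η y w) b z := fun a _ =>
    setIntegral_density_transition η a b
      (fun x hx => image_eq_zero_of_notMem_tsupport fun h => hx (tsupport_partition_subset n M a h))
      fun x hx => h0 x fun h => hx (hKb h)
  obtain ⟨c1, c2⟩ := isCompact_image_chart n hK hKb
  rw [Finset.sum_congr rfl h1, ← integral_finsetSum]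
  · refine setIntegral_congr_fun (isOpen_extChartAt_target b).measurableSet fun z _ => ?_
    rw [← Finset.sum_smul, hS1, one_smul]
  · intro a _
    refine integrableOn_of_zero_off_compact volume (isOpen_extChartAt_target b) c1 c2
      ((continuousOn_partition_symm n a b).smul (hη b)) fun z hz hzK => ?_
    rw [density, h0]
    · simp
    · exact fun h => hzK ⟨_, h, (extChartAt 𝓘(ℝ, Fin n → ℂ) b).right_inv hz⟩

end TopIntegral

/-! ### Invariance of the top integral under adding `√-1 ∂∂̄ φ` -/

section StokesManifold

open Set Filter Topology

theorem continuousOn_psi {V : Type*} [TopologicalSpace V] {m : ℕ}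
    {G : Fin m → Fin m × Fin 2 → Fin m × Fin 2 → V → ℂ} {T : Set V}
    (hG : ∀ i x y, ContinuousOn (G i x y) T) :
    ContinuousOn (fun z => psi fun i x y => G i x y z) T := by
  unfold psi
  exact continuousOn_finsetSum _ fun σ _ => continuousOn_const.mul
    (continuousOn_finsetProd _ fun i _ => hG _ _ _)

section Pair

variable {E H : Type*} [NormedAddCommGroup E] [NormedSpace ℝ E] [TopologicalSpace H]
  (I : ModelWithCorners ℝ E H) {X : Type*} [TopologicalSpace X] [ChartedSpace H X]

theorem inChart_pair (β : X → E [⋀^Fin 2]→L[ℝ] ℝ) (a : X) (z u v : E) :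
    inChart I β a z ![u, v] =
      β ((extChartAt I a).symm z) ![symD I a z u, symD I a z v] := by
  rw [inChart_apply]
  congr 1
  funext i
  fin_cases i <;> rfl

theorem fderiv_ofReal_add_I_mul {g k : E → ℝ} {z : E} (hg : DifferentiableAt ℝ g z)
    (hk : DifferentiableAt ℝ k z) (v : E) :
    fderiv ℝ (fun z => (g z : ℂ) + Complex.I * (k z : ℂ)) z v =
      (fderiv ℝ g z v : ℂ) + Complex.I * (fderiv ℝ k z v : ℂ) := by
  have h1 := Complex.ofRealCLM.hasFDerivAt.comp z hg.hasFDerivAt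
  have h2 := Complex.ofRealCLM.hasFDerivAt.comp z hk.hasFDerivAt
  have h3 : HasFDerivAt (fun z => (g z : ℂ) + Complex.I * (k z : ℂ)) _ z :=
    h1.add (h2.const_mul Complex.I)
  rw [h3.fderiv]
  rfl

end Pair

variable {n : ℕ} {M : Type*} [TopologicalSpace M] [ChartedSpace (Fin n → ℂ) M]

theorem density_wedgePow (β χ : M → (Fin n → ℂ) [⋀^Fin 2]→L[ℝ] ℝ) (a : M) (z : Fin n → ℂ) :
    density (fun y w => wedgePow (complexForm (β y) (χ y)) n w) a z =
      algebraMap ℝ ℂ ((1 / 2) ^ n) * psi (fun (_ : Fin n) x y =>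
        (inChart 𝓘(ℝ, Fin n → ℂ) β a z
          ![frame n (pairEquiv rfl x), frame n (pairEquiv rfl y)] : ℂ) +
        Complex.I * (inChart 𝓘(ℝ, Fin n → ℂ) χ a z
          ![frame n (pairEquiv rfl x), frame n (pairEquiv rfl y)] : ℂ)) := by
  simp only [density, wedgePow_apply, complexForm_apply, inChart_pair]

theorem IsCyclicClosed.continuousOn {β : M → (Fin n → ℂ) [⋀^Fin 2]→L[ℝ] ℝ}
    (hβ : IsCyclicClosed 𝓘(ℝ, Fin n → ℂ) β) (a : M) (u v : Fin n → ℂ) :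
    ContinuousOn (fun z => inChart 𝓘(ℝ, Fin n → ℂ) β a z ![u, v])
      (extChartAt 𝓘(ℝ, Fin n → ℂ) a).target := ((hβ a).1 u v).continuousOn

theorem hasContinuousDensity_wedgePow {β χ : M → (Fin n → ℂ) [⋀^Fin 2]→L[ℝ] ℝ}
    (hβ : IsCyclicClosed 𝓘(ℝ, Fin n → ℂ) β) (hχ : IsCyclicClosed 𝓘(ℝ, Fin n → ℂ) χ) :
    HasContinuousDensity fun y w => wedgePow (complexForm (β y) (χ y)) n w := by
  intro a
  simp only [funext (density_wedgePow β χ a)]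
  exact continuousOn_const.mul (continuousOn_psi fun i x y =>
    (Complex.continuous_ofReal.comp_continuousOn (hβ.continuousOn a _ _)).add
      (continuousOn_const.mul (Complex.continuous_ofReal.comp_continuousOn
        (hχ.continuousOn a _ _))))

variable [CompactSpace M] [T2Space M] [IsManifold 𝓘(ℂ, Fin n → ℂ) ∞ M]

attribute [local instance] isManifold_real

/-- Adding `√-1 ∂∂̄ f` does not change the integral of the top power, when the support of `f` is
contained in the domain of a chart. -/
theorem topIntegral_add_iddbar_of_tsupport {β χ : M → (Fin n → ℂ) [⋀^Fin 2]→L[ℝ] ℝ}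
    (hβ : IsCyclicClosed 𝓘(ℝ, Fin n → ℂ) β) (hχ : IsCyclicClosed 𝓘(ℝ, Fin n → ℂ) χ)
    {f : M → ℝ} (hf : ContMDiff 𝓘(ℝ, Fin n → ℂ) 𝓘(ℝ, ℝ) ∞ f) (b : M)
    (hfb : tsupport f ⊆ (extChartAt 𝓘(ℝ, Fin n → ℂ) b).source) :
    topIntegral (fun y w => wedgePow
      (complexForm ((β + iddbar 𝓘(ℝ, Fin n → ℂ) f) y) (χ y)) n w) =
    topIntegral (fun y w => wedgePow (complexForm (β y) (χ y)) n w) := by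
  have hJ := isHolomorphicAtlas (Fin n → ℂ) M
  set I := 𝓘(ℝ, Fin n → ℂ) with hI
  set β' := β + iddbar I f with hβ'
  have hβ'c : IsCyclicClosed I β' := hβ.add _ (isCyclicClosed_iddbar I hJ hf)
  have hc := hasContinuousDensity_wedgePow hβ hχ
  have hc' := hasContinuousDensity_wedgePow hβ'c hχ
  have hT : IsOpen (extChartAt I b).target := isOpen_extChartAt_target b
  rw [← sub_eq_zero, sub_eq_add_neg, ← neg_one_smul ℝ (topIntegral _), ← topIntegral_smul,
    ← topIntegral_add hc' (hc.smul (-1))]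
  -- The difference of the two top powers, a form vanishing off the support of `f`, so that its
  -- integral is computed in the one chart at `b`.
  set η : M → (Fin n → ℂ) [⋀^Fin (2 * n)]→L[ℝ] ℂ := fun y =>
    wedgePow (complexForm (β' y) (χ y)) n + (-1 : ℝ) • wedgePow (complexForm (β y) (χ y)) n with hη
  have hηc : HasContinuousDensity fun y w => η y w := hc'.add (hc.smul (-1))
  have h0 : ∀ x, x ∉ tsupport f → η x = 0 := by
    intro x hx
    have : β' x = β x := by
      rw [hβ', Pi.add_apply, iddbar_eq_zero I hJ hf (notMem_tsupport_iff_eventuallyEq.1 hx),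
        add_zero]
    simp only [hη, this]
    module
  refine (topIntegral_eq_of_support η b hηc (isClosed_tsupport f) hfb h0).trans ?_
  obtain ⟨hK1, hK2⟩ := isCompact_image_chart n (isClosed_tsupport f) hfb
  set K := extChartAt I b '' tsupport f with hK
  set v : Fin n × Fin 2 → (Fin n → ℂ) := fun x => frame n (pairEquiv rfl x) with hv
  -- Components on the frame of the primitive `-(1/2) df ∘ J` of `√-1 ∂∂̄ f`.
  set h : Fin n × Fin 2 → (Fin n → ℂ) → ℝ := fun s z =>
    -(1 / 2) * fderiv ℝ (f ∘ (extChartAt I b).symm) z (J (v s)) with hh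
  have hhs : ∀ s, ∀ z ∈ (extChartAt I b).target, ContDiffAt ℝ ∞ (h s) z := fun s z hz =>
    contDiffAt_const.mul ((contDiffAt_comp_symm I hf hz).fderiv_apply_const _)
  have hh0 : ∀ s, ∀ z ∈ (extChartAt I b).target, z ∉ K → h s z = 0 := by
    intro s z hz hzK
    have hx : (extChartAt I b).symm z ∉ tsupport f := fun hx =>
      hzK ⟨_, hx, (extChartAt I b).right_inv hz⟩
    have : f ∘ (extChartAt I b).symm =ᶠ[𝓝 z] 0 :=
      (continuousAt_extChartAt_symm'' hz).tendsto.eventually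
        (notMem_tsupport_iff_eventuallyEq.1 hx)
    have h1 : fderiv ℝ (f ∘ (extChartAt I b).symm) z = 0 := by
      rw [this.fderiv_eq]
      simp
    simp only [hh, h1, _root_.zero_apply, mul_zero]
  classical
  -- Extended by zero, since the inverse chart carries no information outside its target.
  set γ : Fin n × Fin 2 → (Fin n → ℂ) → ℂ := fun s z =>
    if z ∈ (extChartAt I b).target then (h s z : ℂ) else 0 with hγ
  have hγ0 : ∀ s z, z ∉ K → γ s z = 0 := by
    intro s z hz
    by_cases hzT : z ∈ (extChartAt I b).target
    · simp only [hγ, if_pos hzT, hh0 s z hzT hz, Complex.ofReal_zero]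
    · simp only [hγ, if_neg hzT]
  have hγev : ∀ s, ∀ z ∈ (extChartAt I b).target, γ s =ᶠ[𝓝 z] fun z => (h s z : ℂ) := by
    intro s z hz
    filter_upwards [hT.mem_nhds hz] with w hw
    simp only [hγ, if_pos hw]
  have hγt : ∀ s, tsupport (γ s) ⊆ K := fun s =>
    closure_minimal (fun z hz => by_contra fun hzK => hz (hγ0 s z hzK)) hK1.isClosed
  have hγs : ∀ s, ContDiff ℝ 2 (γ s) := by
    intro s
    refine contDiff_iff_contDiffAt.2 fun z => ?_
    by_cases hz : z ∈ K
    · refine ContDiffAt.congr_of_eventuallyEq ?_ (hγev s z (hK2 hz))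
      exact Complex.ofRealCLM.contDiff.contDiffAt.comp z
        ((hhs s z (hK2 hz)).of_le ENat.LEInfty.out)
    · refine (contDiffAt_const (c := (0 : ℂ))).congr_of_eventuallyEq ?_
      filter_upwards [hK1.isClosed.isOpen_compl.mem_nhds hz] with w hw using hγ0 s w hw
  have hγd : ∀ s, ∀ z ∈ (extChartAt I b).target, ∀ u,
      fderiv ℝ (γ s) z u = (fderiv ℝ (h s) z u : ℂ) := by
    intro s z hz u
    rw [(hγev s z hz).fderiv_eq]
    have h1 : HasFDerivAt (fun z => (h s z : ℂ)) _ z := Complex.ofRealCLM.hasFDerivAt.comp z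
      ((hhs s z hz).differentiableAt (by simp)).hasFDerivAt
    rw [h1.fderiv]
    rfl
  set B : Fin n × Fin 2 → Fin n × Fin 2 → (Fin n → ℂ) → ℂ := fun s t z =>
    (inChart I β b z ![v s, v t] : ℂ) + Complex.I * (inChart I χ b z ![v s, v t] : ℂ) with hB
  have hst := integral_psi_add_exact volume hT v γ B hγs
    (fun s => HasCompactSupport.of_support_subset_isCompact hK1
      ((subset_tsupport _).trans (hγt s)))
    (fun s => (hγt s).trans hK2)
    (fun s t => (Complex.ofRealCLM.contDiff.comp_contDiffOn ((hβ b).1 _ _)).add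
      (contDiffOn_const.mul (Complex.ofRealCLM.contDiff.comp_contDiffOn ((hχ b).1 _ _))))
    (fun r s t z hz => by
      have d : ∀ {β : M → (Fin n → ℂ) [⋀^Fin 2]→L[ℝ] ℝ}, IsCyclicClosed I β → ∀ u v,
        DifferentiableAt ℝ (fun z => inChart I β b z ![u, v]) z := fun hβ u v =>
        (((hβ b).1 u v).contDiffAt (hT.mem_nhds hz)).differentiableAt (by simp)
      simp only [hB]
      rw [fderiv_ofReal_add_I_mul (d hβ _ _) (d hχ _ _),
        fderiv_ofReal_add_I_mul (d hβ _ _) (d hχ _ _),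
        fderiv_ofReal_add_I_mul (d hβ _ _) (d hχ _ _)]
      have e1 := congrArg (Complex.ofReal) ((hβ b).2 (v r) (v s) (v t) z hz)
      have e2 := congrArg (Complex.ofReal) ((hχ b).2 (v r) (v s) (v t) z hz)
      push_cast at e1 e2
      linear_combination e1 + Complex.I * e2)
  have hden : ∀ z ∈ (extChartAt I b).target, density (fun y w => η y w) b z =
      algebraMap ℝ ℂ ((1 / 2) ^ n) * (psi (fun (_ : Fin n) x y => B x y z +
        (fderiv ℝ (γ y) z (v x) - fderiv ℝ (γ x) z (v y))) -
      psi (fun (_ : Fin n) x y => B x y z)) := by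
    intro z hz
    have e1 := density_wedgePow β χ b z
    have e2 := density_wedgePow β' χ b z
    change density (fun y w => wedgePow (complexForm (β' y) (χ y)) n w) b z +
      (-1 : ℝ) • density (fun y w => wedgePow (complexForm (β y) (χ y)) n w) b z = _
    rw [e1, e2, mul_sub, neg_one_smul, ← sub_eq_add_neg]
    congr 3
    funext _ x y
    have h3 := inChart_iddbar I hJ hf hz (v x) (v y)
    have h4 : ∀ s u, fderiv ℝ (h s) z u = -(1 / 2) *
        fderiv ℝ (fun z => fderiv ℝ (f ∘ (extChartAt I b).symm) z (J (v s))) z u := by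
      intro s u
      have := ((contDiffAt_comp_symm I hf hz).fderiv_apply_const (J (v s))).differentiableAt
        (by simp)
      rw [hh, fderiv_const_mul this]
      rfl
    rw [hγd y z hz, hγd x z hz, h4, h4]
    have h5 : inChart I β' b z ![v x, v y] = inChart I β b z ![v x, v y] +
      inChart I (iddbar I f) b z ![v x, v y] := rfl
    change ((inChart I β' b z ![v x, v y] : ℝ) : ℂ) + Complex.I * (inChart I χ b z ![v x, v y] : ℂ) =
      (inChart I β b z ![v x, v y] : ℂ) + Complex.I * (inChart I χ b z ![v x, v y] : ℂ) + _
    rw [h5, h3]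
    push_cast
    ring
  rw [setIntegral_congr_fun hT.measurableSet hden, integral_const_mul, hst, mul_zero]

variable (n M) in
-- The partition used in `topIntegral` is only continuous; cutting off `φ` requires a smooth one.
theorem exists_smooth_partition : ∃ (S : Finset M) (ψ : M → M → ℝ),
    (∀ b, ContMDiff 𝓘(ℝ, Fin n → ℂ) 𝓘(ℝ, ℝ) ∞ (ψ b)) ∧
    (∀ b, tsupport (ψ b) ⊆ (extChartAt 𝓘(ℝ, Fin n → ℂ) b).source) ∧
    ∀ x, ∑ b ∈ S, ψ b x = 1 := by
  obtain ⟨ρ, hρ⟩ := SmoothPartitionOfUnity.exists_isSubordinate 𝓘(ℝ, Fin n → ℂ) (M := M)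
    isClosed_univ (fun a : M => (extChartAt 𝓘(ℝ, Fin n → ℂ) a).source)
    (fun a => isOpen_extChartAt_source a) fun x _ => mem_iUnion.2 ⟨x, mem_extChartAt_source x⟩
  have hfin := ρ.locallyFinite.finite_nonempty_of_compact
  refine ⟨hfin.toFinset, fun b => ρ b, fun b => (ρ b).contMDiff, hρ, fun x => ?_⟩
  rw [← ρ.sum_eq_one (mem_univ x)]
  refine (finsum_eq_sum_of_support_subset _ fun a ha => ?_).symm
  exact hfin.mem_toFinset.2 ⟨x, ha⟩

/-- Adding `√-1 ∂∂̄ φ` does not change the integral of the top power. -/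
theorem topIntegral_add_iddbar {β χ : M → (Fin n → ℂ) [⋀^Fin 2]→L[ℝ] ℝ}
    (hβ : IsCyclicClosed 𝓘(ℝ, Fin n → ℂ) β) (hχ : IsCyclicClosed 𝓘(ℝ, Fin n → ℂ) χ)
    {φ : M → ℝ} (hφ : ContMDiff 𝓘(ℝ, Fin n → ℂ) 𝓘(ℝ, ℝ) ∞ φ) :
    topIntegral (fun y w => wedgePow
      (complexForm ((β + iddbar 𝓘(ℝ, Fin n → ℂ) φ) y) (χ y)) n w) =
    topIntegral (fun y w => wedgePow (complexForm (β y) (χ y)) n w) := by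
  classical
  have hJ := isHolomorphicAtlas (Fin n → ℂ) M
  obtain ⟨S, ψ, hψ, hψs, hψ1⟩ := exists_smooth_partition n M
  have hf : ∀ b, ContMDiff 𝓘(ℝ, Fin n → ℂ) 𝓘(ℝ, ℝ) ∞ fun x => ψ b x * φ x := fun b =>
    (hψ b).mul hφ
  have hsum : φ = ∑ b ∈ S, fun x => ψ b x * φ x := by
    funext x
    rw [Finset.sum_apply, ← Finset.sum_mul, hψ1, one_mul]
  -- The pieces `ψ_b φ` are added successively, each supported in a chart. Closedness of the partial
  -- sums is needed for the next application of the local result.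
  have key : ∀ S : Finset M, IsCyclicClosed 𝓘(ℝ, Fin n → ℂ)
      (β + ∑ b ∈ S, iddbar 𝓘(ℝ, Fin n → ℂ) (fun x => ψ b x * φ x)) ∧
      topIntegral (fun y w => wedgePow (complexForm
        ((β + ∑ b ∈ S, iddbar 𝓘(ℝ, Fin n → ℂ) (fun x => ψ b x * φ x)) y) (χ y)) n w) =
      topIntegral (fun y w => wedgePow (complexForm (β y) (χ y)) n w) := by
    intro S
    induction S using Finset.induction_on with
    | empty => simpa using hβ
    | insert b S hb ih =>
      rw [Finset.sum_insert hb, add_comm (iddbar _ _), ← add_assoc]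
      refine ⟨ih.1.add _ (isCyclicClosed_iddbar _ hJ (hf b)), ?_⟩
      rw [topIntegral_add_iddbar_of_tsupport ih.1 hχ (hf b) b, ih.2]
      exact (closure_mono (Function.support_mul_subset_left _ _)).trans (hψs b)
  have h := (key S).2
  rw [← iddbar_sum _ hJ S hf, ← hsum] at h
  exact h

end StokesManifold

/-! ### Normalisation of the metric by congruence -/

section Normalise

open Matrix
open scoped ComplexOrder

variable {ι κ : Type*} [Fintype ι] [DecidableEq ι] [Fintype κ] [DecidableEq κ]

theorem exists_unitary_diagonal {A : Matrix ι ι ℂ} (hA : A.IsHermitian) :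
    ∃ U : Matrix ι ι ℂ, U * Uᴴ = 1 ∧ U * A * Uᴴ = diagonal fun i => (hA.eigenvalues i : ℂ) := by
  refine ⟨(hA.eigenvectorUnitary : Matrix ι ι ℂ)ᴴ, ?_, ?_⟩
  · rw [conjTranspose_conjTranspose]
    exact Unitary.coe_star_mul_self hA.eigenvectorUnitary
  · have h := hA.conjStarAlgAut_star_eigenvectorUnitary
    rw [Unitary.conjStarAlgAut_star_apply] at h
    rw [conjTranspose_conjTranspose]
    exact h

/-- A positive definite matrix is congruent to the identity. -/
theorem exists_normalise {A : Matrix ι ι ℂ} (hA : A.PosDef) : ∃ K : Matrix ι ι ℂ, K * A * Kᴴ = 1 := by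
  obtain ⟨U, -, hU⟩ := exists_unitary_diagonal hA.isHermitian
  refine ⟨diagonal (fun i => ((√(hA.isHermitian.eigenvalues i))⁻¹ : ℂ)) * U, ?_⟩
  have h1 : diagonal (fun i => ((√(hA.isHermitian.eigenvalues i))⁻¹ : ℂ)) * U * A *
      (diagonal (fun i => ((√(hA.isHermitian.eigenvalues i))⁻¹ : ℂ)) * U)ᴴ =
      diagonal (fun i => ((√(hA.isHermitian.eigenvalues i))⁻¹ : ℂ)) * (U * A * Uᴴ) *
      (diagonal (fun i => ((√(hA.isHermitian.eigenvalues i))⁻¹ : ℂ)))ᴴ := by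
    rw [conjTranspose_mul]
    simp only [Matrix.mul_assoc]
  rw [h1, hU, diagonal_conjTranspose, diagonal_mul_diagonal, diagonal_mul_diagonal, ← diagonal_one]
  congr 1
  funext i
  have hp := hA.eigenvalues_pos i
  have hs : (√(hA.isHermitian.eigenvalues i) : ℂ) * √(hA.isHermitian.eigenvalues i) =
      hA.isHermitian.eigenvalues i := by
    rw [← Complex.ofReal_mul, Real.mul_self_sqrt hp.le]
  have hne : (√(hA.isHermitian.eigenvalues i) : ℂ) ≠ 0 := by
    rw [Complex.ofReal_ne_zero]
    exact (Real.sqrt_pos.2 hp).ne'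
  simp only [Pi.star_apply, star_inv₀, Complex.star_def, Complex.conj_ofReal]
  rw [← hs]
  field_simp

/-- Congruence transformations which normalise `X` preserve the eigenvalues relative to `X`. -/
theorem charpoly_of_normalise {X B Q : Matrix ι ι ℂ} (hQ : Q * X * Qᴴ = 1) :
    (X⁻¹ * B).charpoly = (Q * B * Qᴴ).charpoly := by
  -- The hypothesis says that `X⁻¹ = Q* Q`, and cyclic invariance of the characteristic polynomial
  -- does the rest.
  have h1 : X * (Qᴴ * Q) = 1 := by
    have h2 : Q * (X * Qᴴ) = 1 := by rw [← Matrix.mul_assoc, hQ]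
    have h3 := mul_eq_one_comm.1 h2
    rw [← Matrix.mul_assoc, h3]
  rw [inv_eq_right_inv h1, Matrix.mul_assoc, charpoly_mul_comm]

theorem border_congr (K : Matrix κ κ ℂ) (a : ℂ) (b : κ → ℂ) (D : Matrix κ κ ℂ) :
    border a (K *ᵥ b) (K * D * Kᴴ) = fromBlocks (1 : Matrix Unit Unit ℂ) 0 0 K * border a b D *
      (fromBlocks (1 : Matrix Unit Unit ℂ) 0 0 K)ᴴ := by
  rw [border, border, fromBlocks_conjTranspose, fromBlocks_multiply, fromBlocks_multiply]
  simp only [conjTranspose_one, conjTranspose_zero, Matrix.one_mul, Matrix.mul_one,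
    Matrix.zero_mul, Matrix.mul_zero, add_zero, zero_add]
  congr 1
  ext i j
  simp [mul_apply, mulVec, dotProduct, conjTranspose_apply, mul_comm]

theorem det_conj_mul (K D : Matrix ι ι ℂ) :
    (K * D * Kᴴ).det = (Complex.normSq K.det : ℂ) * D.det := by
  rw [det_mul, det_mul, det_conjTranspose, ← Complex.mul_conj]
  simp only [Complex.star_def]
  ring

/-- The pointwise estimate for a family of vectors adapted to the splitting. -/
theorem sum_arccot_family_lt [Nonempty κ] {X B T : Matrix (ι ⊕ κ) (ι ⊕ κ) ℂ} {A : Matrix κ κ ℂ}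
    (hA : A.PosDef) (hX : T * X * Tᴴ = fromBlocks 1 0 0 A) {θ Θ : ℝ}
    (hθ : θ ≤ Real.pi) (hΘ : Θ ≤ Real.pi) (hB : B ∈ GammaMatrix X θ Θ)
    {Y : Matrix (ι ⊕ κ) (ι ⊕ κ) ℂ} (hY : Y = T * B * Tᴴ) {D : Matrix κ κ ℂ}
    (hD : D = Y.submatrix Sum.inr Sum.inr + Complex.I • A) {N : ι → ℝ}
    (hN : ∀ i, N i =
      (border (Y (Sum.inl i) (Sum.inl i)) (fun k => Y (Sum.inr k) (Sum.inl i)) D).det.im) :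
    0 < D.det.im ∧ ∑ i, arccot (N i / D.det.im) + arccot (D.det.re / D.det.im) < Θ ∧
      ∀ j, ∑ i ∈ Finset.univ.erase j, arccot (N i / D.det.im) + arccot (D.det.re / D.det.im) < θ := by
  obtain ⟨hBh, μ, hμ, hμΓ⟩ := hB
  obtain ⟨K, hK⟩ := exists_normalise hA
  -- Only the fibre block remains to be normalised, so the base diagonal entries of `Y` are
  -- unchanged.
  set L : Matrix (ι ⊕ κ) (ι ⊕ κ) ℂ := fromBlocks 1 0 0 K with hL
  set Y' := L * Y * Lᴴ with hY'
  have hQ : (L * T) * X * (L * T)ᴴ = 1 := by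
    have : (L * T) * X * (L * T)ᴴ = L * (T * X * Tᴴ) * Lᴴ := by
      rw [conjTranspose_mul]; simp only [Matrix.mul_assoc]
    rw [this, hX, hL, fromBlocks_conjTranspose, fromBlocks_multiply, fromBlocks_multiply]
    simp [hK]
  have hY'e : Y' = (L * T) * B * (L * T)ᴴ := by
    rw [hY', hY, conjTranspose_mul]; simp only [Matrix.mul_assoc]
  have hY'h : Y'.IsHermitian := by
    rw [hY'e]
    exact isHermitian_mul_mul_conjTranspose _ hBh
  rw [charpoly_of_normalise hQ, ← hY'e] at hμ
  obtain ⟨h1, h2, h3⟩ := sum_arccot_reduced_lt hY'h hμ hθ hΘ hμΓ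
  have hblk : Y = fromBlocks Y.toBlocks₁₁ Y.toBlocks₁₂ Y.toBlocks₂₁ Y.toBlocks₂₂ :=
    (fromBlocks_toBlocks Y).symm
  have hY'blk : Y' = fromBlocks Y.toBlocks₁₁ (Y.toBlocks₁₂ * Kᴴ) (K * Y.toBlocks₂₁)
      (K * Y.toBlocks₂₂ * Kᴴ) := by
    rw [hY', hL, fromBlocks_conjTranspose]
    conv_lhs => rw [hblk]
    rw [fromBlocks_multiply, fromBlocks_multiply]
    simp
  have hsub : Y'.submatrix Sum.inr Sum.inr + Complex.I • (1 : Matrix κ κ ℂ) = K * D * Kᴴ := by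
    have e1 : Y'.submatrix Sum.inr Sum.inr = K * Y.submatrix Sum.inr Sum.inr * Kᴴ := by
      rw [hY'blk]
      rfl
    rw [e1, hD, Matrix.mul_add, Matrix.add_mul, Matrix.mul_smul, Matrix.smul_mul, hK]
  have hKdet : 0 < Complex.normSq K.det := by
    rw [Complex.normSq_pos]
    intro h0
    have := congrArg Matrix.det hK
    rw [det_mul, det_mul, h0] at this
    simp at this
  set r := Complex.normSq K.det with hr
  have hdet : (Y'.submatrix Sum.inr Sum.inr + Complex.I • (1 : Matrix κ κ ℂ)).det =
      (r : ℂ) * D.det := by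
    rw [hsub, det_conj_mul]
  have hdiag : ∀ i, ((Y' (Sum.inl i) (Sum.inl i)).re : ℂ) = Y (Sum.inl i) (Sum.inl i) := by
    intro i
    have e1 : Y' (Sum.inl i) (Sum.inl i) = Y (Sum.inl i) (Sum.inl i) := by
      rw [hY'blk]
      rfl
    rw [← e1]
    exact Complex.conj_eq_iff_re.1 (hY'h.apply _ _)
  have hcol : ∀ i, (fun k => Y' (Sum.inr k) (Sum.inl i)) =
      K *ᵥ fun k => Y (Sum.inr k) (Sum.inl i) := by
    intro i
    rw [hY'blk]
    rfl
  -- Numerator and denominator are both multiplied by `|det K|²`, so the quotient does not depend on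
  -- the fibre frame.
  have hred : ∀ i, reduced (Y'.submatrix Sum.inr Sum.inr) (Y' (Sum.inl i) (Sum.inl i)).re
      (fun k => Y' (Sum.inr k) (Sum.inl i)) = N i / D.det.im := by
    intro i
    rw [reduced, hdet, hsub, hdiag, hcol, border_congr, det_conj_mul, hN, det_fromBlocks_zero₂₁,
      det_one, one_mul, ← hr, Complex.im_ofReal_mul, Complex.im_ofReal_mul,
      mul_div_mul_left _ _ hKdet.ne']
  have hph := arccot_re_div_im (hY'h.submatrix Sum.inr) h1
  have hpos := im_det_add_I_pos (hY'h.submatrix Sum.inr) h1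
  rw [hdet, Complex.im_ofReal_mul] at hpos
  rw [hdet, Complex.im_ofReal_mul, Complex.re_ofReal_mul, mul_div_mul_left _ _ hKdet.ne'] at hph
  simp only [hred, ← hph] at h2 h3
  exact ⟨pos_of_mul_pos_right hpos hKdet.le, h2, h3⟩

end Normalise

/-! ### The Hermitian form of a real (1,1)-form -/

section HermForm

open Matrix
open scoped ComplexOrder

variable {E : Type*} [NormedAddCommGroup E] [NormedSpace ℝ E] [NormedSpace ℂ E]
  [IsScalarTower ℝ ℂ E]

/-- The sesquilinear form of a real (1,1)-form. -/
def realHermForm (α : E [⋀^Fin 2]→L[ℝ] ℝ) (u v : E) : ℂ := hermForm (complexForm α 0) u v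

theorem realHermForm_apply (α : E [⋀^Fin 2]→L[ℝ] ℝ) (u v : E) :
    realHermForm α u v = ((α ![u, J v] : ℂ) - Complex.I * (α ![u, v] : ℂ)) / 2 := by
  simp [realHermForm, hermForm, complexForm_apply]

theorem hermMatrix_eq {ι : Type*} (b : Module.Basis ι ℂ E) (α : E [⋀^Fin 2]→L[ℝ] ℝ) :
    hermMatrix b α = of fun i j => realHermForm α (b i) (b j) := by
  ext i j
  simp [hermMatrix, realHermForm_apply]

theorem realHermForm_conj {α : E [⋀^Fin 2]→L[ℝ] ℝ} (hα : IsOneOne α) (u v : E) :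
    star (realHermForm α u v) = realHermForm α v u := by
  rw [realHermForm_apply, realHermForm_apply, pair_J_symm hα v u, pair_swap α u v]
  simp

theorem pair_add_left (α : E [⋀^Fin 2]→L[ℝ] ℝ) (u u' v : E) :
    α ![u + u', v] = α ![u, v] + α ![u', v] :=
  α.toMultilinearMap.cons_add ![v] u u'

theorem pair_smul_left (α : E [⋀^Fin 2]→L[ℝ] ℝ) (c : ℝ) (u v : E) :
    α ![c • u, v] = c * α ![u, v] :=
  α.toMultilinearMap.cons_smul ![v] c u

theorem realHermForm_smul_left {α : E [⋀^Fin 2]→L[ℝ] ℝ} (hα : IsOneOne α) (c : ℂ) (u v : E) :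
    realHermForm α (c • u) v = c * realHermForm α u v := by
  have hc : c • u = c.re • u + c.im • J u := by
    conv_lhs => rw [← Complex.re_add_im c]
    rw [add_smul, mul_smul]
    change (c.re : ℂ) • u + (c.im : ℂ) • J u = _
    rw [← algebraMap_smul ℂ c.re u, ← algebraMap_smul ℂ c.im (J u)]
    rfl
  have h1 : ∀ w, α ![J u, w] = -α ![u, J w] := fun w => pair_J_left hα u w
  rw [realHermForm_apply, realHermForm_apply, hc]
  simp only [pair_add_left, pair_smul_left, h1, J_J, pair_neg_right]
  push_cast
  rw [← Complex.re_add_im c]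
  simp only [Complex.add_re, Complex.ofReal_re, Complex.mul_re, Complex.I_re, Complex.I_im,
    Complex.ofReal_im, Complex.add_im, Complex.mul_im]
  ring_nf
  simp only [Complex.I_sq]
  ring

theorem realHermForm_add_left (α : E [⋀^Fin 2]→L[ℝ] ℝ) (u u' v : E) :
    realHermForm α (u + u') v = realHermForm α u v + realHermForm α u' v := by
  simp only [realHermForm_apply, pair_add_left]
  push_cast
  ring

theorem realHermForm_sum_left {κ : Type*} [Fintype κ] {α : E [⋀^Fin 2]→L[ℝ] ℝ} (hα : IsOneOne α)
    (c : κ → ℂ) (b : κ → E) (v : E) :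
    realHermForm α (∑ k, c k • b k) v = ∑ k, c k * realHermForm α (b k) v := by
  let ℓ : E →ₗ[ℂ] ℂ :=
    { toFun := fun u => realHermForm α u v
      map_add' := fun u u' => realHermForm_add_left α u u' v
      map_smul' := fun c u => realHermForm_smul_left hα c u v }
  change ℓ (∑ k, c k • b k) = _
  rw [map_sum]
  simp only [map_smul]
  rfl

/-- The matrix of a (1,1)-form in a family of linear combinations. -/
theorem realHermForm_family {ι κ : Type*} [Fintype κ] {α : E [⋀^Fin 2]→L[ℝ] ℝ}
    (hα : IsOneOne α) (b : κ → E) (T : Matrix ι κ ℂ) :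
    (of fun i j => realHermForm α (∑ k, T i k • b k) (∑ k, T j k • b k)) =
      T * (of fun i j => realHermForm α (b i) (b j)) * Tᴴ := by
  ext i j
  have h1 : ∀ k, realHermForm α (b k) (∑ l, T j l • b l) =
      ∑ l, realHermForm α (b k) (b l) * star (T j l) := by
    intro k
    rw [← realHermForm_conj hα, realHermForm_sum_left hα, star_sum]
    refine Finset.sum_congr rfl fun l _ => ?_
    rw [star_mul, realHermForm_conj hα]
  rw [of_apply, realHermForm_sum_left hα, Matrix.mul_assoc, mul_apply]
  refine Finset.sum_congr rfl fun k _ => ?_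
  rw [h1, mul_apply]
  rfl

theorem isHermitian_realHermForm {ι : Type*} {α : E [⋀^Fin 2]→L[ℝ] ℝ} (hα : IsOneOne α)
    (b : ι → E) : (of fun i j => realHermForm α (b i) (b j)).IsHermitian :=
  IsHermitian.ext fun i j => by simpa using realHermForm_conj hα (b j) (b i)

theorem realHermForm_self (α : E [⋀^Fin 2]→L[ℝ] ℝ) (u : E) :
    realHermForm α u u = ((α ![u, J u] / 2 : ℝ) : ℂ) := by
  have h := pair_swap α u u
  have h0 : α ![u, u] = 0 := by linarith
  rw [realHermForm_apply, h0]
  push_cast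
  ring

theorem posDef_realHermForm {ι : Type*} [Fintype ι] {α : E [⋀^Fin 2]→L[ℝ] ℝ} (hα : IsOneOne α)
    (hp : IsPositive α) {b : ι → E} (hb : LinearIndependent ℂ b) :
    (of fun i j => realHermForm α (b i) (b j)).PosDef := by
  classical
  refine PosDef.of_dotProduct_mulVec_pos (isHermitian_realHermForm hα b) fun x hx => ?_
  -- The form is linear in its first argument, so `x* H x` is its value on the vector with the
  -- conjugate coefficients `star (x k)`.
  have h1 := congrFun (congrFun (realHermForm_family hα b (of fun (_ : Unit) k => star (x k))) ()) ()
  have h2 : star x ⬝ᵥ (of fun i j => realHermForm α (b i) (b j)) *ᵥ x =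
      realHermForm α (∑ k, star (x k) • b k) (∑ k, star (x k) • b k) := by
    rw [of_apply] at h1
    refine Eq.trans ?_ h1.symm
    rw [Matrix.mul_assoc, mul_apply]
    simp [dotProduct, mulVec, mul_apply]
  rw [h2, realHermForm_self]
  have hne : ∑ k, star (x k) • b k ≠ 0 := by
    intro h0
    apply hx
    funext k
    have := Fintype.linearIndependent_iff.1 hb _ h0 k
    simpa using this
  have := hp _ hne
  exact_mod_cast (by linarith : (0 : ℝ) < α ![_, J _] / 2)

/-- Two (1,1)-forms, the first of them positive, are diagonal in a common frame. -/
theorem exists_diagonal_frame {ι : Type*} [Fintype ι] [DecidableEq ι] (b : Module.Basis ι ℂ E)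
    {χ η : E [⋀^Fin 2]→L[ℝ] ℝ} (hχ : IsOneOne χ) (hp : IsPositive χ) (hη : IsOneOne η) :
    ∃ u : ι → E, (of fun i j => realHermForm χ (u i) (u j)) = (1 : Matrix ι ι ℂ) ∧ ∀ θ Θ : ℝ,
      (fun i => η ![u i, J (u i)] / 2) ∈ Gamma ι θ Θ →
      hermMatrix b η ∈ GammaMatrix (hermMatrix b χ) θ Θ := by
  obtain ⟨K, hK⟩ := exists_normalise (posDef_realHermForm hχ hp b.linearIndependent)
  set X := (of fun i j => realHermForm χ (b i) (b j)) with hX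
  set B := (of fun i j => realHermForm η (b i) (b j)) with hB
  have hBh : B.IsHermitian := isHermitian_realHermForm hη b
  have hKB : (K * B * Kᴴ).IsHermitian := isHermitian_mul_mul_conjTranspose _ hBh
  obtain ⟨U, hU1, hU2⟩ := exists_unitary_diagonal hKB
  have hUK : ∀ Z : Matrix ι ι ℂ, (U * K) * Z * (U * K)ᴴ = U * (K * Z * Kᴴ) * Uᴴ := fun Z => by
    rw [conjTranspose_mul]; simp only [Matrix.mul_assoc]
  have hQ : (U * K) * X * (U * K)ᴴ = 1 := by rw [hUK, hK, Matrix.mul_one, hU1]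
  refine ⟨fun i => ∑ k, (U * K) i k • b k, ?_, fun θ Θ h => ?_⟩
  · rw [realHermForm_family hχ b (U * K), hQ]
  · rw [hermMatrix_eq, hermMatrix_eq]
    -- In this frame `χ` is the identity and `η` is diagonal, so the diagonal values are the
    -- eigenvalues.
    refine ⟨hBh, _, ?_, h⟩
    rw [charpoly_of_normalise hQ, hUK, hU2, charpoly_diagonal]
    refine Finset.prod_congr rfl fun i _ => ?_
    have h1 := congrFun (congrFun (realHermForm_family hη b (U * K)) i) i
    rw [hUK, hU2, of_apply, realHermForm_self, diagonal_apply_eq] at h1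
    rw [h1]

end HermForm

/-! ### Continuity of form-valued functions -/

section Alternating

/-- In finite dimension forms embed in their values on tuples of basis vectors. Needed because
`fibreIntegral` integrates a function with values in forms. -/
theorem continuousOn_alternating {V E : Type*} [TopologicalSpace V] [NormedAddCommGroup E]
    [NormedSpace ℝ E] [FiniteDimensional ℝ E] {k : ℕ} {f : V → E [⋀^Fin k]→L[ℝ] ℝ} {T : Set V}
    (hf : ∀ u, ContinuousOn (fun z => f z u) T) : ContinuousOn f T := by
  set b := Module.finBasis ℝ E
  let ev : (E [⋀^Fin k]→L[ℝ] ℝ) →ₗ[ℝ] ((Fin k → Fin (Module.finrank ℝ E)) → ℝ) :=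
    { toFun := fun η v => η fun i => b (v i)
      map_add' := fun _ _ => rfl
      map_smul' := fun _ _ => rfl }
  have hinj : Function.Injective ev := by
    intro η ζ h
    have h1 : η.toAlternatingMap = ζ.toAlternatingMap :=
      Module.Basis.ext_alternating b fun v _ => congrFun h v
    ext u
    exact congrArg (fun g : E [⋀^Fin k]→ₗ[ℝ] ℝ => g u) h1
  have : FiniteDimensional ℝ (E [⋀^Fin k]→L[ℝ] ℝ) := FiniteDimensional.of_injective ev hinj
  have hemb := LinearMap.isClosedEmbedding_of_injective (f := ev) (LinearMap.ker_eq_bot.2 hinj)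
  rw [hemb.isInducing.continuousOn_iff]
  exact continuousOn_pi.2 fun v => hf _

end Alternating

/-! ### The fibre integral and its type -/

section Fibre

open Set Matrix

variable {n : ℕ} {M : Type*} [TopologicalSpace M] [ChartedSpace (Fin n → ℂ) M]

theorem pull₁_pair (η : M → (Fin n → ℂ) [⋀^Fin 2]→L[ℝ] ℝ) (p y : M)
    (U V : (Fin n → ℂ) × (Fin n → ℂ)) : pull₁ n η (p, y) ![U, V] = η p ![U.1, V.1] := by
  rw [pull₁, pullback, mfderiv_fst]
  change η p _ = _
  congr 1
  funext i
  fin_cases i <;> rfl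

theorem pull₂_pair (η : M → (Fin n → ℂ) [⋀^Fin 2]→L[ℝ] ℝ) (p y : M)
    (U V : (Fin n → ℂ) × (Fin n → ℂ)) : pull₂ n η (p, y) ![U, V] = η y ![U.2, V.2] := by
  rw [pull₂, pullback, mfderiv_snd]
  change η y _ = _
  congr 1
  funext i
  fin_cases i <;> rfl

theorem isOneOne_pull₁ {η : M → (Fin n → ℂ) [⋀^Fin 2]→L[ℝ] ℝ} {p : M} (hη : IsOneOne (η p))
    (y : M) : IsOneOne (pull₁ n η (p, y)) := fun U V => by
  rw [pull₁_pair, pull₁_pair]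
  exact hη _ _

theorem isOneOne_pull₂ {η : M → (Fin n → ℂ) [⋀^Fin 2]→L[ℝ] ℝ} {y : M} (hη : IsOneOne (η y))
    (p : M) : IsOneOne (pull₂ n η (p, y)) := fun U V => by
  rw [pull₂_pair, pull₂_pair]
  exact hη _ _

/-- The tuple of the vectors `(0, w i)` followed by `(u 0, 0)` and `(u 1, 0)`. -/
def fibreTuple (w : Fin (2 * n) → (Fin n → ℂ)) (u : Fin 2 → (Fin n → ℂ)) (i : Fin (2 + 2 * n)) :
    (Fin n → ℂ) × (Fin n → ℂ) :=
  if h : (i : ℕ) < 2 * n then (0, w ⟨i, h⟩) else (u ⟨i - 2 * n, by omega⟩, 0)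

theorem fibreTuple_castSucc (w : Fin (2 * n) → (Fin n → ℂ)) (u : Fin 2 → (Fin n → ℂ))
    (h : 2 * (n + 1) = 2 + 2 * n) (i : Fin n) (a : Fin 2) :
    fibreTuple w u (pairEquiv h (i.castSucc, a)) = (0, w (pairEquiv rfl (i, a))) := by
  have h1 := pairEquiv_val h (i.castSucc, a)
  have h3 : (pairEquiv h (i.castSucc, a) : ℕ) < 2 * n := by
    rw [h1]
    simp only [Fin.val_castSucc]
    omega
  rw [fibreTuple, dif_pos h3]
  congr 2

theorem fibreTuple_last (w : Fin (2 * n) → (Fin n → ℂ)) (u : Fin 2 → (Fin n → ℂ))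
    (h : 2 * (n + 1) = 2 + 2 * n) (a : Fin 2) :
    fibreTuple w u (pairEquiv h (Fin.last n, a)) = (u a, 0) := by
  have h1 := pairEquiv_val h (Fin.last n, a)
  have h3 : ¬ (pairEquiv h (Fin.last n, a) : ℕ) < 2 * n := by
    rw [h1]
    simp
  rw [fibreTuple, dif_neg h3]
  congr 2
  ext
  simp only [h1, Fin.val_last]
  omega

theorem contract_inl (w : Fin (2 * n) → (Fin n → ℂ)) (u : Fin 2 → (Fin n → ℂ))
    (η : ((Fin n → ℂ) × (Fin n → ℂ)) [⋀^Fin (2 + 2 * n)]→L[ℝ] ℝ) :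
    (contract (2 * n) (fun j => ((0 : Fin n → ℂ), w j)) η).compContinuousLinearMap
      (ContinuousLinearMap.inl ℝ (Fin n → ℂ) (Fin n → ℂ)) u = η (fibreTuple w u) := by
  rw [ContinuousAlternatingMap.compContinuousLinearMap_apply, contract_apply]
  rfl

/-- A form on `M × M` has continuous coefficients along the fibre over `p`, in the charts of the
fibre. -/
def HasContinuousFibre (p : M) (η : M × M → ((Fin n → ℂ) × (Fin n → ℂ)) [⋀^Fin 2]→L[ℝ] ℝ) : Prop :=
  ∀ (a : M) (U V : (Fin n → ℂ) × (Fin n → ℂ)), ContinuousOn (fun z =>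
    η (p, (extChartAt 𝓘(ℝ, Fin n → ℂ) a).symm z) ![(U.1, symD 𝓘(ℝ, Fin n → ℂ) a z U.2),
      (V.1, symD 𝓘(ℝ, Fin n → ℂ) a z V.2)]) (extChartAt 𝓘(ℝ, Fin n → ℂ) a).target

theorem HasContinuousFibre.add {p : M}
    {η ζ : M × M → ((Fin n → ℂ) × (Fin n → ℂ)) [⋀^Fin 2]→L[ℝ] ℝ}
    (hη : HasContinuousFibre p η) (hζ : HasContinuousFibre p ζ) : HasContinuousFibre p (η + ζ) :=
  fun a U V => (hη a U V).add (hζ a U V)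

theorem HasContinuousFibre.smul {p : M}
    {η : M × M → ((Fin n → ℂ) × (Fin n → ℂ)) [⋀^Fin 2]→L[ℝ] ℝ}
    (hη : HasContinuousFibre p η) (c : ℝ) : HasContinuousFibre p (c • η) :=
  fun a U V => (hη a U V).const_smul c

theorem hasContinuousFibre_pull₁ (p : M) (η : M → (Fin n → ℂ) [⋀^Fin 2]→L[ℝ] ℝ) :
    HasContinuousFibre p (pull₁ n η) := by
  intro a U V
  simp only [pull₁_pair]
  exact continuousOn_const

theorem hasContinuousFibre_pull₂ (p : M) {η : M → (Fin n → ℂ) [⋀^Fin 2]→L[ℝ] ℝ}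
    (hη : IsCyclicClosed 𝓘(ℝ, Fin n → ℂ) η) : HasContinuousFibre p (pull₂ n η) := by
  intro a U V
  simp only [pull₂_pair, ← inChart_pair]
  exact hη.continuousOn a _ _

/-- The slice through `p` of the product chart at `(p, a)` is the chart of the fibre, and the
derivative of the inverse chart at `p` is the identity. -/
theorem hasContinuousFibre_iddbar [IsManifold 𝓘(ℝ, Fin n → ℂ) ∞ M] (p : M)
    (hJ : IsHolomorphicAtlas 𝓘(ℝ, Fin n → ℂ) M) {φ : M × M → ℝ}
    (hφ : ContMDiff (𝓘(ℝ, Fin n → ℂ).prod 𝓘(ℝ, Fin n → ℂ)) 𝓘(ℝ, ℝ) ∞ φ) :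
    HasContinuousFibre p (iddbar (𝓘(ℝ, Fin n → ℂ).prod 𝓘(ℝ, Fin n → ℂ)) φ) := by
  intro a U V
  have h := (((isCyclicClosed_iddbar _ (isHolomorphicAtlas_prod hJ) hφ) (p, a)).1 U V).continuousOn
  have h2 : ContinuousOn (fun z : Fin n → ℂ => (extChartAt 𝓘(ℝ, Fin n → ℂ) p p, z))
    (extChartAt 𝓘(ℝ, Fin n → ℂ) a).target := by fun_prop
  have hmem : ∀ z ∈ (extChartAt 𝓘(ℝ, Fin n → ℂ) a).target,
      (extChartAt 𝓘(ℝ, Fin n → ℂ) p p, z) ∈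
        (extChartAt (𝓘(ℝ, Fin n → ℂ).prod 𝓘(ℝ, Fin n → ℂ)) (p, a)).target := by
    intro z hz
    rw [extChartAt_prod]
    exact ⟨mem_extChartAt_target p, hz⟩
  refine (h.comp h2 hmem).congr fun z hz => ?_
  simp only [Function.comp_apply]
  rw [inChart_pair, symD_prod (mem_extChartAt_target p) hz, symD_self]
  have : (extChartAt (𝓘(ℝ, Fin n → ℂ).prod 𝓘(ℝ, Fin n → ℂ)) (p, a)).symm
      (extChartAt 𝓘(ℝ, Fin n → ℂ) p p, z) = (p, (extChartAt 𝓘(ℝ, Fin n → ℂ) a).symm z) := by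
    rw [extChartAt_prod]
    exact Prod.ext (extChartAt_to_inv (I := 𝓘(ℝ, Fin n → ℂ)) p) rfl
  rw [this]
  rfl

/-- The vectors of the model space which give the tuple of the fibre integral. -/
def fibreModel (u : Fin 2 → (Fin n → ℂ)) (x : Fin (n + 1) × Fin 2) : (Fin n → ℂ) × (Fin n → ℂ) :=
  fibreTuple (frame n) u (pairEquiv (by ring) x)

theorem fibreTuple_symD (a : M) (z : Fin n → ℂ) (u : Fin 2 → (Fin n → ℂ))
    (x : Fin (n + 1) × Fin 2) :
    fibreTuple (fun j => symD 𝓘(ℝ, Fin n → ℂ) a z (frame n j)) u (pairEquiv (by ring) x) =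
      ((fibreModel u x).1, symD 𝓘(ℝ, Fin n → ℂ) a z (fibreModel u x).2) := by
  rw [fibreModel, fibreTuple, fibreTuple]
  split_ifs <;> simp

/-- The summands of the fibre integral, evaluated. -/
theorem density_wedge (p : M) (η ζ : M × M → ((Fin n → ℂ) × (Fin n → ℂ)) [⋀^Fin 2]→L[ℝ] ℝ)
    {r s : ℕ} (hrs : r + s = n + 1) (h : 2 * r + 2 * s = 2 + 2 * n) (u : Fin 2 → (Fin n → ℂ))
    (a : M) (z : Fin n → ℂ) :
    density (fun y w => wedge h (wedgePow (η (p, y)) r) (wedgePow (ζ (p, y)) s) (fibreTuple w u))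
      a z = algebraMap ℝ ℝ ((1 / 2) ^ (n + 1)) * psi (fun (i : Fin (n + 1)) x y =>
        if (i : ℕ) < r then η (p, (extChartAt 𝓘(ℝ, Fin n → ℂ) a).symm z)
          ![((fibreModel u x).1, symD 𝓘(ℝ, Fin n → ℂ) a z (fibreModel u x).2),
            ((fibreModel u y).1, symD 𝓘(ℝ, Fin n → ℂ) a z (fibreModel u y).2)]
        else ζ (p, (extChartAt 𝓘(ℝ, Fin n → ℂ) a).symm z)
          ![((fibreModel u x).1, symD 𝓘(ℝ, Fin n → ℂ) a z (fibreModel u x).2),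
            ((fibreModel u y).1, symD 𝓘(ℝ, Fin n → ℂ) a z (fibreModel u y).2)]) := by
  rw [density, wedge_wedgePow_apply _ _ hrs (by ring)]
  simp only [fibreTuple_symD]

theorem hasContinuousDensity_wedge {p : M}
    {η ζ : M × M → ((Fin n → ℂ) × (Fin n → ℂ)) [⋀^Fin 2]→L[ℝ] ℝ} (hη : HasContinuousFibre p η)
    (hζ : HasContinuousFibre p ζ) {r s : ℕ} (hrs : r + s = n + 1)
    (h : 2 * r + 2 * s = 2 + 2 * n) (u : Fin 2 → (Fin n → ℂ)) :
    HasContinuousDensity fun y w =>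
      wedge h (wedgePow (η (p, y)) r) (wedgePow (ζ (p, y)) s) (fibreTuple w u) := by
  intro a
  simp only [funext (density_wedge p η ζ hrs h u a)]
  refine continuousOn_const.mul ?_
  unfold psi
  refine continuousOn_finsetSum _ fun σ _ => continuousOn_const.mul
    (continuousOn_finsetProd _ fun i _ => ?_)
  by_cases hi : (i : ℕ) < r
  · simp only [if_pos hi]
    exact hη a _ _
  · simp only [if_neg hi]
    exact hζ a _ _

theorem fibreIntegral_apply [CompactSpace M] [T2Space M] {p : M}
    {η ζ : M × M → ((Fin n → ℂ) × (Fin n → ℂ)) [⋀^Fin 2]→L[ℝ] ℝ} (hη : HasContinuousFibre p η)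
    (hζ : HasContinuousFibre p ζ) {r s : ℕ} (hrs : r + s = n + 1)
    (h : 2 * r + 2 * s = 2 + 2 * n) (u : Fin 2 → (Fin n → ℂ)) :
    fibreIntegral (k := 2) (fun q => wedge h (wedgePow (η q) r) (wedgePow (ζ q) s)) p u =
      topIntegral fun y w =>
        wedge h (wedgePow (η (p, y)) r) (wedgePow (ζ (p, y)) s) (fibreTuple w u) := by
  have hc : HasContinuousDensity fun (y : M) w =>
      (contract (2 * n) (fun j => ((0 : Fin n → ℂ), w j)) (wedge h (wedgePow (η (p, y)) r)
        (wedgePow (ζ (p, y)) s))).compContinuousLinearMap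
        (ContinuousLinearMap.inl ℝ (Fin n → ℂ) (Fin n → ℂ)) := by
    intro a
    refine continuousOn_alternating fun u => ?_
    refine (hasContinuousDensity_wedge hη hζ hrs h u a).congr fun z _ => ?_
    exact contract_inl _ _ _
  have h1 := topIntegral_clm (ContinuousAlternatingMap.apply ℝ (Fin n → ℂ) ℝ u) hc
  refine Eq.trans h1.symm ?_
  congr 1
  funext y w
  exact contract_inl _ _ _

/-- The coefficients of the push-forward. -/
def pushCoeff (n k : ℕ) : ℝ :=
  (-1 : ℝ) ^ k * ((n.factorial : ℝ) / ((n - 2 * k).factorial * (2 * k + 1).factorial))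

/-- The integrand of the push-forward, evaluated on tangent vectors of the base. -/
def pushIntegrand (χ : M → (Fin n → ℂ) [⋀^Fin 2]→L[ℝ] ℝ)
    (η : M × M → ((Fin n → ℂ) × (Fin n → ℂ)) [⋀^Fin 2]→L[ℝ] ℝ) (p : M)
    (u : Fin 2 → (Fin n → ℂ)) (y : M) (w : Fin (2 * n) → (Fin n → ℂ)) : ℝ :=
  ∑ k : Fin ((n - 1) / 2 + 1), pushCoeff n k * wedge (by have := k.2; omega)
    (wedgePow (η (p, y)) (n - 2 * (k : ℕ))) (wedgePow (pull₂ n χ (p, y)) (2 * (k : ℕ) + 1))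
      (fibreTuple w u)

theorem hasContinuousDensity_pushIntegrand (hn : 0 < n)
    {χ : M → (Fin n → ℂ) [⋀^Fin 2]→L[ℝ] ℝ}
    (hχ : IsCyclicClosed 𝓘(ℝ, Fin n → ℂ) χ) {p : M}
    {η : M × M → ((Fin n → ℂ) × (Fin n → ℂ)) [⋀^Fin 2]→L[ℝ] ℝ} (hη : HasContinuousFibre p η)
    (u : Fin 2 → (Fin n → ℂ)) : HasContinuousDensity (pushIntegrand χ η p u) := by
  refine HasContinuousDensity.sum _ fun k _ => HasContinuousDensity.smul ?_ (pushCoeff n k)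
  exact hasContinuousDensity_wedge hη (hasContinuousFibre_pull₂ p hχ)
    (by have := k.2; omega) (by have := k.2; omega) u

theorem normalisedPush_apply [CompactSpace M] [T2Space M] (hn : 0 < n) (C : ℝ)
    {χ : M → (Fin n → ℂ) [⋀^Fin 2]→L[ℝ] ℝ}
    (hχ : IsCyclicClosed 𝓘(ℝ, Fin n → ℂ) χ) {p : M}
    {η : M × M → ((Fin n → ℂ) × (Fin n → ℂ)) [⋀^Fin 2]→L[ℝ] ℝ} (hη : HasContinuousFibre p η)
    (u : Fin 2 → (Fin n → ℂ)) :
    normalisedPush n C χ η p u =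
      (formIntegral fun x => imForm (wedgePow (complexForm (C • χ x) (χ x)) n))⁻¹ *
        topIntegral (pushIntegrand χ η p u) := by
  have h1 : topIntegral (pushIntegrand χ η p u) = ∑ k : Fin ((n - 1) / 2 + 1),
      topIntegral fun y w => pushCoeff n k • wedge (by have := k.2; omega)
        (wedgePow (η (p, y)) (n - 2 * (k : ℕ))) (wedgePow (pull₂ n χ (p, y)) (2 * (k : ℕ) + 1))
          (fibreTuple w u) := by
    refine topIntegral_sum _ fun k _ => HasContinuousDensity.smul ?_ (pushCoeff n k)
    exact hasContinuousDensity_wedge hη (hasContinuousFibre_pull₂ p hχ)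
      (by have := k.2; omega) (by have := k.2; omega) u
  rw [h1, normalisedPush, ContinuousAlternatingMap.smul_apply, smul_eq_mul,
    ContinuousAlternatingMap.sum_apply]
  congr 1
  refine Finset.sum_congr rfl fun k _ => ?_
  rw [topIntegral_smul, ContinuousAlternatingMap.smul_apply, fibreIntegral_apply hη
    (hasContinuousFibre_pull₂ p hχ) (by have := k.2; omega) (by have := k.2; omega) u]
  rfl

/-- The rotation of the tangent vectors of the fibre. -/
def fibreRotation (n : ℕ) : Equiv.Perm (Fin (n + 1) × Fin 2) :=
  Equiv.prodCongrRight fun i => if (i : ℕ) < n then Equiv.swap 0 1 else 1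

/-- The signs of the rotation of the tangent vectors of the fibre. -/
def rotationSign (n : ℕ) (x : Fin (n + 1) × Fin 2) : ℝ :=
  if (x.1 : ℕ) < n ∧ x.2 = 0 then 1 else -1

theorem prod_rotationSign (n : ℕ) :
    ∏ x, rotationSign n x = ((Equiv.Perm.sign (fibreRotation n) : ℤ) : ℝ) := by
  rw [fibreRotation, Equiv.Perm.sign_prodCongrRight, Fin.prod_univ_castSucc,
    Fintype.prod_prod_type, Fin.prod_univ_castSucc]
  simp [rotationSign, Fin.prod_univ_two]

theorem frame_J {n : ℕ} (i : Fin n) :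
    J (frame n (pairEquiv rfl (i, 0))) = frame n (pairEquiv rfl (i, 1)) ∧
      J (frame n (pairEquiv rfl (i, 1))) = -frame n (pairEquiv rfl (i, 0)) := by
  have h : J (frame n (pairEquiv rfl (i, 0))) = frame n (pairEquiv rfl (i, 1)) := by
    rw [frame_pairEquiv, frame_pairEquiv]
    change Complex.I • (Pi.single i (if (0 : Fin 2) = 0 then 1 else Complex.I) : Fin n → ℂ) = _
    rw [← Pi.single_smul]
    simp
  exact ⟨h, by rw [← h, J_J]⟩

theorem J_prod (U : (Fin n → ℂ) × (Fin n → ℂ)) : J U = (J U.1, J U.2) := rfl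

/-- Applying `J` to every vector turns a base vector `J u` into `-u` and exchanges `e_i` with `√-1
e_i` up to sign. -/
theorem fibreModel_rotate (u : Fin 2 → (Fin n → ℂ)) (x : Fin (n + 1) × Fin 2) :
    J (fibreModel (fun i => J (u i)) x) = rotationSign n x • fibreModel u (fibreRotation n x) := by
  obtain ⟨i, a⟩ := x
  refine Fin.lastCases ?_ (fun i => ?_) i
  · have h1 : fibreRotation n (Fin.last n, a) = (Fin.last n, a) := by simp [fibreRotation]
    rw [h1, fibreModel, fibreModel, fibreTuple_last, fibreTuple_last, J_prod]
    simp [rotationSign, J_J]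
  · have h1 : fibreRotation n (i.castSucc, a) = (i.castSucc, Equiv.swap 0 1 a) := by
      simp [fibreRotation]
    rw [h1, fibreModel, fibreModel, fibreTuple_castSucc, fibreTuple_castSucc, J_prod]
    fin_cases a
    · simp [rotationSign, (frame_J i).1]
    · simp [rotationSign, (frame_J i).2]

/-- As the forms are of type (1,1), `J` may be applied to all vectors at once. This undoes `J` on
the base vectors up to sign and permutes the fibre frame; the signs agree with that of the
permutation by `prod_rotationSign`. -/
theorem density_wedge_J (hJ : IsHolomorphicAtlas 𝓘(ℝ, Fin n → ℂ) M) {p : M}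
    {η ζ : M × M → ((Fin n → ℂ) × (Fin n → ℂ)) [⋀^Fin 2]→L[ℝ] ℝ}
    (hη : ∀ y, IsOneOne (η (p, y))) (hζ : ∀ y, IsOneOne (ζ (p, y)))
    {r s : ℕ} (hrs : r + s = n + 1) (h : 2 * r + 2 * s = 2 + 2 * n) (u : Fin 2 → (Fin n → ℂ))
    {a : M} {z : Fin n → ℂ} (hz : z ∈ (extChartAt 𝓘(ℝ, Fin n → ℂ) a).target) :
    density (fun y w => wedge h (wedgePow (η (p, y)) r) (wedgePow (ζ (p, y)) s)
      (fibreTuple w fun i => J (u i))) a z =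
    density (fun y w => wedge h (wedgePow (η (p, y)) r) (wedgePow (ζ (p, y)) s)
      (fibreTuple w u)) a z := by
  rw [density_wedge p η ζ hrs h, density_wedge p η ζ hrs h]
  congr 1
  refine Eq.trans ?_ (psi_rotate _ (fibreRotation n) (rotationSign n) (prod_rotationSign n))
  congr 1
  funext i x y
  set Φ : (Fin n → ℂ) × (Fin n → ℂ) → (Fin n → ℂ) × (Fin n → ℂ) := fun U =>
    (U.1, symD 𝓘(ℝ, Fin n → ℂ) a z U.2) with hΦ
  have hΦJ : ∀ U, Φ (J U) = J (Φ U) := fun U => Prod.ext rfl (hJ a z hz U.2)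
  have hΦs : ∀ (c : ℝ) U, Φ (c • U) = c • Φ U := fun c U => Prod.ext rfl (map_smul _ c U.2)
  have key : ∀ α : ((Fin n → ℂ) × (Fin n → ℂ)) [⋀^Fin 2]→L[ℝ] ℝ, IsOneOne α →
      α ![Φ (fibreModel (fun i => J (u i)) x), Φ (fibreModel (fun i => J (u i)) y)] =
      rotationSign n x * rotationSign n y *
        α ![Φ (fibreModel u (fibreRotation n x)), Φ (fibreModel u (fibreRotation n y))] := by
    intro α hα
    rw [← hα, ← hΦJ, ← hΦJ, fibreModel_rotate, fibreModel_rotate, hΦs, hΦs, pair_smul_left,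
      pair_swap, pair_smul_left, pair_swap]
    ring
  simp only [hΦ] at key
  split_ifs
  · exact key _ (hη _)
  · exact key _ (hζ _)

theorem isOneOne_normalisedPush [CompactSpace M] [T2Space M]
    (hJ : IsHolomorphicAtlas 𝓘(ℝ, Fin n → ℂ) M) (hn : 0 < n) (C : ℝ)
    {χ : M → (Fin n → ℂ) [⋀^Fin 2]→L[ℝ] ℝ} (hχ : IsCyclicClosed 𝓘(ℝ, Fin n → ℂ) χ)
    (hχ1 : ∀ y, IsOneOne (χ y)) {p : M}
    {η : M × M → ((Fin n → ℂ) × (Fin n → ℂ)) [⋀^Fin 2]→L[ℝ] ℝ} (hη : HasContinuousFibre p η)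
    (hη1 : ∀ y, IsOneOne (η (p, y))) : IsOneOne (normalisedPush n C χ η p) := by
  intro u v
  rw [normalisedPush_apply hn C hχ hη, normalisedPush_apply hn C hχ hη]
  congr 1
  refine topIntegral_congr fun a z hz => ?_
  change ∑ k : Fin ((n - 1) / 2 + 1), pushCoeff n k * density (fun y w => wedge _
    (wedgePow (η (p, y)) (n - 2 * (k : ℕ))) (wedgePow (pull₂ n χ (p, y)) (2 * (k : ℕ) + 1))
      (fibreTuple w ![J u, J v])) a z = ∑ k : Fin ((n - 1) / 2 + 1), pushCoeff n k *
    density (fun y w => wedge _ (wedgePow (η (p, y)) (n - 2 * (k : ℕ)))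
      (wedgePow (pull₂ n χ (p, y)) (2 * (k : ℕ) + 1)) (fibreTuple w ![u, v])) a z
  refine Finset.sum_congr rfl fun k _ => ?_
  have e : ![J u, J v] = fun i => J (![u, v] i) := by
    funext i
    fin_cases i <;> rfl
  rw [e, density_wedge_J hJ hη1 (fun y => isOneOne_pull₂ (hχ1 y) p) (by have := k.2; omega)
    (by have := k.2; omega) _ hz]

end Fibre

/-! ### The integrands of the push-forward as bordered determinants -/

section FibreDensity

open Set Matrix

variable {n : ℕ} {M : Type*} [TopologicalSpace M] [ChartedSpace (Fin n → ℂ) M]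

/-- The complex frame of a chart. -/
def chartFrame (a : M) (z : Fin n → ℂ) (j : Fin n) : Fin n → ℂ :=
  symD 𝓘(ℝ, Fin n → ℂ) a z (Pi.single j 1)

theorem symD_frame (hJ : IsHolomorphicAtlas 𝓘(ℝ, Fin n → ℂ) M) {a : M} {z : Fin n → ℂ}
    (hz : z ∈ (extChartAt 𝓘(ℝ, Fin n → ℂ) a).target) (x : Fin n × Fin 2) :
    symD 𝓘(ℝ, Fin n → ℂ) a z (frame n (pairEquiv rfl x)) = realFrame (chartFrame a z) x := by
  obtain ⟨i, b⟩ := x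
  have h0 : frame n (pairEquiv rfl (i, 0)) = Pi.single i 1 := by simp [frame_pairEquiv]
  fin_cases b
  · change symD 𝓘(ℝ, Fin n → ℂ) a z (frame n (pairEquiv rfl (i, 0))) = _
    rw [h0]
    rfl
  · change symD 𝓘(ℝ, Fin n → ℂ) a z (frame n (pairEquiv rfl (i, 1))) = _
    rw [← (frame_J i).1, h0, hJ a z hz]
    rfl

theorem symD_surjective [IsManifold 𝓘(ℝ, Fin n → ℂ) ∞ M] {a : M} {z : Fin n → ℂ}
    (hz : z ∈ (extChartAt 𝓘(ℝ, Fin n → ℂ) a).target) :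
    Function.Surjective (symD 𝓘(ℝ, Fin n → ℂ) a z) := by
  set x := (extChartAt 𝓘(ℝ, Fin n → ℂ) a).symm z with hx
  have h1 : (extChartAt 𝓘(ℝ, Fin n → ℂ) x).symm (extChartAt 𝓘(ℝ, Fin n → ℂ) x x) ∈
      (extChartAt 𝓘(ℝ, Fin n → ℂ) a).source := by
    rw [extChartAt_to_inv]
    exact (extChartAt 𝓘(ℝ, Fin n → ℂ) a).map_target hz
  have h2 := symD_transition 𝓘(ℝ, Fin n → ℂ) (mem_extChartAt_target x) h1
  have h3 : transition 𝓘(ℝ, Fin n → ℂ) x a (extChartAt 𝓘(ℝ, Fin n → ℂ) x x) = z := by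
    rw [transition, Function.comp_apply, extChartAt_to_inv, hx]
    exact (extChartAt 𝓘(ℝ, Fin n → ℂ) a).right_inv hz
  rw [symD_self, h3] at h2
  intro v
  exact ⟨_, (DFunLike.congr_fun h2 v).symm⟩

theorem linearIndependent_chartFrame [IsManifold 𝓘(ℝ, Fin n → ℂ) ∞ M]
    (hJ : IsHolomorphicAtlas 𝓘(ℝ, Fin n → ℂ) M) {a : M} {z : Fin n → ℂ}
    (hz : z ∈ (extChartAt 𝓘(ℝ, Fin n → ℂ) a).target) :
    LinearIndependent ℂ (chartFrame a z) := by
  let L : (Fin n → ℂ) →ₗ[ℂ] (Fin n → ℂ) :=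
    { toFun := symD 𝓘(ℝ, Fin n → ℂ) a z
      map_add' := map_add _
      map_smul' := fun c v => by
        have hc : ∀ v : Fin n → ℂ, c • v = c.re • v + c.im • J v := by
          intro v
          conv_lhs => rw [← Complex.re_add_im c]
          rw [add_smul, mul_smul]
          rfl
        rw [hc, map_add, map_smul, map_smul, hJ a z hz, RingHom.id_apply, hc] }
  have hL : Function.Surjective L := symD_surjective hz
  have h := (Pi.basisFun ℂ (Fin n)).linearIndependent.map' L
    (LinearMap.ker_eq_bot.2 (LinearMap.injective_iff_surjective.2 hL))
  have he : chartFrame a z = L ∘ Pi.basisFun ℂ (Fin n) := by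
    funext j
    simp [chartFrame, L]
  rw [he]
  exact h

theorem density_wedgePow_det (hJ : IsHolomorphicAtlas 𝓘(ℝ, Fin n → ℂ) M)
    {β χ : M → (Fin n → ℂ) [⋀^Fin 2]→L[ℝ] ℝ} (hβ : ∀ y, IsOneOne (β y)) (hχ : ∀ y, IsOneOne (χ y))
    {a : M} {z : Fin n → ℂ} (hz : z ∈ (extChartAt 𝓘(ℝ, Fin n → ℂ) a).target) :
    density (fun y w => wedgePow (complexForm (β y) (χ y)) n w) a z =
      ((2 ^ n * n.factorial : ℝ) : ℂ) * ((of fun i j =>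
          realHermForm (β ((extChartAt 𝓘(ℝ, Fin n → ℂ) a).symm z))
          (chartFrame a z i) (chartFrame a z j)) + Complex.I • (of fun i j =>
          realHermForm (χ ((extChartAt 𝓘(ℝ, Fin n → ℂ) a).symm z))
          (chartFrame a z i) (chartFrame a z j))).det := by
  rw [density, wedgePow_realFrame (complexForm_J (hβ _) (hχ _)) (chartFrame a z) _
    (symD_frame hJ hz)]
  push_cast
  congr 2
  ext i j
  rw [of_apply, hermForm_complexForm]
  rfl

/-- The frame of the tangent space of `M × M` given by a frame of the fibre and a vector of the
base. -/
def snocFrame (e : Fin n → (Fin n → ℂ)) (u : Fin n → ℂ) :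
    Fin (n + 1) → (Fin n → ℂ) × (Fin n → ℂ) :=
  Fin.snoc (α := fun _ => (Fin n → ℂ) × (Fin n → ℂ)) (fun j => (0, e j)) (u, 0)

theorem snocFrame_castSucc (e : Fin n → (Fin n → ℂ)) (u : Fin n → ℂ) (j : Fin n) :
    snocFrame e u j.castSucc = (0, e j) := by simp [snocFrame]

theorem snocFrame_last (e : Fin n → (Fin n → ℂ)) (u : Fin n → ℂ) :
    snocFrame e u (Fin.last n) = (u, 0) := by simp [snocFrame]

theorem realHermForm_pull₂ (χ : M → (Fin n → ℂ) [⋀^Fin 2]→L[ℝ] ℝ) (p y : M)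
    (U V : (Fin n → ℂ) × (Fin n → ℂ)) :
    realHermForm (pull₂ n χ (p, y)) U V = realHermForm (χ y) U.2 V.2 := by
  rw [realHermForm_apply, realHermForm_apply, pull₂_pair, pull₂_pair]
  rfl

theorem realHermForm_pull₁ (χ : M → (Fin n → ℂ) [⋀^Fin 2]→L[ℝ] ℝ) (p y : M)
    (U V : (Fin n → ℂ) × (Fin n → ℂ)) :
    realHermForm (pull₁ n χ (p, y)) U V = realHermForm (χ p) U.1 V.1 := by
  rw [realHermForm_apply, realHermForm_apply, pull₁_pair, pull₁_pair]
  rfl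

theorem realHermForm_zero_left {E : Type*} [NormedAddCommGroup E] [NormedSpace ℝ E]
    [NormedSpace ℂ E] [IsScalarTower ℝ ℂ E] (α : E [⋀^Fin 2]→L[ℝ] ℝ) (v : E) :
    realHermForm α 0 v = 0 := by
  have h : ∀ v, α ![0, v] = 0 := fun v => by
    have := pair_smul_left α 0 0 v
    rwa [zero_smul, zero_mul] at this
  rw [realHermForm_apply, h, h]
  simp

theorem realHermForm_zero_right {E : Type*} [NormedAddCommGroup E] [NormedSpace ℝ E]
    [NormedSpace ℂ E] [IsScalarTower ℝ ℂ E] {α : E [⋀^Fin 2]→L[ℝ] ℝ} (hα : IsOneOne α) (v : E) :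
    realHermForm α v 0 = 0 := by
  rw [← realHermForm_conj hα, realHermForm_zero_left, star_zero]

/-- The coefficient of the integrand of the push-forward as a bordered determinant. -/
theorem density_pushIntegrand (hJ : IsHolomorphicAtlas 𝓘(ℝ, Fin n → ℂ) M) (hn : 0 < n)
    {χ : M → (Fin n → ℂ) [⋀^Fin 2]→L[ℝ] ℝ} (hχ : ∀ y, IsOneOne (χ y)) {p : M}
    {η : M × M → ((Fin n → ℂ) × (Fin n → ℂ)) [⋀^Fin 2]→L[ℝ] ℝ} (hη : ∀ y, IsOneOne (η (p, y)))
    (u : Fin n → ℂ) {a y : M} {z : Fin n → ℂ}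
    (hz : z ∈ (extChartAt 𝓘(ℝ, Fin n → ℂ) a).target)
    (hy : (extChartAt 𝓘(ℝ, Fin n → ℂ) a).symm z = y) :
    density (pushIntegrand χ η p ![u, J u]) a z = 2 ^ (n + 1) * n.factorial *
      (border (realHermForm (η (p, y)) (u, 0) (u, 0))
        (fun k => realHermForm (η (p, y)) (0, chartFrame a z k) (u, 0))
        ((of fun i j => realHermForm (η (p, y)) (0, chartFrame a z i) (0, chartFrame a z j)) +
          Complex.I • of fun i j =>
            realHermForm (χ y) (chartFrame a z i) (chartFrame a z j))).det.im := by
  set e := snocFrame (chartFrame a z) u with he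
  have hv : ∀ x, fibreTuple (fun j => symD 𝓘(ℝ, Fin n → ℂ) a z (frame n j)) ![u, J u]
      (pairEquiv (by ring) x) = realFrame e x := by
    rintro ⟨i, b⟩
    refine Fin.lastCases ?_ (fun i => ?_) i
    · rw [fibreTuple_last]
      fin_cases b
      · simp [realFrame, he, snocFrame_last]
      · simp [realFrame, he, snocFrame_last, J_prod]
    · rw [fibreTuple_castSucc, symD_frame hJ hz]
      fin_cases b
      · simp [realFrame, he, snocFrame_castSucc]
      · simp [realFrame, he, snocFrame_castSucc, J_prod]
  -- `π₂^*χ` is degenerate: it annihilates the base vector `(u, 0)`.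
  have hdeg : (of fun i j => hermForm (complexForm (pull₂ n χ (p, y)) 0) (e i) (e j)).det = 0 := by
    refine det_eq_zero_of_row_eq_zero (Fin.last n) fun j => ?_
    change realHermForm (pull₂ n χ (p, y)) (e (Fin.last n)) (e j) = 0
    rw [he, snocFrame_last, realHermForm_pull₂, realHermForm_zero_left]
  have h1 := sum_wedge_realFrame hn (hη y) (isOneOne_pull₂ (hχ y) p) e _ hv hdeg
  refine Eq.trans ?_ (h1.trans ?_)
  · rw [density, hy]
    rfl
  congr 2
  -- The base vector is last in the frame but first in `border`; simultaneous reordering leaves the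
  -- determinant unchanged.
  let ε : Unit ⊕ Fin n ≃ Fin (n + 1) :=
    (Equiv.sumComm _ _).trans ((Equiv.optionEquivSumPUnit (Fin n)).symm.trans finSuccEquivLast.symm)
  have ε1 : ∀ x, ε (Sum.inl x) = Fin.last n := fun _ => by simp [ε]
  have ε2 : ∀ j, ε (Sum.inr j) = j.castSucc := fun _ => by simp [ε]
  rw [← det_submatrix_equiv_self ε]
  congr 1
  ext x y'
  have hh : ∀ U V, hermForm (complexForm (η (p, y)) (pull₂ n χ (p, y))) U V =
      realHermForm (η (p, y)) U V + Complex.I * realHermForm (χ y) U.2 V.2 := by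
    intro U V
    rw [hermForm_complexForm, ← realHermForm_pull₂ χ p]
    rfl
  rw [submatrix_apply, of_apply, hh]
  rcases x with x | x <;> rcases y' with y' | y' <;>
    simp only [ε1, ε2, he, snocFrame_last, snocFrame_castSucc, border, fromBlocks_apply₁₁,
      fromBlocks_apply₁₂, fromBlocks_apply₂₁, fromBlocks_apply₂₂, of_apply,
      realHermForm_zero_left, realHermForm_zero_right (hχ y), mul_zero, add_zero,
      realHermForm_conj (hη y), Matrix.add_apply, Matrix.smul_apply, smul_eq_mul]

/-- The pointwise estimate on the product. -/
theorem pointwise_estimate (hn : 0 < n)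
    {χ : M → (Fin n → ℂ) [⋀^Fin 2]→L[ℝ] ℝ} (hχ : ∀ y, IsOneOne (χ y))
    (hχp : ∀ y, IsPositive (χ y)) {θ Θ : ℝ} (hθ : θ ≤ Real.pi) (hΘ : Θ ≤ Real.pi)
    {η : M × M → ((Fin n → ℂ) × (Fin n → ℂ)) [⋀^Fin 2]→L[ℝ] ℝ}
    (hη : MemGamma ((Pi.basisFun ℂ (Fin n)).prod (Pi.basisFun ℂ (Fin n)))
      (pull₁ n χ + pull₂ n χ) θ Θ η) {p y : M} {u : Fin n → (Fin n → ℂ)}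
    (hu : (of fun i j => realHermForm (χ p) (u i) (u j)) = (1 : Matrix (Fin n) (Fin n) ℂ))
    {e : Fin n → (Fin n → ℂ)} (he : LinearIndependent ℂ e) {D : Matrix (Fin n) (Fin n) ℂ}
    (hD : D = (of fun i j => realHermForm (η (p, y)) (0, e i) (0, e j)) +
      Complex.I • of fun i j => realHermForm (χ y) (e i) (e j)) {N : Fin n → ℝ}
    (hN : ∀ i, N i = (border (realHermForm (η (p, y)) (u i, 0) (u i, 0))
        (fun k => realHermForm (η (p, y)) (0, e k) (u i, 0)) D).det.im) :
    0 < D.det.im ∧ ∑ i, arccot (N i / D.det.im) + arccot (D.det.re / D.det.im) < Θ ∧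
      ∀ j, ∑ i ∈ Finset.univ.erase j, arccot (N i / D.det.im) +
        arccot (D.det.re / D.det.im) < θ := by
  have : Nonempty (Fin n) := ⟨⟨0, hn⟩⟩
  obtain ⟨hη1, hηΓ⟩ := hη (p, y)
  set b := (Pi.basisFun ℂ (Fin n)).prod (Pi.basisFun ℂ (Fin n)) with hb
  set f : Fin n ⊕ Fin n → (Fin n → ℂ) × (Fin n → ℂ) :=
    Sum.elim (fun i => (u i, 0)) fun j => (0, e j) with hf
  set T : Matrix (Fin n ⊕ Fin n) (Fin n ⊕ Fin n) ℂ := of fun i k => b.repr (f i) k with hT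
  have hfT : ∀ i, ∑ k, T i k • b k = f i := fun i => b.sum_repr (f i)
  have hfam : ∀ {α : ((Fin n → ℂ) × (Fin n → ℂ)) [⋀^Fin 2]→L[ℝ] ℝ}, IsOneOne α →
      (of fun i j => realHermForm α (f i) (f j)) = T * hermMatrix b α * Tᴴ := by
    intro α hα
    have := realHermForm_family hα b T
    simp only [hfT] at this
    rw [this, hermMatrix_eq]
  have hX1 : IsOneOne ((pull₁ n χ + pull₂ n χ) (p, y)) := fun U V =>
    congrArg₂ (· + ·) (isOneOne_pull₁ (hχ p) y U V) (isOneOne_pull₂ (hχ y) p U V)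
  have hadd : ∀ U V, realHermForm ((pull₁ n χ + pull₂ n χ) (p, y)) U V =
      realHermForm (χ p) U.1 V.1 + realHermForm (χ y) U.2 V.2 := by
    intro U V
    rw [← realHermForm_pull₁ χ p y, ← realHermForm_pull₂ χ p y]
    simp only [realHermForm_apply, Pi.add_apply, ContinuousAlternatingMap.add_apply]
    push_cast
    ring
  -- In the adapted frame the product metric has no mixed terms, and its base block is the identity
  -- because the `u_i` are orthonormal.
  have hX : T * hermMatrix b ((pull₁ n χ + pull₂ n χ) (p, y)) * Tᴴ = fromBlocks 1 0 0
      (of fun i j => realHermForm (χ y) (e i) (e j)) := by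
    rw [← hfam hX1]
    ext i j
    rw [of_apply, hadd]
    have hu' : ∀ i j, realHermForm (χ p) (u i) (u j) = (1 : Matrix (Fin n) (Fin n) ℂ) i j :=
      fun i j => congrFun (congrFun hu i) j
    rcases i with i | i <;> rcases j with j | j <;>
      simp [hf, hu', realHermForm_zero_left, realHermForm_zero_right (hχ p),
        realHermForm_zero_right (hχ y)]
  refine sum_arccot_family_lt (posDef_realHermForm (hχ y) (hχp y) he) hX hθ hΘ hηΓ (hfam hη1) ?_ hN
  rw [hD]
  rfl

end FibreDensity

/-! ### Averages of points of a convex set -/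

section Average

open Set

variable {n : ℕ} {M : Type*} [TopologicalSpace M] [ChartedSpace (Fin n → ℂ) M] [CompactSpace M]
  [T2Space M] [Nonempty M]

/-- Averages of points of an open convex set remain in it. -/
theorem average_mem {ι : Type*} [Fintype ι] {Ω : Set (ι → ℝ)} (hc : Convex ℝ Ω) (ho : IsOpen Ω)
    {G : ι → M → (Fin (2 * n) → (Fin n → ℂ)) → ℝ} {g : M → (Fin (2 * n) → (Fin n → ℂ)) → ℝ}
    (hG : ∀ k, HasContinuousDensity (G k)) (hg : HasContinuousDensity g)
    (hpos : ∀ a, ∀ z ∈ (extChartAt 𝓘(ℝ, Fin n → ℂ) a).target, 0 < density g a z)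
    (hmem : ∀ a, ∀ z ∈ (extChartAt 𝓘(ℝ, Fin n → ℂ) a).target,
      (fun k => density (G k) a z / density g a z) ∈ Ω) :
    (fun k => topIntegral (G k) / topIntegral g) ∈ Ω := by
  classical
  by_contra hnot
  -- A functional `ℓ` separating the average `x₀` from `Ω` makes `ℓ(x₀) g - ∑ ℓ_k G_k` pointwise
  -- positive, while its integral is zero by the definition of `x₀`.
  obtain ⟨ℓ, hℓ⟩ := geometric_hahn_banach_open_point hc ho hnot
  set x₀ : ι → ℝ := fun k => topIntegral (G k) / topIntegral g with hx₀
  have hexp : ∀ x, ℓ x = ∑ k, ℓ (Pi.single k 1) * x k := by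
    intro x
    have h1 : x = ∑ k, x k • (Pi.single k 1 : ι → ℝ) := by
      funext i
      simp [Finset.sum_apply, Pi.single_apply]
    conv_lhs => rw [h1]
    rw [map_sum]
    refine Finset.sum_congr rfl fun k _ => ?_
    rw [map_smul, smul_eq_mul, mul_comm]
  have hgp := topIntegral_pos hg hpos
  have hGs := HasContinuousDensity.sum Finset.univ fun k _ => (hG k).smul (-ℓ (Pi.single k 1))
  have hlt : 0 < topIntegral fun y w =>
      ℓ x₀ • g y w + ∑ k, (-ℓ (Pi.single k 1)) • G k y w := by
    refine topIntegral_pos ((hg.smul _).add hGs) fun a z hz => ?_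
    have h1 := hℓ _ (hmem a z hz)
    have h2 := hpos a z hz
    rw [hexp] at h1
    have h3 : (∑ k, ℓ (Pi.single k 1) * (density (G k) a z / density g a z)) * density g a z =
        ∑ k, ℓ (Pi.single k 1) * density (G k) a z := by
      rw [Finset.sum_mul]
      refine Finset.sum_congr rfl fun k _ => ?_
      field_simp
    have h4 := mul_lt_mul_of_pos_right h1 h2
    rw [h3] at h4
    change 0 < ℓ x₀ * density g a z + ∑ k, (-ℓ (Pi.single k 1)) * density (G k) a z
    simp only [neg_mul, Finset.sum_neg_distrib]
    linarith
  rw [topIntegral_add (hg.smul _) hGs, topIntegral_smul,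
    topIntegral_sum _ fun k _ => (hG k).smul (-ℓ (Pi.single k 1))] at hlt
  simp only [topIntegral_smul] at hlt
  simp only [smul_eq_mul, neg_mul, Finset.sum_neg_distrib] at hlt
  have h5 : ℓ x₀ * topIntegral g = ∑ k, ℓ (Pi.single k 1) * topIntegral (G k) := by
    rw [hexp x₀, Finset.sum_mul]
    refine Finset.sum_congr rfl fun k _ => ?_
    rw [hx₀, mul_assoc, div_mul_cancel₀ _ hgp.ne']
  linarith

end Average

/-! ### The argument of `(C + √-1)ⁿ` -/

section Phase

/-- The phase of `(C + √-1)ⁿ`. -/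
theorem arccot_re_div_im_pow {n : ℕ} (hn : 0 < n) {C : ℝ} (h : n * arccot C < Real.pi) :
    0 < (((C : ℂ) + Complex.I) ^ n).im ∧
      arccot ((((C : ℂ) + Complex.I) ^ n).re / (((C : ℂ) + Complex.I) ^ n).im) = n * arccot C := by
  have hs := sin_arccot_pos C
  -- `C + √-1` has argument `arccot C` and modulus `1 / sin (arccot C)`.
  have h1 : ((Real.sin (arccot C) : ℝ) : ℂ) * ((C : ℂ) + Complex.I) =
      Complex.exp ((arccot C : ℝ) * Complex.I) := by
    rw [Complex.exp_mul_I, ← Complex.ofReal_cos, ← Complex.ofReal_sin, cos_arccot_eq]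
    push_cast
    ring
  have h2 : ((Real.sin (arccot C) ^ n : ℝ) : ℂ) * ((C : ℂ) + Complex.I) ^ n =
      Complex.exp ((n * arccot C : ℝ) * Complex.I) := by
    push_cast
    rw [← mul_pow, ← Complex.ofReal_sin, h1, ← Complex.exp_nat_mul]
    congr 1
    ring
  have hre := congrArg Complex.re h2
  have him := congrArg Complex.im h2
  rw [Complex.re_ofReal_mul, Complex.exp_ofReal_mul_I_re] at hre
  rw [Complex.im_ofReal_mul, Complex.exp_ofReal_mul_I_im] at him
  have hsn : 0 < Real.sin (arccot C) ^ n := pow_pos hs n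
  have h0 : 0 < n * arccot C := mul_pos (by exact_mod_cast hn) (arccot_pos C)
  have hsin := Real.sin_pos_of_pos_of_lt_pi h0 h
  have hpos : 0 < (((C : ℂ) + Complex.I) ^ n).im := by
    rw [← him] at hsin
    exact pos_of_mul_pos_right hsin hsn.le
  refine ⟨hpos, arccot_eq_of h0 h ?_⟩
  rw [← hre, ← him]
  field_simp

end Phase

/-! ### The integral of the constant model on the fibre -/

section Volume

open Set Matrix
open scoped ComplexOrder

variable {n : ℕ} {M : Type*} [TopologicalSpace M] [ChartedSpace (Fin n → ℂ) M] [CompactSpace M]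
  [T2Space M] [IsManifold 𝓘(ℂ, Fin n → ℂ) ∞ M]

attribute [local instance] isManifold_real

/-- The integral of `(C χ + √-1 χ)ⁿ` is a positive multiple of `(C + √-1)ⁿ`. -/
theorem exists_topIntegral_wedgePow [Nonempty M] {χ : M → (Fin n → ℂ) [⋀^Fin 2]→L[ℝ] ℝ}
    (hχ : IsKahlerForm 𝓘(ℝ, Fin n → ℂ) χ) (C : ℝ) :
    ∃ V : ℝ, 0 < V ∧ topIntegral (fun y w => wedgePow (complexForm ((C • χ) y) (χ y)) n w) =
      V * ((C : ℂ) + Complex.I) ^ n := by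
  have hJ := isHolomorphicAtlas (Fin n → ℂ) M
  have hcl : IsCyclicClosed 𝓘(ℝ, Fin n → ℂ) χ := hχ.toIsClosedForm.isCyclicClosed
  have hC1 : ∀ y, IsOneOne ((C • χ) y) := fun y u v =>
    congrArg (C * ·) (hχ.oneOne y u v)
  set c : ℂ := ((C : ℂ) + Complex.I) ^ n with hc
  have hc0 : c ≠ 0 := by
    refine pow_ne_zero n fun h => ?_
    have := congrArg Complex.im h
    simp at this
  have hcont : HasContinuousDensity fun (y : M) w =>
      wedgePow (complexForm ((C • χ) y) (χ y)) n w := hasContinuousDensity_wedgePow (hcl.smul _ C) hcl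
  have hden : ∀ a : M, ∀ z ∈ (extChartAt 𝓘(ℝ, Fin n → ℂ) a).target, ∃ d : ℝ, 0 < d ∧
      density (fun y w => wedgePow (complexForm ((C • χ) y) (χ y)) n w) a z = c * d := by
    intro a z hz
    set A := (of fun i j => realHermForm (χ ((extChartAt 𝓘(ℝ, Fin n → ℂ) a).symm z))
          (chartFrame a z i) (chartFrame a z j)) with hA
    have hAp : A.PosDef := posDef_realHermForm (hχ.oneOne _) (hχ.positive _)
      (linearIndependent_chartFrame hJ hz)
    have hdp := Complex.pos_iff.1 hAp.det_pos
    have hAd : A.det = (A.det.re : ℂ) := Complex.ext rfl hdp.2.symm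
    refine ⟨2 ^ n * n.factorial * A.det.re, mul_pos (by positivity) hdp.1, ?_⟩
    have hD : (of fun i j => realHermForm ((C • χ) ((extChartAt 𝓘(ℝ, Fin n → ℂ) a).symm z))
          (chartFrame a z i) (chartFrame a z j)) + Complex.I • A =
          ((C : ℂ) + Complex.I) • A := by
      ext i j
      simp only [hA, Matrix.add_apply, Matrix.smul_apply, of_apply, realHermForm_apply,
        Pi.smul_apply, ContinuousAlternatingMap.smul_apply, smul_eq_mul]
      push_cast
      ring
    rw [density_wedgePow_det hJ hC1 hχ.oneOne hz, ← hA, hD, det_smul, Fintype.card_fin, ← hc]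
    push_cast
    rw [← hAd]
    ring
  -- Division by the constant `(C + √-1)ⁿ` leaves a positive real density, so the integral divided
  -- by it is real and positive.
  set L : ℂ →L[ℝ] ℂ := ContinuousLinearMap.mul ℝ ℂ c⁻¹ with hL
  have hLd : ∀ w, L w = c⁻¹ * w := fun w => rfl
  have hre := topIntegral_clm (Complex.reCLM.comp L) hcont
  have him := topIntegral_clm (Complex.imCLM.comp L) hcont
  set x := topIntegral (fun (y : M) w => wedgePow (complexForm ((C • χ) y) (χ y)) n w) with hx
  have h1 : 0 < (L x).re := by
    change 0 < (Complex.reCLM.comp L) x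
    rw [← hre]
    refine topIntegral_pos (fun a => (Complex.reCLM.comp L).continuous.comp_continuousOn (hcont a))
      fun a z hz => ?_
    obtain ⟨d, hd, hd2⟩ := hden a z hz
    change 0 < (L (density (fun y w => wedgePow (complexForm ((C • χ) y) (χ y)) n w) a z)).re
    rw [hd2, hLd, inv_mul_cancel_left₀ hc0]
    exact hd
  have h2 : (L x).im = 0 := by
    change (Complex.imCLM.comp L) x = 0
    rw [← him, topIntegral_congr (h := fun _ _ => (0 : ℝ))]
    · simp [topIntegral]
    · intro a z hz
      obtain ⟨d, -, hd2⟩ := hden a z hz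
      change (L (density (fun y w => wedgePow (complexForm ((C • χ) y) (χ y)) n w) a z)).im = 0
      rw [hd2, hLd, inv_mul_cancel_left₀ hc0, Complex.ofReal_im]
  refine ⟨(L x).re, h1, ?_⟩
  have h3 : ((L x).re : ℂ) = L x := Complex.ext rfl h2.symm
  rw [h3, hLd]
  field_simp

end Volume

end DHYM

end

/-! ### Assembly of the estimates at a point of the base -/

open DHYM

theorem proposition3p6 {n : ℕ} (hn : 0 < n)
    {M : Type*} [TopologicalSpace M] [T2Space M] [CompactSpace M]
    [ChartedSpace (Fin n → ℂ) M] [IsManifold 𝓘(ℂ, Fin n → ℂ) ∞ M]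
    (χ ω₀ : M → (Fin n → ℂ) [⋀^Fin 2]→L[ℝ] ℝ)
    (hχ : DHYM.IsKahlerForm 𝓘(ℝ, Fin n → ℂ) χ)
    (hω₀ : DHYM.IsClosedOneOneForm 𝓘(ℝ, Fin n → ℂ) ω₀)
    (θ₀ Θ₀ C₁₄ θ₁₅ Θ₁₆ Θ₁₇ Θ₁₈ : ℝ)
    (hθ₀ : 0 < θ₀) (hθΘ₀ : θ₀ < Θ₀) (hΘ₀ : Θ₀ < Real.pi)
    (hθ₁₅ : θ₁₅ = θ₀ + n * DHYM.arccot C₁₄)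
    (hΘ₁₆ : Θ₁₆ = Θ₁₇ + n * DHYM.arccot C₁₄)
    (hΘ₁₈ : Θ₁₈ = Θ₀ + n * DHYM.arccot C₁₄)
    (h₁ : θ₁₅ < Θ₁₆) (h₂ : Θ₁₆ < Θ₁₈) (h₃ : Θ₁₈ < Real.pi)
    (φ₁₉ : M × M → ℝ)
    (hφ₁₉ : ContMDiff (𝓘(ℝ, Fin n → ℂ).prod 𝓘(ℝ, Fin n → ℂ)) 𝓘(ℝ, ℝ) ∞ φ₁₉)
    (ω₁₉ : M × M → ((Fin n → ℂ) × (Fin n → ℂ)) [⋀^Fin 2]→L[ℝ] ℝ)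
    (hω₁₉ : ω₁₉ = DHYM.pull₁ n ω₀ + C₁₄ • DHYM.pull₂ n χ +
      DHYM.iddbar (𝓘(ℝ, Fin n → ℂ).prod 𝓘(ℝ, Fin n → ℂ)) φ₁₉)
    (hΓ : DHYM.MemGamma ((Pi.basisFun ℂ (Fin n)).prod (Pi.basisFun ℂ (Fin n)))
      (DHYM.pull₁ n χ + DHYM.pull₂ n χ) θ₁₅ Θ₁₆ ω₁₉) :
    DHYM.MemGamma (Pi.basisFun ℂ (Fin n)) χ θ₀ Θ₀ (DHYM.normalisedPush n C₁₄ χ ω₁₉) := by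
  have hman : IsManifold 𝓘(ℝ, Fin n → ℂ) ∞ M := isManifold_real (Fin n → ℂ) M
  have hJ := isHolomorphicAtlas (Fin n → ℂ) M
  have hcl : IsCyclicClosed 𝓘(ℝ, Fin n → ℂ) χ := hχ.toIsClosedForm.isCyclicClosed
  have hne : Nonempty (Fin n) := ⟨⟨0, hn⟩⟩
  intro p
  have hMne : Nonempty M := ⟨p⟩
  have hfib : HasContinuousFibre p ω₁₉ := by
    rw [hω₁₉]
    exact ((hasContinuousFibre_pull₁ p ω₀).add ((hasContinuousFibre_pull₂ p hcl).smul C₁₄)).add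
      (hasContinuousFibre_iddbar p hJ hφ₁₉)
  have hone : ∀ y, IsOneOne (ω₁₉ (p, y)) := fun y => (hΓ (p, y)).1
  have hpush := isOneOne_normalisedPush hJ hn C₁₄ hcl hχ.oneOne hfib hone
  refine ⟨hpush, ?_⟩
  -- The frame depends on the push-forward itself, which is legitimate since the pointwise estimates
  -- hold for every `χ`-orthonormal frame at `p`.
  obtain ⟨u, hu, hfin⟩ := exists_diagonal_frame (Pi.basisFun ℂ (Fin n)) (hχ.oneOne p)
    (hχ.positive p) hpush
  refine hfin θ₀ Θ₀ ?_
  -- the restriction of `ω₁₉` to the fibre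
  set φ : M → ℝ := fun y => φ₁₉ (p, y) with hφ
  have hφs : ContMDiff 𝓘(ℝ, Fin n → ℂ) 𝓘(ℝ, ℝ) ∞ φ :=
    hφ₁₉.comp (contMDiff_const.prodMk contMDiff_id)
  set β : M → (Fin n → ℂ) [⋀^Fin 2]→L[ℝ] ℝ := C₁₄ • χ + iddbar 𝓘(ℝ, Fin n → ℂ) φ with hβ
  have hβω : ∀ y v w, β y ![v, w] = ω₁₉ (p, y) ![((0 : Fin n → ℂ), v), ((0 : Fin n → ℂ), w)] := by
    intro y v w
    have e0 : ω₀ p ![(0 : Fin n → ℂ), 0] = 0 := by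
      have := pair_smul_left (ω₀ p) 0 0 0
      rwa [zero_smul, zero_mul] at this
    have e1 : ω₁₉ (p, y) ![((0 : Fin n → ℂ), v), ((0 : Fin n → ℂ), w)] =
        pull₁ n ω₀ (p, y) ![((0 : Fin n → ℂ), v), ((0 : Fin n → ℂ), w)] +
        C₁₄ * pull₂ n χ (p, y) ![((0 : Fin n → ℂ), v), ((0 : Fin n → ℂ), w)] +
        iddbar (𝓘(ℝ, Fin n → ℂ).prod 𝓘(ℝ, Fin n → ℂ)) φ₁₉ (p, y)
          ![((0 : Fin n → ℂ), v), ((0 : Fin n → ℂ), w)] := by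
      rw [hω₁₉]
      rfl
    rw [e1, pull₁_pair, pull₂_pair, iddbar_prod_right hJ hφ₁₉, e0, zero_add]
    rfl
  have hβ1 : ∀ y, IsOneOne (β y) := fun y v w => by
    have e : ∀ v : Fin n → ℂ, J ((0 : Fin n → ℂ), v) = (0, J v) := fun v => by
      rw [J_prod]
      simp
    rw [hβω, hβω, ← e, ← e]
    exact hone y _ _
  have hβh : ∀ y v w, realHermForm (β y) v w =
      realHermForm (ω₁₉ (p, y)) ((0 : Fin n → ℂ), v) ((0 : Fin n → ℂ), w) := fun y v w => by
    rw [realHermForm_apply, realHermForm_apply, hβω, hβω, J_prod]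
    simp
  have hβcl : IsCyclicClosed 𝓘(ℝ, Fin n → ℂ) β :=
    (hcl.smul _ C₁₄).add _ (isCyclicClosed_iddbar _ hJ hφs)
  set gC : M → (Fin (2 * n) → (Fin n → ℂ)) → ℂ := fun y w =>
    wedgePow (complexForm (β y) (χ y)) n w with hgC
  have hgCc : HasContinuousDensity gC := hasContinuousDensity_wedgePow hβcl hcl
  set g : M → (Fin (2 * n) → (Fin n → ℂ)) → ℝ := fun y w => Complex.imCLM (gC y w) with hg
  have hgc : HasContinuousDensity g := fun a =>
    Complex.imCLM.continuous.comp_continuousOn (hgCc a)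
  -- The index `none` carries the fibre phase, the indices `some i` the base directions. The factor
  -- `1 / 2` matches the volume factors `2^(n+1) n!` and `2^n n!`, and is also the one in the
  -- eigenvalue `η(u, J u) / 2`.
  set G : Option (Fin n) → M → (Fin (2 * n) → (Fin n → ℂ)) → ℝ := fun k =>
    k.elim (fun y w => Complex.reCLM (gC y w))
      fun i y w => (1 / 2 : ℝ) • pushIntegrand χ ω₁₉ p ![u i, J (u i)] y w with hG
  have hGc : ∀ k, HasContinuousDensity (G k) := by
    rintro (_ | i)
    · exact fun a => Complex.reCLM.continuous.comp_continuousOn (hgCc a)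
    · exact (hasContinuousDensity_pushIntegrand hn hcl hfib _).smul _
  -- the integrals
  obtain ⟨V, hV, hVint⟩ := exists_topIntegral_wedgePow hχ C₁₄
  -- The `√-1 ∂∂̄ φ` term does not affect the integral, leaving the model `C₁₄ χ`.
  have hInt : topIntegral gC = V * ((C₁₄ : ℂ) + Complex.I) ^ n := by
    rw [← hVint]
    exact topIntegral_add_iddbar (hcl.smul _ C₁₄) hcl hφs
  have hTg : topIntegral g = V * (((C₁₄ : ℂ) + Complex.I) ^ n).im := by
    have := topIntegral_clm Complex.imCLM hgCc
    rw [hInt, Complex.imCLM_apply, Complex.im_ofReal_mul] at this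
    exact this
  have hTR : topIntegral (G none) = V * (((C₁₄ : ℂ) + Complex.I) ^ n).re := by
    have := topIntegral_clm Complex.reCLM hgCc
    rw [hInt, Complex.reCLM_apply, Complex.re_ofReal_mul] at this
    exact this
  have hdenom : (formIntegral fun x => imForm (wedgePow (complexForm (C₁₄ • χ x) (χ x)) n)) =
      topIntegral g := by
    have := topIntegral_clm Complex.imCLM (hasContinuousDensity_wedgePow (hcl.smul _ C₁₄) hcl)
    rw [hVint, Complex.imCLM_apply, Complex.im_ofReal_mul, ← hTg] at this
    exact this
  -- From `Θ₁₈ < π` and `Θ₀ > 0`.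
  have hnC : n * arccot C₁₄ < Real.pi := by linarith
  obtain ⟨hpow, hphase⟩ := arccot_re_div_im_pow hn hnC
  have hTnone : arccot (topIntegral (G none) / topIntegral g) = n * arccot C₁₄ := by
    rw [hTg, hTR, mul_div_mul_left _ _ hV.ne', hphase]
  have hTsome : ∀ i, topIntegral (G (some i)) / topIntegral g =
      normalisedPush n C₁₄ χ ω₁₉ p ![u i, J (u i)] / 2 := by
    intro i
    rw [normalisedPush_apply hn C₁₄ hcl hfib, hdenom]
    change topIntegral (fun y w => (1 / 2 : ℝ) • pushIntegrand χ ω₁₉ p ![u i, J (u i)] y w) / _ = _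
    rw [topIntegral_smul, smul_eq_mul]
    ring
  -- the pointwise estimates
  have hpt : ∀ a : M, ∀ z ∈ (extChartAt 𝓘(ℝ, Fin n → ℂ) a).target, 0 < density g a z ∧
      ∑ k, arccot (density (G k) a z / density g a z) < Θ₁₆ ∧
      ∀ j, ∑ k ∈ Finset.univ.erase (some j), arccot (density (G k) a z / density g a z) < θ₁₅ := by
    intro a z hz
    obtain ⟨y, hy⟩ : ∃ y, (extChartAt 𝓘(ℝ, Fin n → ℂ) a).symm z = y := ⟨_, rfl⟩
    set D : Matrix (Fin n) (Fin n) ℂ := (Matrix.of fun i j => realHermForm (ω₁₉ (p, y))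
      (0, chartFrame a z i) (0, chartFrame a z j)) + Complex.I • Matrix.of fun i j =>
        realHermForm (χ y) (chartFrame a z i) (chartFrame a z j) with hD
    set N : Fin n → ℝ := fun i => (border (realHermForm (ω₁₉ (p, y)) (u i, 0) (u i, 0))
      (fun k => realHermForm (ω₁₉ (p, y)) (0, chartFrame a z k) (u i, 0)) D).det.im with hN
    obtain ⟨k1, k2, k3⟩ := pointwise_estimate hn hχ.oneOne hχ.positive (by linarith) (by linarith)
      hΓ hu (linearIndependent_chartFrame hJ hz) hD (N := N) fun i => rfl
    set r : ℝ := 2 ^ n * n.factorial with hr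
    have hr0 : 0 < r := by positivity
    have hdC : density gC a z = (r : ℂ) * D.det := by
      rw [hgC, density_wedgePow_det hJ hβ1 hχ.oneOne hz, hy]
      simp only [hβh, hr, hD]
    have hdg : density g a z = r * D.det.im := by
      change (density gC a z).im = _
      rw [hdC, Complex.im_ofReal_mul]
    have hdR : density (G none) a z = r * D.det.re := by
      change (density gC a z).re = _
      rw [hdC, Complex.re_ofReal_mul]
    have hdN : ∀ i, density (G (some i)) a z = r * N i := by
      intro i
      change (1 / 2 : ℝ) • density (pushIntegrand χ ω₁₉ p ![u i, J (u i)]) a z = _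
      rw [density_pushIntegrand hJ hn hχ.oneOne hone (u i) hz hy, smul_eq_mul, hr, pow_succ]
      simp only [hN, hD]
      ring
    have q1 : density (G none) a z / density g a z = D.det.re / D.det.im := by
      rw [hdR, hdg, mul_div_mul_left _ _ hr0.ne']
    have q2 : ∀ i, density (G (some i)) a z / density g a z = N i / D.det.im := fun i => by
      rw [hdN, hdg, mul_div_mul_left _ _ hr0.ne']
    refine ⟨by rw [hdg]; exact mul_pos hr0 k1, ?_, fun j => ?_⟩
    · rw [Fintype.sum_option, q1]
      simp only [q2]
      linarith
    · have k4 := k3 j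
      rw [Finset.sum_erase_eq_sub (Finset.mem_univ _)] at k4 ⊢
      rw [Fintype.sum_option, q1]
      simp only [q2]
      linarith
  have hpos := fun a z hz => (hpt a z hz).1
  have hQ := average_mem (convex_sum_arccot_lt (by linarith : Θ₁₆ ≤ Real.pi)
    (Finset.univ : Finset (Option (Fin n)))) (isOpen_sum_arccot_lt Θ₁₆ _) hGc hgc hpos
    fun a z hz => (hpt a z hz).2.1
  -- Only `some j` is erased: the fibre phase stays in the sum and supplies the constant that
  -- separates `θ₁₅` from `θ₀`.
  have hP := fun j => average_mem (convex_sum_arccot_lt (by linarith : θ₁₅ ≤ Real.pi)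
    ((Finset.univ : Finset (Option (Fin n))).erase (some j))) (isOpen_sum_arccot_lt θ₁₅ _)
    hGc hgc hpos fun a z hz => (hpt a z hz).2.2 j
  rw [mem_Gamma_iff]
  refine ⟨fun j => ?_, ?_⟩
  · have h := hP j
    rw [Set.mem_ofPred_eq, Finset.sum_erase_eq_sub (Finset.mem_univ _), Fintype.sum_option,
      hTnone] at h
    simp only [hTsome] at h
    rw [Finset.sum_erase_eq_sub (Finset.mem_univ _)]
    linarith
  -- The averaged bound is `Θ₁₆`, and `Θ₁₆ < Θ₁₈ = Θ₀ + n arccot C₁₄`.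
  · have h := hQ
    rw [Set.mem_ofPred_eq, Fintype.sum_option, hTnone] at h
    simp only [hTsome] at h
    linarith
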